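/- A hypergraph $G$ has a finite nonempty vertex set $V(G)$ and a set $E(G)$ of nonempty subsets of $V(G)$, called edges; it is $k$-uniform if every edge has exactly $k$ vertices. A walk of length $p$ is a sequence $(v_0,e_1,v_1,\dots,e_p,v_p)$ with $v_{i-1},v_i\in e_i\in E(G)$ and $v_{i-1}\ne v_i$ for $1\le i\le p$; it is a path if all $v_i$ are distinct and all $e_i$ are distinct, and a cycle if $p\ge 2$, all $e_i$ are distinct, and all $v_i$ are distinct except that $v_0=v_p$. A hypertree is a hypergraph without cycles in which any two vertices are joined by a path. The distance of two vertices is the length of a shortest path between them, and the distance spectral radius $\rho(G)$ is the largest eigenvalue of the distance matrix of $G$. The degree of a vertex is the number of edges containing it. For integers $k\ge 2$, $L\ge 1$, $\Delta\ge 2$ and $a,b\ge 0$, let $C_k(L,\Delta,a,b)$ be the $k$-uniform hypergraph obtained from the $k$-uniform loose path $(u_0,e_1,u_1,\dots,e_L,u_L)$ (a $k$-uniform hypertree in which $u_1,\dots,u_{L-1}$ have degree $2$ and all other vertices have degree $1$) by attaching, at each $u_i$ with $1\le i\le L-1$ and ($i\le a$ or $i\ge L-b$), $\Delta-2$ new edges,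 each consisting of $u_i$ and $k-1$ new vertices. Let $k,m,n$ be integers with $k\ge 2$ and $2\le n\le\lfloor (m-1)/2\rfloor$, and consider the class of all $k$-uniform hypertrees that have $m$ edges and exactly $n$ vertices whose degree is the maximum degree of the hypertree, where the value of the maximum degree is not prescribed. Then $C=C_k(m-n,3,\lfloor n/2\rfloor,\lceil n/2\rceil)$ belongs to this class, and every $T$ in this class satisfies $\rho(T)\le\rho(C)$, with equality if and only if $T$ is isomorphic to $C$. -/

import Mathlib

namespace Hypergraph

variable {α : Type*} {β : Type*}

/-- `(v 0, e 0, v 1, …, e (p - 1), v p)` is a walk of length `p` in `H`. -/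
def IsWalk (H : Hypergraph α) {p : ℕ} (v : Fin (p + 1) → α) (e : Fin p → Set α) : Prop :=
  (∀ i, v i ∈ H.vertexSet) ∧
    ∀ i : Fin p, e i ∈ H.edgeSet ∧ v i.castSucc ∈ e i ∧ v i.succ ∈ e i ∧ v i.castSucc ≠ v i.succ

/-- A path is a walk whose vertices are distinct and whose edges are distinct. -/
def IsPath (H : Hypergraph α) {p : ℕ} (v : Fin (p + 1) → α) (e : Fin p → Set α) : Prop :=
  H.IsWalk v e ∧ Function.Injective v ∧ Function.Injective e

/-- A cycle is a walk with at least two edges whose edges are distinct and whose vertices are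
distinct except that the first and the last vertex coincide. -/
def IsCycle (H : Hypergraph α) {p : ℕ} (v : Fin (p + 1) → α) (e : Fin p → Set α) : Prop :=
  H.IsWalk v e ∧ 2 ≤ p ∧ Function.Injective e ∧
    Function.Injective (fun i : Fin p => v i.castSucc) ∧ v 0 = v (Fin.last p)

/-- There is a path of length `p` from `u` to `w` in `H`. -/
def HasPath (H : Hypergraph α) (u w : α) (p : ℕ) : Prop :=
  ∃ (v : Fin (p + 1) → α) (e : Fin p → Set α), H.IsPath v e ∧ v 0 = u ∧ v (Fin.last p) = w

/-- `H` has a vertex, and any two vertices of `H` are joined by a path. -/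
def IsConnected (H : Hypergraph α) : Prop :=
  H.vertexSet.Nonempty ∧ ∀ u ∈ H.vertexSet, ∀ w ∈ H.vertexSet, ∃ p, H.HasPath u w p

/-- A hypertree is a connected hypergraph without cycles. -/
def IsHypertree (H : Hypergraph α) : Prop :=
  H.IsConnected ∧ ∀ (p : ℕ) (v : Fin (p + 1) → α) (e : Fin p → Set α), ¬ H.IsCycle v e

/-- Every edge of `H` has exactly `k` vertices. -/
def IsUniform (H : Hypergraph α) (k : ℕ) : Prop :=
  ∀ e ∈ H.edgeSet, e.ncard = k

/-- The number of edges of `H` that contain `v`. -/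
noncomputable def degree (H : Hypergraph α) (v : α) : ℕ :=
  {e | e ∈ H.edgeSet ∧ v ∈ e}.ncard

/-- The vertices of `H` whose degree is the maximum degree of `H`. -/
def maxDegreeVertices (H : Hypergraph α) : Set α :=
  {v | v ∈ H.vertexSet ∧ ∀ w ∈ H.vertexSet, H.degree w ≤ H.degree v}

/-- The length of a shortest path from `u` to `w`. -/
noncomputable def dist (H : Hypergraph α) (u w : α) : ℕ :=
  sInf {p | H.HasPath u w p}

/-- The distance matrix, indexed by the vertices of `H`. -/
noncomputable def distMatrix (H : Hypergraph α) : Matrix H.vertexSet H.vertexSet ℝ :=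
  Matrix.of fun u w => (H.dist u w : ℝ)

/-- The largest eigenvalue of the distance matrix. -/
noncomputable def distSpectralRadius (H : Hypergraph α) [Finite H.vertexSet] : ℝ :=
  letI : Fintype H.vertexSet := Fintype.ofFinite _
  sSup {μ : ℝ | Module.End.HasEigenvalue H.distMatrix.mulVecLin μ}

/-- `H` and `K` are isomorphic: some bijection from the vertices of `H` onto the vertices of `K`
maps edges to edges and non-edges to non-edges. -/
def IsIsomorphic (H : Hypergraph α) (K : Hypergraph β) : Prop :=
  ∃ f : α → β, Set.BijOn f H.vertexSet K.vertexSet ∧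
    ∀ s ⊆ H.vertexSet, (s ∈ H.edgeSet ↔ f '' s ∈ K.edgeSet)

/-- `H` is a `k`-uniform hypertree with `m` edges and exactly `n` vertices of maximum degree. -/
def IsUniformHypertreeWith (H : Hypergraph α) (k m n : ℕ) : Prop :=
  H.IsHypertree ∧ H.IsUniform k ∧ H.edgeSet.ncard = m ∧ H.maxDegreeVertices.ncard = n

/-- The vertices of the `k`-uniform loose path `(u_0, e_1, u_1, …, e_L, u_L)` with a hyperstar of
`c i` edges attached at each `u_i`:
* the path vertices `u_i`, `i ≤ L`;
* the `k - 2` other vertices of each of the `L` path edges;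
* the `k - 1` noncentral vertices of each of the `c i` edges of the hyperstar at `u_i`. -/
abbrev StarCaterpillarVertex (k L : ℕ) (c : Fin (L + 1) → ℕ) : Type :=
  Fin (L + 1) ⊕ (Fin L × Fin (k - 2)) ⊕ ((i : Fin (L + 1)) × Fin (c i) × Fin (k - 1))

/-- The path edge joining `u_j` and `u_(j+1)`. -/
def starCaterpillarPathEdge (k L : ℕ) (c : Fin (L + 1) → ℕ) (j : Fin L) :
    Set (StarCaterpillarVertex k L c) :=
  {Sum.inl j.castSucc, Sum.inl j.succ} ∪ Set.range fun x : Fin (k - 2) => Sum.inr (Sum.inl (j, x))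

/-- The `t`-th edge of the hyperstar whose center is `u_i`. -/
def starCaterpillarStarEdge (k L : ℕ) (c : Fin (L + 1) → ℕ) (i : Fin (L + 1)) (t : Fin (c i)) :
    Set (StarCaterpillarVertex k L c) :=
  {Sum.inl i} ∪ Set.range fun x : Fin (k - 1) => Sum.inr (Sum.inr ⟨i, t, x⟩)

/-- The rooted product of the `k`-uniform loose path with `L` edges and the `k`-uniform hyperstars
with `c 0, …, c L` edges, rooted at their centers (`c i = 0` is the trivial graph). -/
def starCaterpillar (k L : ℕ) (c : Fin (L + 1) → ℕ) :
    Hypergraph (StarCaterpillarVertex k L c) where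
  vertexSet := Set.univ
  edgeSet := {s | (∃ j, s = starCaterpillarPathEdge k L c j) ∨
    ∃ i t, s = starCaterpillarStarEdge k L c i t}
  subset_vertexSet_of_mem_edgeSet' := fun _ _ => Set.subset_univ _

/-- The size of the hyperstar attached at `u_i` in `C_k(L, Δ, a, b)`: the attached graph is trivial
for `i = 0`, `i = L` and `a < i < L - b`, and has `Δ - 2` edges otherwise. -/
def caterpillarStarSize (L Δ a b : ℕ) (i : Fin (L + 1)) : ℕ :=
  if (i : ℕ) = 0 ∨ (i : ℕ) = L ∨ (a < (i : ℕ) ∧ (i : ℕ) + b < L) then 0 else Δ - 2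

/-- The caterpillar `C_k(L, Δ, a, b)`. -/
abbrev caterpillar (k L Δ a b : ℕ) :
    Hypergraph (StarCaterpillarVertex k L (caterpillarStarSize L Δ a b)) :=
  starCaterpillar k L (caterpillarStarSize L Δ a b)

end Hypergraph

set_option linter.unusedSectionVars false
set_option linter.unusedDecidableInType false
set_option linter.unusedFintypeInType false

/-! A hypertree is encoded by its gate maps, `g i v` being the vertex of the edge `i` nearest to
`v`. The distance of two vertices is then the number of edges separating them, and rearranging
branches is an operation on gate maps over fixed vertex and edge types (`move`, `exchange`), which
changes the quadratic form of the distance matrix by an explicit product (`form_move`,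
`form_exchange`). By Perron–Frobenius (`exists_perron`) the spectral radius is the maximum of the
Rayleigh quotient and has a positive eigenvector, so one test vector suffices to show that a
rearrangement increases it.

The class is relaxed to `InClass`: at least `n` vertices of degree at least three. This contains the
given class, because a hypertree of maximum degree two has `m - 1 > n` vertices of degree two. Over
fixed finite types a maximizer of `rad` in the relaxed class exists, and it suffices that every
maximizer is the caterpillar, which lies in the original class.

In a maximizer, moving a third branch at a vertex of degree at least three into the lighter of two
other branches increases `rad`, so the result must leave the class. Hence all degrees are at most
three, exactly `n` vertices have degree three, and of two branches at such a vertex one contains no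
vertex of degree two (`deg_le_three`, `card_big`, `deg_ne_two`). Two exchange arguments show that an
edge has at most two vertices of degree at least two and that one of any three edges at a vertex is
pendant (`not_three_branching`, `exists_pendant`). Therefore everything off a longest path consists
of single pendant edges at inner vertices, and these occupy an initial segment of `a` and a final
segment of `b` inner positions, or all of them (`exists_segments`).

It remains to see that `a` and `b` differ by at most one. If `b ≥ a + 2`, the two outer edges at the
last inner vertex are moved to the first vertex of the path. Without them and without the pendant
edges that lack a mirror image, the path is symmetric, and the unmatched pendant edges all hang on
the half from which the branch departs. The Perron vector `x` need not be symmetric, so it is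
corrected to `x - 2β`, where `β` is the odd response of the symmetric part to the moved mass. The
gain is then a negative multiple of a weighted sum of the response over the unmatched part, and a
maximum principle makes the response negative on that half (`response_neg`,
`rad_lt_move_of_reflection`). -/

/-- A family of gate maps: `g i v` is the vertex of the edge `i` closest to `v`, so that the edge `i`
is the set of fixed points of `g i`. Such families encode hypertrees. -/
structure IsGateTree {ι V : Type*} (g : ι → V → V) : Prop where
  idem : ∀ i v, g i (g i v) = g i v
  const : ∀ {i j}, i ≠ j → ∀ u v, g j (g i u) = g j (g i v)
  step : ∀ {u v}, u ≠ v → ∃ i, g i u = u ∧ g i v ≠ u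

/-! ### Gate maps: separating edges, distances and branches -/

namespace GateTree

section Basic

variable {ι V : Type*} [Fintype ι] [DecidableEq ι] [Fintype V] [DecidableEq V]

/-- The edges separating two vertices. -/
def sep (g : ι → V → V) (u v : V) : Finset ι := Finset.univ.filter fun i => g i u ≠ g i v

/-- The distance of two vertices, as the number of edges separating them. -/
def gdist (g : ι → V → V) (u v : V) : ℕ := (sep g u v).card

/-- The vertices of an edge. -/
def edge (g : ι → V → V) (i : ι) : Finset V := Finset.univ.filter fun v => g i v = v

/-- The number of edges at a vertex. -/
def deg (g : ι → V → V) (v : V) : ℕ := (Finset.univ.filter fun i => g i v = v).card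

/-- `B` is the vertex set, without `p`, of a union of branches at `p`. -/
structure IsBranch (g : ι → V → V) (p : V) (B : Finset V) : Prop where
  notMem : p ∉ B
  edges : ∀ i, (∀ v, g i v = v → v ∈ B ∨ v = p) ∨ (∀ v, g i v = v → v ∉ B)

variable {g : ι → V → V}

@[simp] lemma mem_sep {u v : V} {i : ι} : i ∈ sep g u v ↔ g i u ≠ g i v := by
  simp [sep]

@[simp] lemma mem_edge {v : V} {i : ι} : v ∈ edge g i ↔ g i v = v := by
  simp [edge]

lemma sep_comm (u v : V) : sep g u v = sep g v u := by
  ext; simp [ne_comm]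

lemma gdist_comm (u v : V) : gdist g u v = gdist g v u := by
  rw [gdist, sep_comm, gdist]

@[simp] lemma gdist_self (v : V) : gdist g v v = 0 := by simp [gdist, sep]

lemma gdist_triangle (u v w : V) : gdist g u w ≤ gdist g u v + gdist g v w := by
  refine (Finset.card_le_card ?_).trans (Finset.card_union_le _ _)
  intro i
  simp only [mem_sep, Finset.mem_union]
  grind

lemma const' (h : IsGateTree g) {i j : ι} (hij : i ≠ j) {u v : V} (hu : g i u = u)
    (hv : g i v = v) : g j u = g j v := by
  rw [← hu, ← hv]; exact h.const hij _ _

/-- Both `u` and `g i v` lie on the edge `i`, so every other edge sees them through the same gate: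
the step from `u` to `g i v` crosses `i` only. -/
lemma sep_gate (h : IsGateTree g) {u v : V} {i : ι} (hu : g i u = u) :
    sep g (g i v) v = (sep g u v).erase i := by
  ext j
  rw [Finset.mem_erase, mem_sep, mem_sep]
  by_cases hj : j = i
  · subst hj; simp [h.idem]
  · rw [const' h (Ne.symm hj) (h.idem i v) hu]; simp [hj]

lemma gdist_gate (h : IsGateTree g) {u v : V} {i : ι} (hu : g i u = u) (hv : g i v ≠ u) :
    gdist g u v = gdist g (g i v) v + 1 := by
  have : i ∈ sep g u v := by rw [mem_sep, hu]; exact Ne.symm hv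
  rw [gdist, gdist, sep_gate h hu, Finset.card_erase_add_one this]

lemma gdist_gate' (h : IsGateTree g) {u v : V} {i : ι} (hu : g i u = u) :
    gdist g u v = gdist g (g i v) v + if g i v = u then 0 else 1 := by
  split_ifs with hv
  · rw [hv]; rfl
  · exact gdist_gate h hu hv

/-- Induction along the path leading to `v`. -/
lemma gate_induction (h : IsGateTree g) (v : V) {P : V → Prop} (base : P v)
    (ind : ∀ u i, u ≠ v → g i u = u → g i v ≠ u → P (g i v) → P u) (u : V) : P u := by
  induction hn : gdist g u v using Nat.strong_induction_on generalizing u with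
  | _ n ih =>
    by_cases huv : u = v
    · rwa [huv]
    · obtain ⟨i, hu, hv⟩ := h.step huv
      refine ind u i huv hu hv (ih _ ?_ _ rfl)
      have := gdist_gate h hu hv
      omega

lemma gdist_eq_zero (h : IsGateTree g) {u v : V} : gdist g u v = 0 ↔ u = v := by
  constructor
  · intro h0
    by_contra huv
    obtain ⟨i, hu, hv⟩ := h.step huv
    have := gdist_gate h hu hv
    omega
  · rintro rfl; simp

lemma gdist_pos (h : IsGateTree g) {u v : V} (huv : u ≠ v) : 0 < gdist g u v :=
  Nat.pos_of_ne_zero fun h0 => huv ((gdist_eq_zero h).1 h0)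

/-- An edge without vertices in `B` sees every vertex of `B` through `p`. -/
lemma IsBranch.gate_mem (h : IsGateTree g) {p : V} {B : Finset V} (hB : IsBranch g p B) {j : ι}
    (hj : ∀ b ∈ B, g j b ≠ b) {b : V} (hb : b ∈ B) : g j b = g j p := by
  refine gate_induction h p (P := fun b => b ∈ B → g j b = g j p) (fun _ => rfl) ?_ b hb
  intro u i hup hu hv ih huB
  have hij : i ≠ j := by rintro rfl; exact hj u huB hu
  have h1 := (hB.edges i).resolve_right (fun h2 => h2 u hu huB)
  rw [const' h hij hu (h.idem i p)]
  rcases h1 (g i p) (h.idem i p) with h2 | h2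
  · exact ih h2
  · rw [h2]

/-- An edge with a vertex in `B` sees every vertex outside `B` through `p`. -/
lemma IsBranch.gate_notMem (h : IsGateTree g) {p : V} {B : Finset V} (hB : IsBranch g p B) {j : ι}
    (hj : ∃ b ∈ B, g j b = b) {a : V} (ha : a ∉ B) : g j a = g j p := by
  refine gate_induction h p (P := fun b => b ∉ B → g j b = g j p) (fun _ => rfl) ?_ a ha
  intro u i hup hu hv ih huB
  have h1 := (hB.edges i).resolve_left (fun h2 => by grind)
  have hij : i ≠ j := by
    rintro rfl
    obtain ⟨b, hb, hb'⟩ := hj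
    exact h1 b hb' hb
  rw [const' h hij hu (h.idem i p)]
  exact ih (h1 _ (h.idem i p))

/-- `p` is a cut vertex: an edge meeting `B` cannot separate `a` from `p`, and an edge missing `B`
cannot separate `p` from `b`. So the edges separating `a` from `b` split into two disjoint sets. -/
lemma IsBranch.gdist_add (h : IsGateTree g) {p : V} {B : Finset V} (hB : IsBranch g p B) {a b : V}
    (ha : a ∉ B) (hb : b ∈ B) : gdist g a b = gdist g a p + gdist g p b := by
  have hdisj : Disjoint (sep g a p) (sep g p b) := by
    rw [Finset.disjoint_left]
    intro j h1 h2
    rw [mem_sep] at h1 h2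
    by_cases hj : ∃ b ∈ B, g j b = b
    · exact h1 (hB.gate_notMem h hj ha)
    · push Not at hj
      exact h2 (hB.gate_mem h hj hb).symm
  rw [gdist, gdist, gdist, ← Finset.card_union_of_disjoint hdisj]
  congr 1
  ext j
  rw [Finset.mem_union, mem_sep, mem_sep, mem_sep]
  by_cases hj : ∃ b ∈ B, g j b = b
  · rw [hB.gate_notMem h hj ha]; simp
  · push Not at hj
    rw [hB.gate_mem h hj hb]; simp

/-- The branch at `p` that starts with the edge `i`. -/
def edgeBranch (g : ι → V → V) (i : ι) (p : V) : Finset V := Finset.univ.filter fun v => g i v ≠ p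

/-- The union of the branches at `p` other than the one that starts with the edge `i`. -/
def coBranch (g : ι → V → V) (i : ι) (p : V) : Finset V :=
  Finset.univ.filter fun v => g i v = p ∧ v ≠ p

@[simp] lemma mem_edgeBranch {i : ι} {p v : V} : v ∈ edgeBranch g i p ↔ g i v ≠ p := by
  simp [edgeBranch]

@[simp] lemma mem_coBranch {i : ι} {p v : V} : v ∈ coBranch g i p ↔ g i v = p ∧ v ≠ p := by
  simp [coBranch]

lemma isBranch_edgeBranch (h : IsGateTree g) {i : ι} {p : V} (hp : g i p = p) :
    IsBranch g p (edgeBranch g i p) := by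
  refine ⟨by simp [hp], fun j => ?_⟩
  by_cases hj : j = i
  · subst hj
    left
    intro v hv
    rw [mem_edgeBranch, hv]
    tauto
  · by_cases hc : ∃ v, g j v = v ∧ g i v = p
    · right
      obtain ⟨v, hv, hvp⟩ := hc
      intro w hw
      rw [mem_edgeBranch, const' h hj hw hv]
      simp [hvp]
    · left
      intro w hw
      rw [mem_edgeBranch]
      left
      exact fun h2 => hc ⟨w, hw, h2⟩

lemma isBranch_coBranch (h : IsGateTree g) {i : ι} {p : V} :
    IsBranch g p (coBranch g i p) := by
  refine ⟨by simp, fun j => ?_⟩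
  by_cases hj : j = i
  · subst hj
    right
    intro v hv
    rw [mem_coBranch, hv]
    tauto
  · by_cases hc : ∃ v, g j v = v ∧ g i v = p
    · left
      obtain ⟨v, hv, hvp⟩ := hc
      intro w hw
      rw [mem_coBranch, const' h hj hw hv]
      tauto
    · right
      intro w hw
      rw [mem_coBranch]
      exact fun h2 => hc ⟨w, hw, h2.1⟩

/-- Since `j` contains `p`, the edge `i` sees all of `j` through `p`. So `j` has no vertex in the
branch starting with `i`, and it sees that branch through `p`. -/
lemma gate_eq_of_gate_ne (h : IsGateTree g) {i j : ι} (hij : i ≠ j) {p w : V} (hi : g i p = p)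
    (hj : g j p = p) (hw : g i w ≠ p) : g j w = p := by
  rw [(isBranch_edgeBranch h hi).gate_mem h (j := j) (b := w) _ (by simpa using hw), hj]
  intro b hb hjb
  rw [mem_edgeBranch, const' h (Ne.symm hij) hjb hj, hi] at hb
  exact hb rfl

/-- Root the hypertree at `r`: every other vertex lies on exactly one edge of which it is not the
gate towards `r`. -/
lemma card_vertices (h : IsGateTree g) (r : V) :
    Fintype.card V = ∑ i, ((edge g i).card - 1) + 1 := by
  have key : (Finset.univ.erase r : Finset V)
      = Finset.univ.biUnion fun i => (edge g i).erase (g i r) := by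
    ext v
    simp only [Finset.mem_erase, Finset.mem_univ, and_true, Finset.mem_biUnion, true_and, mem_edge]
    constructor
    · intro hv
      obtain ⟨i, h1, h2⟩ := h.step hv
      exact ⟨i, Ne.symm h2, h1⟩
    · rintro ⟨i, h1, h2⟩ rfl
      exact h1 h2.symm
  have hcard : (Finset.univ.erase r : Finset V).card = ∑ i, ((edge g i).card - 1) := by
    rw [key, Finset.card_biUnion]
    · refine Finset.sum_congr rfl fun i _ => Finset.card_erase_of_mem ?_
      simp [h.idem]
    · intro i _ j _ hij
      rw [Function.onFun, Finset.disjoint_left]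
      intro v h1 h2
      simp only [Finset.mem_erase, mem_edge] at h1 h2
      exact h2.1 (gate_eq_of_gate_ne h hij h1.2 h2.2 (Ne.symm h1.1)).symm
  rw [Finset.card_erase_of_mem (Finset.mem_univ _), Finset.card_univ] at hcard
  have : 0 < Fintype.card V := Fintype.card_pos_iff.2 ⟨r⟩
  omega

lemma sum_deg (g : ι → V → V) : ∑ v, deg g v = ∑ i, (edge g i).card := by
  simp only [deg, edge, Finset.card_filter]
  exact Finset.sum_comm

lemma deg_pos (h : IsGateTree g) {u v : V} (huv : u ≠ v) : 0 < deg g u := by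
  obtain ⟨i, hi, -⟩ := h.step huv
  exact Finset.card_pos.2 ⟨i, by simpa using hi⟩

end Basic

end GateTree

/-! ### Moving a branch from one vertex to another -/

namespace GateTree

section Move

variable {ι V : Type*} [Fintype ι] [DecidableEq ι] [Fintype V] [DecidableEq V]

/-- The quadratic form of the distance matrix. -/
def form (g : ι → V → V) (x : V → ℝ) : ℝ := ∑ u, ∑ v, x u * x v * gdist g u v

/-- Detach the branch `B` from the vertex `p` and attach it at the vertex `q`. -/
def move (g : ι → V → V) (p q : V) (B : Finset V) (j : ι) (v : V) : V :=
  if ∃ b ∈ B, g j b = b then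
    if g j (if v ∈ B then v else p) = p then q else g j (if v ∈ B then v else p)
  else g j (if v ∈ B then q else v)

variable {g : ι → V → V} {p q : V} {B : Finset V}

lemma move_of_exists_of_mem {j : ι} (hj : ∃ b ∈ B, g j b = b) {v : V} (hv : v ∈ B) :
    move g p q B j v = if g j v = p then q else g j v := by
  rw [move, if_pos hj, if_pos hv]

lemma move_of_exists_of_notMem {j : ι} (hj : ∃ b ∈ B, g j b = b) {v : V} (hv : v ∉ B) :
    move g p q B j v = if g j p = p then q else g j p := by
  rw [move, if_pos hj, if_neg hv]

lemma move_of_forall_of_mem {j : ι} (hj : ∀ b ∈ B, g j b ≠ b) {v : V} (hv : v ∈ B) :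
    move g p q B j v = g j q := by
  rw [move, if_neg (by push Not; exact hj), if_pos hv]

lemma move_of_forall_of_notMem {j : ι} (hj : ∀ b ∈ B, g j b ≠ b) {v : V} (hv : v ∉ B) :
    move g p q B j v = g j v := by
  rw [move, if_neg (by push Not; exact hj), if_neg hv]

lemma IsBranch.mem_or (hB : IsBranch g p B) {j : ι} (hj : ∃ b ∈ B, g j b = b) {v : V}
    (hv : g j v = v) : v ∈ B ∨ v = p := by
  rcases hB.edges j with h1 | h1
  · exact h1 v hv
  · obtain ⟨b, hb, hb'⟩ := hj
    exact absurd hb (h1 b hb')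

/-- There are two kinds of edges. Those with a vertex in `B` lie in `B ∪ {p}`; in them `p` is
renamed `q`, and everything outside `B` is seen through that vertex. The others keep their vertices
and see all of `B` through their gate for `q`. The axioms are checked for each combination. -/
lemma isGateTree_move (h : IsGateTree g) (hB : IsBranch g p B) (hq : q ∉ B) :
    IsGateTree (move g p q B) := by
  have hp := hB.notMem
  have hin : ∀ {j}, (∃ b ∈ B, g j b = b) → ∀ v, g j v ∈ B ∨ g j v = p :=
    fun hj v => hB.mem_or hj (h.idem _ v)
  have hout : ∀ {j}, (∀ b ∈ B, g j b ≠ b) → ∀ v, g j v ∉ B :=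
    fun hj v hv => hj _ hv (h.idem _ v)
  refine ⟨fun j v => ?_, fun {i j} hij u v => ?_, fun {u v} huv => ?_⟩
  · by_cases hj : ∃ b ∈ B, g j b = b
    · have key : ∀ w, move g p q B j (if g j w = p then q else g j w) =
          if g j w = p then q else g j w := by
        intro w
        split_ifs with hw
        · rw [move_of_exists_of_notMem hj hq, if_pos]
          rw [← hw, h.idem]
        · rw [move_of_exists_of_mem hj ((hin hj w).resolve_right hw), h.idem, if_neg hw]
      by_cases hv : v ∈ B
      · rw [move_of_exists_of_mem hj hv, key]
      · rw [move_of_exists_of_notMem hj hv, key]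
    · push Not at hj
      by_cases hv : v ∈ B
      · rw [move_of_forall_of_mem hj hv, move_of_forall_of_notMem hj (hout hj q), h.idem]
      · rw [move_of_forall_of_notMem hj hv, move_of_forall_of_notMem hj (hout hj v), h.idem]
  · by_cases hi : ∃ b ∈ B, g i b = b
    · have hi' : ∀ v, ∃ w, move g p q B i v = if g i w = p then q else g i w := by
        intro v
        by_cases hv : v ∈ B
        · exact ⟨v, move_of_exists_of_mem hi hv⟩
        · exact ⟨p, move_of_exists_of_notMem hi hv⟩
      obtain ⟨u', hu⟩ := hi' u
      obtain ⟨v', hv⟩ := hi' v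
      rw [hu, hv]
      by_cases hj : ∃ b ∈ B, g j b = b
      · have key : ∀ w, move g p q B j (if g i w = p then q else g i w) =
            if g j (g i w) = p then q else g j (g i w) := by
          intro w
          by_cases hw : g i w = p
          · rw [if_pos hw, move_of_exists_of_notMem hj hq, hw]
          · rw [if_neg hw, move_of_exists_of_mem hj ((hin hi w).resolve_right hw)]
        rw [key, key, h.const hij u' v']
      · push Not at hj
        have key : ∀ w, move g p q B j (if g i w = p then q else g i w) = g j q := by
          intro w
          by_cases hw : g i w = p
          · rw [if_pos hw, move_of_forall_of_notMem hj hq]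
          · rw [if_neg hw, move_of_forall_of_mem hj ((hin hi w).resolve_right hw)]
        rw [key, key]
    · push Not at hi
      have hi' : ∀ v, ∃ w, move g p q B i v = g i w := by
        intro v
        by_cases hv : v ∈ B
        · exact ⟨q, move_of_forall_of_mem hi hv⟩
        · exact ⟨v, move_of_forall_of_notMem hi hv⟩
      obtain ⟨u', hu⟩ := hi' u
      obtain ⟨v', hv⟩ := hi' v
      rw [hu, hv]
      by_cases hj : ∃ b ∈ B, g j b = b
      · rw [move_of_exists_of_notMem hj (hout hi _), move_of_exists_of_notMem hj (hout hi _)]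
      · push Not at hj
        rw [move_of_forall_of_notMem hj (hout hi _), move_of_forall_of_notMem hj (hout hi _),
          h.const hij u' v']
  · by_cases hu : u ∈ B
    · have hup : u ≠ p := fun e => hp (e ▸ hu)
      have huq : u ≠ q := fun e => hq (e ▸ hu)
      by_cases hv : v ∈ B
      · obtain ⟨i, h1, h2⟩ := h.step huv
        have hi : ∃ b ∈ B, g i b = b := ⟨u, hu, h1⟩
        refine ⟨i, ?_, ?_⟩
        · rw [move_of_exists_of_mem hi hu, h1, if_neg hup]
        · rw [move_of_exists_of_mem hi hv]
          split_ifs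
          · exact huq.symm
          · exact h2
      · obtain ⟨i, h1, h2⟩ := h.step hup
        have hi : ∃ b ∈ B, g i b = b := ⟨u, hu, h1⟩
        refine ⟨i, ?_, ?_⟩
        · rw [move_of_exists_of_mem hi hu, h1, if_neg hup]
        · rw [move_of_exists_of_notMem hi hv]
          split_ifs
          · exact huq.symm
          · exact h2
    · by_cases hv : v ∈ B
      · by_cases huq : u = q
        · subst huq
          -- After the move, the edge that led from `p` towards `v` leads from `q` towards `v`.
          have hpv : p ≠ v := fun e => hp (e ▸ hv)
          obtain ⟨i, h1, h2⟩ := h.step hpv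
          have hi : ∃ b ∈ B, g i b = b := by
            by_contra hi
            push Not at hi
            exact h2 (by rw [hB.gate_mem h hi hv, h1])
          refine ⟨i, ?_, ?_⟩
          · rw [move_of_exists_of_notMem hi hu, h1, if_pos rfl]
          · rw [move_of_exists_of_mem hi hv, if_neg h2]
            intro e
            exact hu (e ▸ (hin hi v).resolve_right h2)
        · obtain ⟨i, h1, h2⟩ := h.step huq
          have hi : ∀ b ∈ B, g i b ≠ b := by
            by_contra hi
            push Not at hi
            exact h2 (by rw [hB.gate_notMem h hi hq, ← hB.gate_notMem h hi hu, h1])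
          refine ⟨i, ?_, ?_⟩
          · rw [move_of_forall_of_notMem hi hu, h1]
          · rwa [move_of_forall_of_mem hi hv]
      · obtain ⟨i, h1, h2⟩ := h.step huv
        have hi : ∀ b ∈ B, g i b ≠ b := by
          by_contra hi
          push Not at hi
          exact h2 (by rw [hB.gate_notMem h hi hv, ← hB.gate_notMem h hi hu, h1])
        refine ⟨i, ?_, ?_⟩
        · rw [move_of_forall_of_notMem hi hu, h1]
        · rwa [move_of_forall_of_notMem hi hv]

lemma gdist_move_notMem (h : IsGateTree g) (hB : IsBranch g p B) {a a' : V}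
    (ha : a ∉ B) (ha' : a' ∉ B) : gdist (move g p q B) a a' = gdist g a a' := by
  rw [gdist, gdist]
  congr 1
  ext j
  rw [mem_sep, mem_sep]
  by_cases hj : ∃ b ∈ B, g j b = b
  · rw [move_of_exists_of_notMem hj ha, move_of_exists_of_notMem hj ha', hB.gate_notMem h hj ha,
      hB.gate_notMem h hj ha']
    simp
  · push Not at hj
    rw [move_of_forall_of_notMem hj ha, move_of_forall_of_notMem hj ha']

lemma gdist_move_mem (h : IsGateTree g) (hB : IsBranch g p B) (hq : q ∉ B) {b b' : V}
    (hb : b ∈ B) (hb' : b' ∈ B) : gdist (move g p q B) b b' = gdist g b b' := by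
  rw [gdist, gdist]
  congr 1
  ext j
  rw [mem_sep, mem_sep]
  by_cases hj : ∃ b ∈ B, g j b = b
  · rw [move_of_exists_of_mem hj hb, move_of_exists_of_mem hj hb']
    have h1 := hB.mem_or hj (h.idem j b)
    have h2 := hB.mem_or hj (h.idem j b')
    grind
  · push Not at hj
    rw [move_of_forall_of_mem hj hb, move_of_forall_of_mem hj hb', hB.gate_mem h hj hb,
      hB.gate_mem h hj hb']
    simp

lemma IsBranch.move (h : IsGateTree g) (hB : IsBranch g p B) (hq : q ∉ B) :
    IsBranch (move g p q B) q B := by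
  refine ⟨hq, fun j => ?_⟩
  by_cases hj : ∃ b ∈ B, g j b = b
  · left
    intro v hv
    by_cases hvB : v ∈ B
    · exact Or.inl hvB
    · right
      rw [move_of_exists_of_notMem hj hvB] at hv
      split_ifs at hv with h1
      · exact hv.symm
      · have := hB.mem_or hj (h.idem j p)
        grind
  · push Not at hj
    right
    intro v hv hvB
    rw [move_of_forall_of_mem hj hvB] at hv
    exact hj v hvB (by rw [← hv, h.idem])

lemma gdist_move_left (h : IsGateTree g) (hB : IsBranch g p B) (hq : q ∉ B) {b : V}
    (hb : b ∈ B) : gdist (move g p q B) q b = gdist g p b := by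
  rw [gdist, gdist]
  congr 1
  ext j
  rw [mem_sep, mem_sep]
  by_cases hj : ∃ b ∈ B, g j b = b
  · rw [move_of_exists_of_mem hj hb, move_of_exists_of_notMem hj hq]
    have h1 := hB.mem_or hj (h.idem j b)
    have h2 := hB.mem_or hj (h.idem j p)
    grind
  · push Not at hj
    rw [move_of_forall_of_mem hj hb, move_of_forall_of_notMem hj hq, hB.gate_mem h hj hb]
    simp

lemma gdist_move (h : IsGateTree g) (hB : IsBranch g p B) (hq : q ∉ B) {a b : V}
    (ha : a ∉ B) (hb : b ∈ B) :
    gdist (move g p q B) a b = gdist g a q + gdist g p b := by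
  rw [(hB.move h hq).gdist_add (isGateTree_move h hB hq) ha hb, gdist_move_notMem h hB ha hq,
    gdist_move_left h hB hq hb]

lemma form_split (g : ι → V → V) (B : Finset V) (x : V → ℝ) :
    form g x = ∑ a ∈ Bᶜ, ∑ a' ∈ Bᶜ, x a * x a' * gdist g a a'
      + 2 * ∑ a ∈ Bᶜ, ∑ b ∈ B, x a * x b * gdist g a b
      + ∑ b ∈ B, ∑ b' ∈ B, x b * x b' * gdist g b b' := by
  have h1 : ∑ b ∈ B, ∑ a ∈ Bᶜ, x b * x a * (gdist g b a : ℝ)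
      = ∑ a ∈ Bᶜ, ∑ b ∈ B, x a * x b * (gdist g a b : ℝ) := by
    rw [Finset.sum_comm]
    refine Finset.sum_congr rfl fun a _ => Finset.sum_congr rfl fun b _ => ?_
    rw [gdist_comm]; ring
  rw [form, ← Finset.sum_compl_add_sum B]
  simp_rw [← Finset.sum_compl_add_sum B (fun v => x _ * x v * (gdist g _ v : ℝ))]
  rw [Finset.sum_add_distrib, Finset.sum_add_distrib, h1]
  ring

/-- Only distances between `B` and its complement change, from `d(a, p) + d(p, b)` to `d(a, q) +
d(p, b)`. The increment does not depend on `b`, so the weight of `B` factors out. -/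
lemma form_move (h : IsGateTree g) (hB : IsBranch g p B) (hq : q ∉ B) (x : V → ℝ) :
    form (move g p q B) x = form g x
      + 2 * (∑ b ∈ B, x b) * ∑ a ∈ Bᶜ, x a * ((gdist g a q : ℝ) - gdist g a p) := by
  rw [form_split g B, form_split _ B]
  have h1 : ∑ a ∈ Bᶜ, ∑ a' ∈ Bᶜ, x a * x a' * (gdist (move g p q B) a a' : ℝ)
      = ∑ a ∈ Bᶜ, ∑ a' ∈ Bᶜ, x a * x a' * (gdist g a a' : ℝ) := by
    refine Finset.sum_congr rfl fun a ha => Finset.sum_congr rfl fun a' ha' => ?_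
    rw [gdist_move_notMem h hB (by simpa using ha) (by simpa using ha')]
  have h2 : ∑ b ∈ B, ∑ b' ∈ B, x b * x b' * (gdist (move g p q B) b b' : ℝ)
      = ∑ b ∈ B, ∑ b' ∈ B, x b * x b' * (gdist g b b' : ℝ) := by
    refine Finset.sum_congr rfl fun a ha => Finset.sum_congr rfl fun a' ha' => ?_
    rw [gdist_move_mem h hB hq ha ha']
  have h3 : ∑ a ∈ Bᶜ, ∑ b ∈ B, x a * x b * (gdist (move g p q B) a b : ℝ)
      = ∑ a ∈ Bᶜ, ∑ b ∈ B, x a * x b * (gdist g a b : ℝ)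
        + (∑ b ∈ B, x b) * ∑ a ∈ Bᶜ, x a * ((gdist g a q : ℝ) - gdist g a p) := by
    rw [Finset.sum_mul_sum, Finset.sum_comm (s := B), ← Finset.sum_add_distrib]
    refine Finset.sum_congr rfl fun a ha => ?_
    rw [← Finset.sum_add_distrib]
    refine Finset.sum_congr rfl fun b hb => ?_
    rw [gdist_move h hB hq (Finset.mem_compl.1 ha) hb, hB.gdist_add h (Finset.mem_compl.1 ha) hb]
    push_cast
    ring
  rw [h1, h2, h3]
  ring

lemma edge_move_of_exists (h : IsGateTree g) (hB : IsBranch g p B) (hq : q ∉ B) {j : ι}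
    (hj : ∃ b ∈ B, g j b = b) {v : V} :
    move g p q B j v = v ↔ (v ∈ B ∧ g j v = v) ∨ (v = q ∧ g j p = p) := by
  have hp := hB.notMem
  by_cases hv : v ∈ B
  · rw [move_of_exists_of_mem hj hv]
    grind
  · rw [move_of_exists_of_notMem hj hv]
    have h2 := hB.mem_or hj (h.idem j p)
    grind

lemma edge_move_of_forall (h : IsGateTree g) {j : ι}
    (hj : ∀ b ∈ B, g j b ≠ b) {v : V} : move g p q B j v = v ↔ g j v = v := by
  by_cases hv : v ∈ B
  · rw [move_of_forall_of_mem hj hv]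
    constructor
    · intro h1
      exact absurd (by rw [← h1, h.idem]) (hj v hv)
    · intro h1
      exact absurd h1 (hj v hv)
  · rw [move_of_forall_of_notMem hj hv]

lemma card_edge_move (h : IsGateTree g) (hB : IsBranch g p B) (hq : q ∉ B) (j : ι) :
    (edge (move g p q B) j).card = (edge g j).card := by
  have hp := hB.notMem
  by_cases hj : ∃ b ∈ B, g j b = b
  · refine Finset.card_bij' (fun v _ => if v = q then p else v) (fun v _ => if v = p then q else v)
      ?_ ?_ ?_ ?_ <;>
    · intro v hv
      rw [mem_edge] at hv
      have := fun hv => hB.mem_or hj (v := v) hv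
      try rw [edge_move_of_exists h hB hq hj] at hv
      try rw [mem_edge, edge_move_of_exists h hB hq hj]
      try rw [mem_edge]
      grind
  · push Not at hj
    congr 1
    ext v
    rw [mem_edge, mem_edge, edge_move_of_forall h hj]

/-- The number of edges that join `p` to the branch `B`. -/
def attach (g : ι → V → V) (p : V) (B : Finset V) : ℕ :=
  (Finset.univ.filter fun j => g j p = p ∧ ∃ b ∈ B, g j b = b).card

lemma deg_eq_add_attach (g : ι → V → V) (p : V) (B : Finset V) :
    deg g p = (Finset.univ.filter fun j => g j p = p ∧ ¬ ∃ b ∈ B, g j b = b).card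
      + attach g p B := by
  rw [deg, attach, add_comm, ← Finset.card_filter_add_card_filter_not (fun j => ∃ b ∈ B, g j b = b),
    Finset.filter_filter, Finset.filter_filter]

lemma deg_move_left (h : IsGateTree g) (hB : IsBranch g p B) (hq : q ∉ B) (hpq : p ≠ q) :
    deg (move g p q B) p + attach g p B = deg g p := by
  rw [deg_eq_add_attach g p B, deg]
  congr 2
  ext j
  rw [Finset.mem_filter_univ, Finset.mem_filter_univ]
  by_cases hj : ∃ b ∈ B, g j b = b
  · rw [edge_move_of_exists h hB hq hj]
    simp only [hB.notMem, hpq, hj, false_and, or_self, not_true_eq_false, and_false]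
  · have hj' := hj
    push Not at hj'
    rw [edge_move_of_forall h hj']
    tauto

lemma deg_move_right (h : IsGateTree g) (hB : IsBranch g p B) (hq : q ∉ B) (hpq : p ≠ q) :
    deg (move g p q B) q = deg g q + attach g p B := by
  rw [deg, deg, attach, ← Finset.card_union_of_disjoint]
  · congr 1
    ext j
    rw [Finset.mem_filter_univ, Finset.mem_union, Finset.mem_filter_univ, Finset.mem_filter_univ]
    by_cases hj : ∃ b ∈ B, g j b = b
    · rw [edge_move_of_exists h hB hq hj]
      have := hB.mem_or hj (v := q)
      grind
    · have hj' := hj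
      push Not at hj'
      rw [edge_move_of_forall h hj']
      tauto
  · rw [Finset.disjoint_left]
    intro j h1 h2
    rw [Finset.mem_filter_univ] at h1 h2
    have := hB.mem_or h2.2 h1
    grind

lemma deg_move_of_ne (h : IsGateTree g) (hB : IsBranch g p B) (hq : q ∉ B) {v : V} (hvp : v ≠ p)
    (hvq : v ≠ q) : deg (move g p q B) v = deg g v := by
  rw [deg, deg]
  congr 1
  ext j
  rw [Finset.mem_filter_univ, Finset.mem_filter_univ]
  by_cases hj : ∃ b ∈ B, g j b = b
  · rw [edge_move_of_exists h hB hq hj]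
    have := hB.mem_or hj (v := v)
    tauto
  · push Not at hj
    rw [edge_move_of_forall h hj]

lemma attach_edgeBranch (h : IsGateTree g) {i : ι} (hp : g i p = p)
    (hi : ∃ v, g i v = v ∧ v ≠ p) : attach g p (edgeBranch g i p) = 1 := by
  rw [attach, Finset.card_eq_one]
  refine ⟨i, ?_⟩
  ext j
  rw [Finset.mem_filter_univ, Finset.mem_singleton]
  constructor
  · rintro ⟨h1, b, h2, h3⟩
    rw [mem_edgeBranch] at h2
    by_contra hij
    have := const' h hij h1 h3
    rw [hp] at this
    exact h2 this.symm
  · rintro rfl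
    obtain ⟨v, h1, h2⟩ := hi
    exact ⟨hp, v, by rw [mem_edgeBranch, h1]; exact h2, h1⟩

end Move

end GateTree

/-! ### Rayleigh quotients and the Perron vector -/

namespace GateTree

section Spectral

variable {ι V : Type*} [Fintype ι] [DecidableEq ι] [Fintype V] [DecidableEq V]

/-- The distance matrix. -/
def distMat (g : ι → V → V) : Matrix V V ℝ := Matrix.of fun u v => (gdist g u v : ℝ)

/-- The distance spectral radius. -/
noncomputable def rad (g : ι → V → V) : ℝ :=
  sSup {μ : ℝ | Module.End.HasEigenvalue (distMat g).mulVecLin μ}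

variable {g : ι → V → V}

lemma form_eq_sum (g : ι → V → V) (x : V → ℝ) :
    form g x = ∑ u, x u * ∑ v, (gdist g u v : ℝ) * x v := by
  rw [form]
  refine Finset.sum_congr rfl fun u _ => ?_
  rw [Finset.mul_sum]
  refine Finset.sum_congr rfl fun v _ => ?_
  ring

lemma form_smul (g : ι → V → V) (c : ℝ) (x : V → ℝ) :
    form g (fun v => c * x v) = c ^ 2 * form g x := by
  rw [form, form, Finset.mul_sum]
  refine Finset.sum_congr rfl fun u _ => ?_
  rw [Finset.mul_sum]
  refine Finset.sum_congr rfl fun v _ => ?_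
  ring

lemma form_le_form_abs (g : ι → V → V) (x : V → ℝ) : form g x ≤ form g (fun v => |x v|) := by
  rw [form, form]
  refine Finset.sum_le_sum fun u _ => Finset.sum_le_sum fun v _ => ?_
  rw [← abs_mul]
  exact mul_le_mul_of_nonneg_right (le_abs_self _) (Nat.cast_nonneg _)

lemma sum_dist_comm (g : ι → V → V) (x y : V → ℝ) :
    ∑ u, y u * ∑ v, (gdist g u v : ℝ) * x v = ∑ u, x u * ∑ v, (gdist g u v : ℝ) * y v := by
  simp_rw [Finset.mul_sum]
  rw [Finset.sum_comm]
  refine Finset.sum_congr rfl fun u _ => Finset.sum_congr rfl fun v _ => ?_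
  rw [gdist_comm]
  ring

lemma form_add (g : ι → V → V) (x y : V → ℝ) :
    form g (fun v => x v + y v) = form g x
      + 2 * ∑ u, y u * ∑ v, (gdist g u v : ℝ) * x v + form g y := by
  have h1 := sum_dist_comm g x y
  rw [form_eq_sum, form_eq_sum, form_eq_sum]
  simp_rw [add_mul, mul_add, Finset.sum_add_distrib, mul_add, Finset.sum_add_distrib]
  linarith

lemma exists_max_form (g : ι → V → V) [Nonempty V] :
    ∃ x : V → ℝ, ∑ v, x v ^ 2 = 1 ∧ ∀ y, form g y ≤ form g x * ∑ v, y v ^ 2 := by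
  have hcomp : IsCompact {x : V → ℝ | ∑ v, x v ^ 2 = 1} := by
    refine Metric.isCompact_of_isClosed_isBounded ?_ ?_
    · exact isClosed_eq (by fun_prop) continuous_const
    · refine (Metric.isBounded_closedBall (x := (0 : V → ℝ)) (r := 1)).subset ?_
      intro x hx
      rw [mem_closedBall_zero_iff, pi_norm_le_iff_of_nonneg zero_le_one]
      intro v
      rw [Real.norm_eq_abs, ← sq_le_one_iff_abs_le_one]
      rw [← show ∑ v, x v ^ 2 = 1 from hx]
      exact Finset.single_le_sum (f := fun v => x v ^ 2) (fun w _ => sq_nonneg (x w))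
        (Finset.mem_univ v)
  have hne : {x : V → ℝ | ∑ v, x v ^ 2 = 1}.Nonempty := by
    refine ⟨Pi.single (Classical.arbitrary V) 1, ?_⟩
    rw [Set.mem_ofPred_eq, Finset.sum_eq_single (Classical.arbitrary V)]
    · simp
    · intro b _ hb; simp [hb]
    · simp
  have hcont : Continuous (form g) := by unfold form; fun_prop
  obtain ⟨x, hx, hmax⟩ := hcomp.exists_isMaxOn hne hcont.continuousOn
  refine ⟨x, hx, fun y => ?_⟩
  rcases (Finset.sum_nonneg fun v _ => sq_nonneg (y v) : 0 ≤ ∑ v, y v ^ 2).eq_or_lt with h0 | h0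
  · have hy : ∀ v, y v = 0 := by
      intro v
      have := (Finset.sum_eq_zero_iff_of_nonneg fun v _ => sq_nonneg (y v)).1 h0.symm v
        (Finset.mem_univ v)
      simpa using this
    simp [form, hy]
  · set s := ∑ v, y v ^ 2 with hs
    have hsq : (Real.sqrt s)⁻¹ ^ 2 = s⁻¹ := by rw [inv_pow, Real.sq_sqrt h0.le]
    have hmem : (fun v => (Real.sqrt s)⁻¹ * y v) ∈ {x : V → ℝ | ∑ v, x v ^ 2 = 1} := by
      rw [Set.mem_ofPred_eq]
      simp_rw [mul_pow]
      rw [← Finset.mul_sum, hsq, ← hs, inv_mul_cancel₀ h0.ne']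
    have h1 : form g (fun v => (Real.sqrt s)⁻¹ * y v) ≤ form g x := hmax hmem
    rw [form_smul, hsq, inv_mul_le_iff₀ h0] at h1
    linarith

/-- First-order condition for a maximizer of the Rayleigh quotient: along the coordinate direction
`v` the defect is `2tr + O(t²)`, where `r` is the error in the eigenvalue equation at `v`, and it
must never be positive. -/
lemma eigen_of_form_eq {g : ι → V → V} {μ : ℝ} (hμ : ∀ y, form g y ≤ μ * ∑ v, y v ^ 2)
    {x : V → ℝ} (hx : form g x = μ * ∑ v, x v ^ 2) (v : V) :
    ∑ w, (gdist g v w : ℝ) * x w = μ * x v := by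
  set r : ℝ := ∑ w, (gdist g v w : ℝ) * x w - μ * x v with hr
  by_contra hne
  have hr0 : r ≠ 0 := sub_ne_zero.2 hne
  have key : ∀ t : ℝ, 2 * t * r + t ^ 2 * (form g (Pi.single v 1) - μ) ≤ 0 := by
    intro t
    have h1 := hμ (fun w => x w + t * (Pi.single v 1 : V → ℝ) w)
    rw [form_add, form_smul, hx] at h1
    have h2 : ∑ u, t * (Pi.single v 1 : V → ℝ) u * ∑ w, (gdist g u w : ℝ) * x w
        = t * ∑ w, (gdist g v w : ℝ) * x w := by
      rw [Finset.sum_eq_single v]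
      · simp
      · intro b _ hb; simp [hb]
      · simp
    have h3 : ∑ u, (x u + t * (Pi.single v 1 : V → ℝ) u) ^ 2
        = ∑ u, x u ^ 2 + 2 * t * x v + t ^ 2 := by
      have : ∀ u, (x u + t * (Pi.single v 1 : V → ℝ) u) ^ 2
          = x u ^ 2 + (2 * t * x v + t ^ 2) * (Pi.single v 1 : V → ℝ) u := by
        intro u
        by_cases hu : u = v
        · subst hu; simp; ring
        · simp [hu]
      simp_rw [this]
      rw [Finset.sum_add_distrib, ← Finset.mul_sum, Finset.sum_pi_single']
      simp; ring
    rw [h2, h3] at h1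
    rw [hr]
    linarith
  set c := form g (Pi.single v 1) - μ
  -- This step is short enough for the linear term to dominate `t ^ 2 * c`, whatever the sign of
  -- `c`.
  have h1 := key (r / (1 + |c|))
  have hc : 0 < 1 + |c| := by positivity
  have h2 : 2 * (r / (1 + |c|)) * r + (r / (1 + |c|)) ^ 2 * c
      = r ^ 2 / (1 + |c|) ^ 2 * (2 * (1 + |c|) + c) := by
    field_simp
  rw [h2] at h1
  have h3 : 0 < 2 * (1 + |c|) + c := by
    have := neg_abs_le c
    have := abs_nonneg c
    linarith
  have : 0 < r ^ 2 / (1 + |c|) ^ 2 * (2 * (1 + |c|) + c) := by positivity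
  linarith

/-- Taking absolute values does not decrease the form, so the absolute value of a maximizer is a
maximizer and thus an eigenvector. It has no zero entry because all distances between distinct
vertices are positive. Every eigenvalue is a Rayleigh quotient, so the maximum is `rad`. -/
lemma exists_perron (h : IsGateTree g) [Nontrivial V] :
    ∃ x : V → ℝ, (∀ v, 0 < x v) ∧ (∀ v, ∑ w, (gdist g v w : ℝ) * x w = rad g * x v) ∧
      ∀ y, form g y ≤ rad g * ∑ v, y v ^ 2 := by
  obtain ⟨x₀, hx₀, hmax⟩ := exists_max_form g
  set μ := form g x₀
  have habs : ∑ v, |x₀ v| ^ 2 = 1 := by simp_rw [sq_abs]; exact hx₀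
  have hform : form g (fun v => |x₀ v|) = μ * ∑ v, |x₀ v| ^ 2 := by
    refine le_antisymm (hmax _) ?_
    rw [habs, mul_one]
    exact form_le_form_abs g x₀
  have heig := eigen_of_form_eq hmax hform
  have hpos : ∀ v, 0 < |x₀ v| := by
    intro v
    by_contra hv
    have hv0 : |x₀ v| = 0 := le_antisymm (not_lt.1 hv) (abs_nonneg _)
    obtain ⟨w, hw⟩ : ∃ w, x₀ w ≠ 0 := by
      by_contra hall
      push Not at hall
      simp [hall] at hx₀
    have hvw : v ≠ w := by
      rintro rfl
      exact hw (abs_eq_zero.1 hv0)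
    have h1 := heig v
    rw [hv0, mul_zero] at h1
    have h2 := (Finset.sum_eq_zero_iff_of_nonneg (fun w _ => by positivity)).1 h1 w
      (Finset.mem_univ w)
    have h3 : (0 : ℝ) < gdist g v w := by exact_mod_cast gdist_pos h hvw
    have h4 := abs_pos.2 hw
    exact (mul_pos h3 h4).ne' h2
  have hgreat : IsGreatest {μ : ℝ | Module.End.HasEigenvalue (distMat g).mulVecLin μ} μ := by
    constructor
    · refine Module.End.hasEigenvalue_of_hasEigenvector (x := fun v => |x₀ v|) ⟨?_, ?_⟩
      · rw [Module.End.mem_eigenspace_iff]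
        ext v
        simpa [distMat, Matrix.mulVec, dotProduct] using heig v
      · intro h0
        have v := Classical.arbitrary V
        exact (hpos v).ne' (congrFun h0 v)
    · intro ν hν
      obtain ⟨z, hz⟩ := hν.exists_hasEigenvector
      have h1 : ∀ v, ∑ w, (gdist g v w : ℝ) * z w = ν * z v := by
        intro v
        have := congrFun (Module.End.mem_eigenspace_iff.1 hz.1) v
        simpa [distMat, Matrix.mulVec, dotProduct] using this
      have h2 : form g z = ν * ∑ v, z v ^ 2 := by
        rw [form_eq_sum, Finset.mul_sum]
        refine Finset.sum_congr rfl fun v _ => ?_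
        rw [h1]; ring
      have h3 : 0 < ∑ v, z v ^ 2 := by
        obtain ⟨v, hv⟩ := Function.ne_iff.1 hz.2
        exact Finset.sum_pos' (fun v _ => sq_nonneg _) ⟨v, Finset.mem_univ v, by
          have : z v ≠ 0 := hv
          positivity⟩
      have h4 := hmax z
      rw [h2] at h4
      exact le_of_mul_le_mul_right h4 h3
  have hrad : rad g = μ := hgreat.csSup_eq
  rw [hrad]
  exact ⟨_, hpos, heig, hmax⟩

lemma rad_lt_of_form (h : IsGateTree g) [Nontrivial V] {r : ℝ} {y : V → ℝ}
    (hy : r * ∑ v, y v ^ 2 < form g y) : r < rad g := by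
  obtain ⟨-, -, -, hmax⟩ := exists_perron h
  have h1 := hy.trans_le (hmax y)
  by_contra hr
  have := mul_le_mul_of_nonneg_right (not_lt.1 hr)
    (Finset.sum_nonneg fun v _ => sq_nonneg (y v) : 0 ≤ ∑ v, y v ^ 2)
  linarith

end Spectral

end GateTree

/-! ### Extremal hypertrees: constraints from moving one branch -/

namespace GateTree

section Extremal

variable {ι V : Type*} [Fintype ι] [DecidableEq ι] [Fintype V] [DecidableEq V]

/-- The vertices of degree at least three. -/
def big (g : ι → V → V) : Finset V := Finset.univ.filter fun v => 3 ≤ deg g v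

/-- The `k`-uniform hypertrees with at least `n` vertices of degree at least three. -/
structure InClass (k n : ℕ) (g : ι → V → V) : Prop where
  tree : IsGateTree g
  unif : ∀ i, (edge g i).card = k
  many : n ≤ (big g).card

/-- A member of the class with the largest distance spectral radius. -/
structure IsExtremal (k n : ℕ) (g : ι → V → V) : Prop extends InClass k n g where
  le : ∀ g' : ι → V → V, InClass k n g' → rad g' ≤ rad g

variable {g : ι → V → V} {k n : ℕ}

@[simp] lemma mem_big {v : V} : v ∈ big g ↔ 3 ≤ deg g v := by simp [big]

lemma exists_ne_of_two_le (h2 : ∀ i, 2 ≤ (edge g i).card) (i : ι) (p : V) :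
    ∃ v, g i v = v ∧ v ≠ p := by
  obtain ⟨v, hv, hvp⟩ := Finset.exists_mem_ne (h2 i) p
  exact ⟨v, mem_edge.1 hv, hvp⟩

/-- A vertex of `B` farthest from `p` is a leaf: with two edges, one of them would lead further
away. -/
lemma exists_leaf (h : IsGateTree g) (h2 : ∀ i, 2 ≤ (edge g i).card) {p : V} {B : Finset V}
    (hB : IsBranch g p B) (hne : B.Nonempty) : ∃ z ∈ B, deg g z = 1 := by
  obtain ⟨z, hz, hmax⟩ := B.exists_max_image (gdist g p) hne
  refine ⟨z, hz, ?_⟩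
  have hzp : z ≠ p := fun e => hB.notMem (e ▸ hz)
  refine le_antisymm ?_ (deg_pos h hzp)
  by_contra hdeg
  obtain ⟨i, hi, j, hj, hij⟩ := Finset.one_lt_card.1 (not_le.1 hdeg)
  rw [Finset.mem_filter_univ] at hi hj
  have key : ∀ i, g i z = z → g i p = z → False := by
    intro i hi hip
    obtain ⟨w, hw, hwz⟩ := exists_ne_of_two_le h2 i z
    have h1 := gdist_gate h hw (by rw [hip]; exact hwz.symm : g i p ≠ w)
    rw [hip, gdist_comm, gdist_comm z] at h1
    have hwB : w ∈ B := by
      rcases hB.edges i with h3 | h3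
      · refine (h3 w hw).resolve_right ?_
        rintro rfl
        exact hwz (by rw [← hip, hw])
      · exact absurd hz (h3 z hi)
    have := hmax w hwB
    omega
  by_cases hip : g i p = z
  · exact key i hi hip
  · exact key j hj (gate_eq_of_gate_ne h hij hi hj hip)

lemma eq_of_deg_eq_one {z : V} (hz : deg g z = 1) {i j : ι} (hi : g i z = z) (hj : g j z = z) :
    i = j := by
  obtain ⟨f, hf⟩ := Finset.card_eq_one.1 hz
  have h1 : i ∈ ({f} : Finset ι) := hf ▸ by simpa using hi
  have h2 : j ∈ ({f} : Finset ι) := hf ▸ by simpa using hj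
  rw [Finset.mem_singleton.1 h1, Finset.mem_singleton.1 h2]

/-- The only edge at the leaf `z` separates `z` from both `a` and `v`, so it is counted twice on the
right and at most once on the left. -/
lemma gdist_lt_of_leaf (h : IsGateTree g) {a v z : V} (hz : deg g z = 1) (haz : a ≠ z)
    (hvz : v ≠ z) : gdist g a v + 1 ≤ gdist g a z + gdist g z v := by
  obtain ⟨f, hf, hfa⟩ := h.step haz.symm
  obtain ⟨f', hf', hfv⟩ := h.step hvz.symm
  obtain rfl := eq_of_deg_eq_one hz hf hf'
  have h1 : sep g a v ⊆ sep g a z ∪ sep g z v := by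
    intro i
    simp only [mem_sep, Finset.mem_union]
    grind
  have h2 : f ∈ sep g a z ∩ sep g z v := by
    simp only [mem_sep, Finset.mem_inter, hf]
    exact ⟨hfa, hfv.symm⟩
  have h3 := Finset.card_union_add_card_inter (sep g a z) (sep g z v)
  have h4 := Finset.card_pos.2 ⟨f, h2⟩
  have h5 := Finset.card_le_card h1
  rw [gdist, gdist, gdist]
  omega

/-- Replacing `u` by `z` as target, vertices outside `B` get farther by exactly `gdist g u z`, and
vertices in `B` get closer by at most as much; the side outside `B` is heavier. -/
lemma shift_pos (h : IsGateTree g) {u z : V} {B : Finset V} (hB : IsBranch g u B) (hz : z ∈ B)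
    (A : Finset V) {x : V → ℝ} (hx : ∀ v, 0 < x v)
    (hmass : ∑ a ∈ A with a ∈ B, x a < ∑ a ∈ A with a ∉ B, x a) :
    0 < ∑ a ∈ A, x a * ((gdist g a z : ℝ) - gdist g a u) := by
  have huz : u ≠ z := fun e => hB.notMem (e ▸ hz)
  have hD : (0 : ℝ) < gdist g u z := by exact_mod_cast gdist_pos h huz
  rw [← Finset.sum_filter_add_sum_filter_not A (· ∈ B)]
  have h1 : ∑ a ∈ A with a ∉ B, x a * ((gdist g a z : ℝ) - gdist g a u)
      = gdist g u z * ∑ a ∈ A with a ∉ B, x a := by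
    rw [Finset.mul_sum]
    refine Finset.sum_congr rfl fun a ha => ?_
    rw [hB.gdist_add h (Finset.mem_filter.1 ha).2 hz]
    push_cast; ring
  have h2 : -(gdist g u z * ∑ a ∈ A with a ∈ B, x a)
      ≤ ∑ a ∈ A with a ∈ B, x a * ((gdist g a z : ℝ) - gdist g a u) := by
    rw [Finset.mul_sum, ← Finset.sum_neg_distrib]
    refine Finset.sum_le_sum fun a _ => ?_
    have h3 : (gdist g a u : ℝ) ≤ gdist g a z + gdist g u z := by
      rw [gdist_comm u z]; exact_mod_cast gdist_triangle a z u
    have := hx a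
    nlinarith
  have := mul_lt_mul_of_pos_left hmass hD
  linarith

/-- The weight of a branch. -/
def mass (x : V → ℝ) (B : Finset V) : ℝ := ∑ b ∈ B, x b

/-- Extremality in the form in which it is used: `y` may be the Perron vector itself or a
permutation of it. -/
lemma IsExtremal.form_le (hg : IsExtremal k n g) [Nontrivial V] {x y : V → ℝ}
    (hx : ∀ v, ∑ w, (gdist g v w : ℝ) * x w = rad g * x v) {g' : ι → V → V}
    (hg' : InClass k n g') (hy : ∑ v, y v ^ 2 = ∑ v, x v ^ 2) : form g' y ≤ form g x := by
  by_contra hlt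
  have h1 : form g x = rad g * ∑ v, x v ^ 2 := by
    rw [form_eq_sum, Finset.mul_sum]
    refine Finset.sum_congr rfl fun v _ => ?_
    rw [hx]; ring
  have h2 := rad_lt_of_form hg'.tree (r := rad g) (y := y) (by rw [hy, ← h1]; exact not_le.1 hlt)
  exact absurd (hg.le g' hg') (not_le.2 h2)

lemma edgeBranch_disjoint (h : IsGateTree g) {u : V} {i j : ι} (hij : i ≠ j) (hi : g i u = u)
    (hj : g j u = u) : Disjoint (edgeBranch g i u) (edgeBranch g j u) := by
  rw [Finset.disjoint_left]
  intro v h1 h2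
  rw [mem_edgeBranch] at h1 h2
  exact h2 (gate_eq_of_gate_ne h hij hi hj h1)

/-- Moving one of three branches at `u` into the lighter of the other two. -/
lemma IsExtremal.not_inClass_move (hg : IsExtremal k n g) {x : V → ℝ}
    (hx0 : ∀ v, 0 < x v) (hx : ∀ v, ∑ w, (gdist g v w : ℝ) * x w = rad g * x v)
    {u z : V} {i₁ i₂ i₃ : ι} (h₁₂ : i₁ ≠ i₂) (h₁₃ : i₁ ≠ i₃) (h₂₃ : i₂ ≠ i₃) (h₁ : g i₁ u = u)
    (h₂ : g i₂ u = u) (h₃ : g i₃ u = u)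
    (hne : (edgeBranch g i₃ u).Nonempty)
    (hm : mass x (edgeBranch g i₁ u) ≤ mass x (edgeBranch g i₂ u)) (hz : z ∈ edgeBranch g i₁ u) :
    ¬ InClass k n (move g u z (edgeBranch g i₃ u)) := by
  have h := hg.tree
  intro hc
  have hB₁ := isBranch_edgeBranch h h₁
  have hB₃ := isBranch_edgeBranch h h₃
  have hz3 : z ∉ edgeBranch g i₃ u := Finset.disjoint_left.1 (edgeBranch_disjoint h h₁₃ h₁ h₃) hz
  have huz : u ≠ z := fun e => hB₁.notMem (e ▸ hz)
  have : Nontrivial V := ⟨u, z, huz⟩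
  have h4 := hg.form_le hx hc (y := x) rfl
  rw [form_move h hB₃ hz3] at h4
  have h5 : 0 < ∑ b ∈ edgeBranch g i₃ u, x b := Finset.sum_pos (fun b _ => hx0 b) hne
  -- Off the moved branch, the vertices outside branch `i₁` include `u` and branch `i₂`, and branch
  -- `i₂` is at least as heavy as branch `i₁`.
  have h6 := shift_pos h hB₁ hz (edgeBranch g i₃ u)ᶜ hx0 ?_
  · have := mul_pos h5 h6
    linarith
  · have h7 : ∑ a ∈ (edgeBranch g i₃ u)ᶜ with a ∈ edgeBranch g i₁ u, x a
        ≤ mass x (edgeBranch g i₁ u) := by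
      refine Finset.sum_le_sum_of_subset_of_nonneg ?_ fun a _ _ => (hx0 a).le
      intro a ha
      exact (Finset.mem_filter.1 ha).2
    have h8 : x u + mass x (edgeBranch g i₂ u)
        ≤ ∑ a ∈ (edgeBranch g i₃ u)ᶜ with a ∉ edgeBranch g i₁ u, x a := by
      rw [mass, ← Finset.sum_insert (isBranch_edgeBranch h h₂).notMem]
      refine Finset.sum_le_sum_of_subset_of_nonneg ?_ fun a _ _ => (hx0 a).le
      intro a ha
      rw [Finset.mem_filter, Finset.mem_compl]
      rcases Finset.mem_insert.1 ha with rfl | ha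
      · exact ⟨hB₃.notMem, hB₁.notMem⟩
      · exact ⟨Finset.disjoint_left.1 (edgeBranch_disjoint h h₂₃ h₂ h₃) ha,
          Finset.disjoint_left.1 (edgeBranch_disjoint h h₁₂.symm h₂ h₁) ha⟩
    have := hx0 u
    linarith

lemma InClass.two_le (hg : InClass k n g) (hk : 2 ≤ k) (i : ι) : 2 ≤ (edge g i).card := by
  rw [hg.unif]; exact hk

lemma edgeBranch_nonempty (h2 : ∀ i, 2 ≤ (edge g i).card) (i : ι) (u : V) :
    (edgeBranch g i u).Nonempty := by
  obtain ⟨v, h1, h2⟩ := exists_ne_of_two_le h2 i u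
  exact ⟨v, by rw [mem_edgeBranch, h1]; exact h2⟩

lemma InClass.nontrivial (hg : InClass k n g) (hk : 2 ≤ k) (i : ι) : Nontrivial V := by
  obtain ⟨a, -, b, -, hab⟩ := Finset.one_lt_card.1 (hg.two_le hk i)
  exact ⟨a, b, hab⟩

/-- Among two branches at a vertex of degree at least three, one does not admit any move of a third
branch into it. -/
lemma IsExtremal.move_dichotomy (hg : IsExtremal k n g) (hk : 2 ≤ k) {u : V} (hu : 3 ≤ deg g u)
    {i₁ i₂ : ι} (h₁₂ : i₁ ≠ i₂) (h₁ : g i₁ u = u) (h₂ : g i₂ u = u) :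
    ∃ i₃, g i₃ u = u ∧ ((∀ z ∈ edgeBranch g i₁ u, z ∉ edgeBranch g i₃ u ∧
        ¬ InClass k n (move g u z (edgeBranch g i₃ u))) ∨
      ∀ z ∈ edgeBranch g i₂ u, z ∉ edgeBranch g i₃ u ∧
        ¬ InClass k n (move g u z (edgeBranch g i₃ u))) := by
  have h := hg.tree
  obtain ⟨i₃, h₃, hne⟩ : ∃ i₃ ∈ Finset.univ.filter (fun i => g i u = u), i₃ ∉ ({i₁, i₂} : Finset ι) := by
    refine Finset.exists_mem_notMem_of_card_lt_card (lt_of_le_of_lt Finset.card_le_two ?_)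
    exact hu
  rw [Finset.mem_filter_univ] at h₃
  rw [Finset.mem_insert, Finset.mem_singleton, not_or] at hne
  have := hg.nontrivial hk i₁
  obtain ⟨x, hx0, hx, -⟩ := exists_perron h
  have hn := edgeBranch_nonempty (hg.two_le hk) i₃ u
  refine ⟨i₃, h₃, ?_⟩
  rcases le_total (mass x (edgeBranch g i₁ u)) (mass x (edgeBranch g i₂ u)) with hm | hm
  · left
    intro z hz
    exact ⟨Finset.disjoint_left.1 (edgeBranch_disjoint h (Ne.symm hne.1) h₁ h₃) hz,
      hg.not_inClass_move hx0 hx h₁₂ (Ne.symm hne.1) (Ne.symm hne.2) h₁ h₂ h₃ hn hm hz⟩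
  · right
    intro z hz
    exact ⟨Finset.disjoint_left.1 (edgeBranch_disjoint h (Ne.symm hne.2) h₂ h₃) hz,
      hg.not_inClass_move hx0 hx h₁₂.symm (Ne.symm hne.2) (Ne.symm hne.1) h₂ h₁ h₃ hn hm hz⟩

lemma InClass.move (hg : InClass k n g) {p q : V} {B : Finset V} (hB : IsBranch g p B)
    (hq : q ∉ B) (hn : n ≤ (big (move g p q B)).card) : InClass k n (move g p q B) :=
  ⟨isGateTree_move hg.tree hB hq, fun i => by rw [card_edge_move hg.tree hB hq, hg.unif], hn⟩

lemma big_erase_subset (h : IsGateTree g) {p q : V} {B : Finset V} (hB : IsBranch g p B)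
    (hq : q ∉ B) (hpq : p ≠ q) : (big g).erase p ⊆ big (GateTree.move g p q B) := by
  intro v hv
  rw [Finset.mem_erase, mem_big] at hv
  rw [mem_big]
  by_cases hvq : v = q
  · subst hvq
    rw [deg_move_right h hB hq hpq]
    omega
  · rw [deg_move_of_ne h hB hq hv.1 hvq]
    exact hv.2

lemma exists_two_edges {u : V} (hu : 2 ≤ deg g u) : ∃ i j, i ≠ j ∧ g i u = u ∧ g j u = u := by
  obtain ⟨i, hi, j, hj, hij⟩ := Finset.one_lt_card.1 hu
  exact ⟨i, j, hij, by simpa using hi, by simpa using hj⟩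

/-- A vertex of degree at least four still has degree at least three after losing one branch, so the
gainful move would stay in the class. -/
lemma IsExtremal.deg_le_three (hg : IsExtremal k n g) (hk : 2 ≤ k) (u : V) : deg g u ≤ 3 := by
  have h := hg.tree
  by_contra hu
  obtain ⟨i₁, i₂, h₁₂, h₁, h₂⟩ := exists_two_edges (g := g) (u := u) (by omega)
  obtain ⟨i₃, h₃, hd⟩ := hg.move_dichotomy hk (by omega) h₁₂ h₁ h₂
  have hB₃ := isBranch_edgeBranch h h₃
  have key : ∀ z, z ≠ u → z ∉ edgeBranch g i₃ u →
      InClass k n (GateTree.move g u z (edgeBranch g i₃ u)) := by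
    intro z hzu hz
    refine hg.toInClass.move hB₃ hz (hg.many.trans (Finset.card_le_card ?_))
    intro v hv
    by_cases hvu : v = u
    · subst hvu
      have h1 := deg_move_left h hB₃ hz (Ne.symm hzu)
      rw [attach_edgeBranch h h₃ (exists_ne_of_two_le (hg.two_le hk) i₃ _)] at h1
      rw [mem_big]
      omega
    · exact big_erase_subset h hB₃ hz (Ne.symm hzu) (Finset.mem_erase.2 ⟨hvu, hv⟩)
  rcases hd with hd | hd
  · obtain ⟨z, hz⟩ := edgeBranch_nonempty (hg.two_le hk) i₁ u
    exact (hd z hz).2 (key z (fun e => by rw [e, mem_edgeBranch] at hz; exact hz h₁) (hd z hz).1)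
  · obtain ⟨z, hz⟩ := edgeBranch_nonempty (hg.two_le hk) i₂ u
    exact (hd z hz).2 (key z (fun e => by rw [e, mem_edgeBranch] at hz; exact hz h₂) (hd z hz).1)

/-- With more than `n` vertices of degree at least three, one of them may be sacrificed by the
gainful move. -/
lemma IsExtremal.card_big (hg : IsExtremal k n g) (hk : 2 ≤ k) : (big g).card = n := by
  have h := hg.tree
  refine le_antisymm ?_ hg.many
  by_contra hn
  have hn' : n < (big g).card := not_le.1 hn
  obtain ⟨u, hu⟩ := Finset.card_pos.1 (lt_of_le_of_lt (Nat.zero_le n) hn')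
  have hu3 := mem_big.1 hu
  obtain ⟨i₁, i₂, h₁₂, h₁, h₂⟩ := exists_two_edges (g := g) (u := u) (by omega)
  obtain ⟨i₃, h₃, hd⟩ := hg.move_dichotomy hk (by omega) h₁₂ h₁ h₂
  have hB₃ := isBranch_edgeBranch h h₃
  have key : ∀ z, z ≠ u → z ∉ edgeBranch g i₃ u →
      InClass k n (GateTree.move g u z (edgeBranch g i₃ u)) := by
    intro z hzu hz
    refine hg.toInClass.move hB₃ hz ?_
    have h1 := Finset.card_le_card (big_erase_subset h hB₃ hz (Ne.symm hzu))
    rw [Finset.card_erase_of_mem hu] at h1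
    omega
  rcases hd with hd | hd
  · obtain ⟨z, hz⟩ := edgeBranch_nonempty (hg.two_le hk) i₁ u
    exact (hd z hz).2 (key z (fun e => by rw [e, mem_edgeBranch] at hz; exact hz h₁) (hd z hz).1)
  · obtain ⟨z, hz⟩ := edgeBranch_nonempty (hg.two_le hk) i₂ u
    exact (hd z hz).2 (key z (fun e => by rw [e, mem_edgeBranch] at hz; exact hz h₂) (hd z hz).1)

/-- Of two branches at a vertex of degree three, one has no vertex of degree two. -/
lemma IsExtremal.deg_ne_two (hg : IsExtremal k n g) (hk : 2 ≤ k) {u : V} (hu : 3 ≤ deg g u)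
    {i₁ i₂ : ι} (h₁₂ : i₁ ≠ i₂) (h₁ : g i₁ u = u) (h₂ : g i₂ u = u) :
    (∀ z ∈ edgeBranch g i₁ u, deg g z ≠ 2) ∨ ∀ z ∈ edgeBranch g i₂ u, deg g z ≠ 2 := by
  have h := hg.tree
  obtain ⟨i₃, h₃, hd⟩ := hg.move_dichotomy hk hu h₁₂ h₁ h₂
  have hB₃ := isBranch_edgeBranch h h₃
  -- The move raises `z` from degree two to three, which compensates for `u` possibly dropping out
  -- of `big`.
  have key : ∀ z, deg g z = 2 → z ∉ edgeBranch g i₃ u →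
      InClass k n (GateTree.move g u z (edgeBranch g i₃ u)) := by
    intro z hz2 hz
    have hzu : z ≠ u := by rintro rfl; omega
    refine hg.toInClass.move hB₃ hz ?_
    have h1 := big_erase_subset h hB₃ hz (Ne.symm hzu)
    have h2 : z ∉ (big g).erase u := by
      rw [Finset.mem_erase, mem_big, hz2]; omega
    have h3 : insert z ((big g).erase u) ⊆ big (GateTree.move g u z (edgeBranch g i₃ u)) := by
      refine Finset.insert_subset ?_ h1
      rw [mem_big, deg_move_right h hB₃ hz (Ne.symm hzu),
        attach_edgeBranch h h₃ (exists_ne_of_two_le (hg.two_le hk) i₃ _)]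
      omega
    have h4 := Finset.card_le_card h3
    rw [Finset.card_insert_of_notMem h2, Finset.card_erase_add_one (mem_big.2 hu)] at h4
    exact hg.many.trans h4
  rcases hd with hd | hd
  · left
    intro z hz hz2
    exact (hd z hz).2 (key z hz2 (hd z hz).1)
  · right
    intro z hz hz2
    exact (hd z hz).2 (key z hz2 (hd z hz).1)

end Extremal

end GateTree

/-! ### Exchanging weights and branches -/

namespace GateTree

section Exchange

variable {ι V : Type*} [Fintype ι] [DecidableEq ι] [Fintype V] [DecidableEq V]
variable {g : ι → V → V} {k n : ℕ}

lemma attach_coBranch (h : IsGateTree g) (h2 : ∀ i, 2 ≤ (edge g i).card) {e : ι} {v : V}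
    (he : g e v = v) : attach g v (coBranch g e v) + 1 = deg g v := by
  have : (Finset.univ.filter fun j => g j v = v ∧ ∃ b ∈ coBranch g e v, g j b = b)
      = (Finset.univ.filter fun j => g j v = v).erase e := by
    ext j
    rw [Finset.mem_filter_univ, Finset.mem_erase, Finset.mem_filter_univ]
    constructor
    · rintro ⟨h1, b, hb, hjb⟩
      refine ⟨?_, h1⟩
      rintro rfl
      rw [mem_coBranch, hjb] at hb
      exact hb.2 hb.1
    · rintro ⟨h1, h3⟩
      refine ⟨h3, ?_⟩
      obtain ⟨b, hb, hbv⟩ := exists_ne_of_two_le h2 j v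
      refine ⟨b, ?_, hb⟩
      rw [mem_coBranch, const' h h1 hb h3]
      exact ⟨he, hbv⟩
  rw [attach, this, Finset.card_erase_add_one (by simpa using he), deg]

/-- The effect of exchanging the weights of two vertices. -/
lemma form_swap (g : ι → V → V) (x : V → ℝ) {v z : V} (hvz : v ≠ z) :
    form g (fun a => x (Equiv.swap v z a)) = form g x
      + 2 * (x z - x v) * (∑ a, x a * ((gdist g a v : ℝ) - gdist g a z))
      - 2 * (x z - x v) ^ 2 * gdist g v z := by
  have h1 : (fun a => x (Equiv.swap v z a)) = fun a => x a
      + (x z - x v) * ((Pi.single v 1 : V → ℝ) a - (Pi.single z 1 : V → ℝ) a) := by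
    funext a
    by_cases hv : a = v
    · subst hv; simp [hvz]
    · by_cases hz : a = z
      · subst hz; simp [hvz.symm]
      · simp [Equiv.swap_apply_of_ne_of_ne hv hz, hv, hz]
  have h3 : ∀ f : V → ℝ, ∑ a, ((Pi.single v 1 : V → ℝ) a - (Pi.single z 1 : V → ℝ) a) * f a
      = f v - f z := by
    intro f
    simp [sub_mul, Finset.sum_sub_distrib, Pi.single_apply]
  have h4 : form g (fun a => (Pi.single v 1 : V → ℝ) a - (Pi.single z 1 : V → ℝ) a)
      = -2 * gdist g v z := by
    rw [form_eq_sum, h3]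
    simp_rw [mul_comm (Nat.cast _ : ℝ), h3]
    rw [gdist_self, gdist_self, gdist_comm z v]
    push_cast; ring
  have h5 : ∑ a, x a * ((gdist g a v : ℝ) - gdist g a z)
      = ∑ a, (gdist g v a : ℝ) * x a - ∑ a, (gdist g z a : ℝ) * x a := by
    rw [← Finset.sum_sub_distrib]
    refine Finset.sum_congr rfl fun a _ => ?_
    rw [gdist_comm a v, gdist_comm a z]; ring
  rw [h1, form_add, form_smul, h4, h5]
  simp_rw [mul_assoc]
  rw [← Finset.mul_sum, h3]
  ring

/-- The effect of moving a branch from `v` to `z` and exchanging the weights of `v` and `z`. -/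
lemma form_move_swap (h : IsGateTree g) (x : V → ℝ) {v z : V} {B : Finset V}
    (hB : IsBranch g v B) (hz : z ∉ B) (hvz : v ≠ z) :
    form (move g v z B) (fun a => x (Equiv.swap v z a)) = form g x
      + 2 * (∑ b ∈ B, x b + x v - x z) *
        ∑ a ∈ (Bᶜ.erase v).erase z, x a * ((gdist g a z : ℝ) - gdist g a v) := by
  have hv := hB.notMem
  rw [form_move h hB hz, form_swap g x hvz]
  have h1 : ∑ b ∈ B, x (Equiv.swap v z b) = ∑ b ∈ B, x b := by
    refine Finset.sum_congr rfl fun b hb => ?_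
    rw [Equiv.swap_apply_of_ne_of_ne]
    · rintro rfl; exact hv hb
    · rintro rfl; exact hz hb
  have hmv : v ∈ Bᶜ := Finset.mem_compl.2 hv
  have hmz : z ∈ Bᶜ.erase v := Finset.mem_erase.2 ⟨hvz.symm, Finset.mem_compl.2 hz⟩
  have h2 : ∑ a ∈ Bᶜ, x (Equiv.swap v z a) * ((gdist g a z : ℝ) - gdist g a v)
      = (x z - x v) * gdist g v z
        + ∑ a ∈ (Bᶜ.erase v).erase z, x a * ((gdist g a z : ℝ) - gdist g a v) := by
    rw [← Finset.add_sum_erase _ _ hmv, ← Finset.add_sum_erase _ _ hmz]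
    simp only [Equiv.swap_apply_left, Equiv.swap_apply_right, gdist_self, gdist_comm z v]
    rw [Finset.sum_congr rfl (g := fun a => x a * ((gdist g a z : ℝ) - gdist g a v))]
    · push_cast; ring
    · intro a ha
      rw [Finset.mem_erase, Finset.mem_erase] at ha
      rw [Equiv.swap_apply_of_ne_of_ne ha.2.1 ha.1]
  have h3 : ∑ a, x a * ((gdist g a v : ℝ) - gdist g a z)
      = (x z - x v - ∑ b ∈ B, x b) * gdist g v z
        - ∑ a ∈ (Bᶜ.erase v).erase z, x a * ((gdist g a z : ℝ) - gdist g a v) := by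
    rw [← Finset.sum_compl_add_sum B, ← Finset.add_sum_erase _ _ hmv,
      ← Finset.add_sum_erase _ _ hmz]
    have h4 : ∑ b ∈ B, x b * ((gdist g b v : ℝ) - gdist g b z)
        = -((∑ b ∈ B, x b) * gdist g v z) := by
      rw [Finset.sum_mul, ← Finset.sum_neg_distrib]
      refine Finset.sum_congr rfl fun b hb => ?_
      rw [gdist_comm b z, gdist_comm b v, hB.gdist_add h hz hb, gdist_comm z v]
      push_cast; ring
    rw [h4, gdist_comm z v, gdist_self, gdist_self]
    have h5 : ∀ a, x a * ((gdist g a v : ℝ) - gdist g a z)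
        = -(x a * ((gdist g a z : ℝ) - gdist g a v)) := fun a => by ring
    simp_rw [h5 , Finset.sum_neg_distrib]
    push_cast; ring
  rw [h1, h2, h3]
  ring

/-- The vertices seen from `e` through `u` are assumed to weigh no more than those seen through `v`
or through `w`. Everything hanging at `v` off `e` is moved to a leaf `z` beyond `u`, and the weights
of `v` and `z` are interchanged. The vertices `v` and `z` thereby exchange their degrees, so the
class is kept, and both factors in `form_move_swap` are positive. -/
lemma IsExtremal.not_three_branching_of_le (hg : IsExtremal k n g) (hk : 2 ≤ k) {x : V → ℝ}
    (hx0 : ∀ v, 0 < x v) (hx : ∀ v, ∑ w, (gdist g v w : ℝ) * x w = rad g * x v)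
    {e : ι} {u v w : V} (huv : u ≠ v) (huw : u ≠ w) (hvw : v ≠ w) (heu : g e u = u)
    (hev : g e v = v) (hdu : 2 ≤ deg g u)
    (hmv : ∑ a with g e a = u, x a ≤ ∑ a with g e a = v, x a)
    (hmw : ∑ a with g e a = u, x a ≤ ∑ a with g e a = w, x a) : False := by
  have h := hg.tree
  have h2 := hg.two_le hk
  have hBu := isBranch_coBranch h (i := e) (p := u)
  have hBv := isBranch_coBranch h (i := e) (p := v)
  have hneu : (coBranch g e u).Nonempty := by
    obtain ⟨i, j, hij, hi, hj⟩ := exists_two_edges hdu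
    obtain ⟨f, hf, hfu⟩ : ∃ f, f ≠ e ∧ g f u = u := by
      by_cases hie : i = e
      · exact ⟨j, fun hje => hij (hie.trans hje.symm), hj⟩
      · exact ⟨i, hie, hi⟩
    obtain ⟨b, hb, hbu⟩ := exists_ne_of_two_le h2 f u
    refine ⟨b, ?_⟩
    rw [mem_coBranch, const' h hf hb hfu]
    exact ⟨heu, hbu⟩
  obtain ⟨z, hzu, hz1⟩ := exists_leaf h h2 hBu hneu
  have hz := mem_coBranch.1 hzu
  have hzv : z ∉ coBranch g e v := by
    rw [mem_coBranch, hz.1]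
    exact fun h3 => huv h3.1
  have hvz : v ≠ z := by
    rintro rfl
    exact huv (by rw [← hz.1, hev])
  have hatt := attach_coBranch h h2 hev
  have hclass : InClass k n (move g v z (coBranch g e v)) := by
    refine hg.toInClass.move hBv hzv ?_
    have h3 := big_erase_subset h hBv hzv hvz
    by_cases hv : v ∈ big g
    · have h4 : z ∉ (big g).erase v := by rw [Finset.mem_erase, mem_big, hz1]; omega
      have h5 : insert z ((big g).erase v) ⊆ big (move g v z (coBranch g e v)) := by
        refine Finset.insert_subset ?_ h3
        rw [mem_big] at hv ⊢
        rw [deg_move_right h hBv hzv hvz, hz1]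
        omega
      have h6 := Finset.card_le_card h5
      rw [Finset.card_insert_of_notMem h4, Finset.card_erase_add_one hv] at h6
      exact hg.many.trans h6
    · rw [Finset.erase_eq_of_notMem hv] at h3
      exact hg.many.trans (Finset.card_le_card h3)
  have : Nontrivial V := ⟨u, v, huv⟩
  have hle := hg.form_le hx hclass (y := fun a => x (Equiv.swap v z a))
    (Equiv.sum_comp (Equiv.swap v z) fun a => x a ^ 2)
  rw [form_move_swap h x hBv hzv hvz] at hle
  have hSu : x z + x u ≤ ∑ a with g e a = u, x a := by
    rw [← Finset.sum_pair hz.2]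
    refine Finset.sum_le_sum_of_subset_of_nonneg ?_ fun a _ _ => (hx0 a).le
    intro a ha
    rw [Finset.mem_insert, Finset.mem_singleton] at ha
    rw [Finset.mem_filter_univ]
    rcases ha with rfl | rfl
    · exact hz.1
    · exact heu
  have hSv : ∑ b ∈ coBranch g e v, x b + x v = ∑ a with g e a = v, x a := by
    rw [add_comm, ← Finset.sum_insert hBv.notMem]
    congr 1
    ext a
    rw [Finset.mem_insert, mem_coBranch, Finset.mem_filter_univ]
    grind
  -- The total at `v` is at least the total at `u`, which contains both `x z` and `x u`.
  have ht : 0 < ∑ b ∈ coBranch g e v, x b + x v - x z := by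
    have := hx0 u
    linarith
  have hD1 : gdist g v z = gdist g u z + 1 := by
    rw [gdist_gate h hev (by rw [hz.1]; exact huv), hz.1]
  have hD : (0 : ℝ) < gdist g u z := by exact_mod_cast gdist_pos h hz.2.symm
  set A := ((coBranch g e v)ᶜ.erase v).erase z with hA
  have hAmem : ∀ a, a ∈ A ↔ a ≠ z ∧ g e a ≠ v := by
    intro a
    rw [hA, Finset.mem_erase, Finset.mem_erase, Finset.mem_compl, mem_coBranch]
    grind
  -- Vertices seen through `u` lose at most `gdist g u z`: because `z` is a leaf, the triangle
  -- inequality improves by one, which absorbs the crossing of `e`. The remaining vertices of `A`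
  -- are equally far from `u` and `v`, so they gain exactly `gdist g u z`; they include everything
  -- seen through `w`.
  have hφ : 0 < ∑ a ∈ A, x a * ((gdist g a z : ℝ) - gdist g a v) := by
    rw [← Finset.sum_filter_add_sum_filter_not A (fun a => g e a = u)]
    have h3 : -(gdist g u z * ∑ a ∈ A with g e a = u, x a)
        ≤ ∑ a ∈ A with g e a = u, x a * ((gdist g a z : ℝ) - gdist g a v) := by
      rw [Finset.mul_sum, ← Finset.sum_neg_distrib]
      refine Finset.sum_le_sum fun a ha => ?_
      have ha' := (hAmem a).1 (Finset.mem_filter.1 ha).1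
      have h4 := gdist_lt_of_leaf h hz1 ha'.1 hvz
      rw [gdist_comm z v, hD1] at h4
      have h5 : (gdist g a v : ℝ) ≤ gdist g a z + gdist g u z := by exact_mod_cast (by omega)
      have := hx0 a
      nlinarith
    have h4 : ∑ a ∈ A with g e a ≠ u, x a * ((gdist g a z : ℝ) - gdist g a v)
        = gdist g u z * ∑ a ∈ A with g e a ≠ u, x a := by
      rw [Finset.mul_sum]
      refine Finset.sum_congr rfl fun a ha => ?_
      have ha' := (hAmem a).1 (Finset.mem_filter.1 ha).1
      have hau := (Finset.mem_filter.1 ha).2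
      have h5 : gdist g a z = gdist g a u + gdist g u z :=
        hBu.gdist_add h (by rw [mem_coBranch]; tauto) hzu
      have h6 := gdist_gate h heu hau
      have h7 := gdist_gate h hev ha'.2
      rw [h5, gdist_comm a u, gdist_comm a v, h6, h7]
      push_cast; ring
    have h5 : ∑ a ∈ A with g e a = u, x a + x z ≤ ∑ a with g e a = u, x a := by
      rw [add_comm, ← Finset.sum_insert (by rw [Finset.mem_filter, hAmem]; tauto)]
      refine Finset.sum_le_sum_of_subset_of_nonneg ?_ fun a _ _ => (hx0 a).le
      intro a ha
      rw [Finset.mem_insert, Finset.mem_filter] at ha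
      rw [Finset.mem_filter_univ]
      rcases ha with rfl | ha
      · exact hz.1
      · exact ha.2
    have h6 : ∑ a with g e a = w, x a ≤ ∑ a ∈ A with g e a ≠ u, x a := by
      refine Finset.sum_le_sum_of_subset_of_nonneg ?_ fun a _ _ => (hx0 a).le
      intro a ha
      rw [Finset.mem_filter_univ] at ha
      rw [Finset.mem_filter, hAmem, ha]
      refine ⟨⟨?_, hvw.symm⟩, huw.symm⟩
      rintro rfl
      exact huw (by rw [← hz.1, ha])
    have h7 : ∑ a ∈ A with g e a = u, x a < ∑ a ∈ A with g e a ≠ u, x a := by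
      have := hx0 z
      linarith
    have h8 := mul_lt_mul_of_pos_left h7 hD
    rw [h4]
    linarith
  have := mul_pos ht hφ
  linarith

/-- An edge of an extremal hypertree has at most two vertices of degree at least two. -/
lemma IsExtremal.not_three_branching (hg : IsExtremal k n g) (hk : 2 ≤ k)
    {e : ι} {u v w : V} (huv : u ≠ v) (huw : u ≠ w) (hvw : v ≠ w) (heu : g e u = u)
    (hev : g e v = v) (hew : g e w = w) (hdu : 2 ≤ deg g u) (hdv : 2 ≤ deg g v)
    (hdw : 2 ≤ deg g w) : False := by
  have : Nontrivial V := ⟨u, v, huv⟩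
  obtain ⟨x, hx0, hx, -⟩ := exists_perron hg.tree
  -- The hypothesis is symmetric in the three vertices, so the one with the lightest part can play
  -- the role of `u`.
  set S : V → ℝ := fun y => ∑ a with g e a = y, x a with hS
  by_cases h1 : S u ≤ S v ∧ S u ≤ S w
  · exact hg.not_three_branching_of_le hk hx0 hx huv huw hvw heu hev hdu h1.1 h1.2
  · by_cases h2 : S v ≤ S u ∧ S v ≤ S w
    · exact hg.not_three_branching_of_le hk hx0 hx huv.symm hvw huw hev heu hdv h2.1 h2.2
    · have h3 : S w ≤ S u ∧ S w ≤ S v := by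
        constructor <;> by_contra h3 <;> grind
      exact hg.not_three_branching_of_le hk hx0 hx huw.symm hvw.symm huv hew heu hdw h3.1 h3.2

variable {p q : V} {B B' : Finset V}

lemma IsBranch.move_of_disjoint (h : IsGateTree g) (hB : IsBranch g p B) (hB' : IsBranch g q B')
    (hd : Disjoint B B') (hq : q ∉ B) : IsBranch (GateTree.move g p q B) q B' := by
  refine ⟨hB'.notMem, fun j => ?_⟩
  by_cases hj : ∃ b ∈ B, g j b = b
  · right
    intro v hv
    rw [edge_move_of_exists h hB hq hj] at hv
    rcases hv with hv | hv
    · exact Finset.disjoint_left.1 hd hv.1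
    · rw [hv.1]; exact hB'.notMem
  · push Not at hj
    simp_rw [edge_move_of_forall h hj]
    exact hB'.edges j

lemma attach_move_of_disjoint (h : IsGateTree g) (hB : IsBranch g p B) (hB' : IsBranch g q B')
    (hd : Disjoint B B') (hq : q ∉ B) (hp : p ∉ B') :
    attach (GateTree.move g p q B) q B' = attach g q B' := by
  rw [attach, attach]
  congr 1
  ext j
  rw [Finset.mem_filter_univ, Finset.mem_filter_univ]
  by_cases hj : ∃ b ∈ B, g j b = b
  · simp_rw [edge_move_of_exists h hB hq hj]
    have h1 : ¬ ∃ b ∈ B', g j b = b := by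
      rintro ⟨b, hb, hjb⟩
      rcases hB.mem_or hj hjb with h2 | rfl
      · exact Finset.disjoint_left.1 hd h2 hb
      · exact hp hb
    have h2 : ¬ ∃ b ∈ B', b ∈ B ∧ g j b = b ∨ b = q ∧ g j p = p := by
      rintro ⟨b, hb, h3 | h3⟩
      · exact Finset.disjoint_left.1 hd h3.1 hb
      · rw [h3.1] at hb; exact hB'.notMem hb
    simp only [h1, h2, and_false]
  · push Not at hj
    simp_rw [edge_move_of_forall h hj]

/-- Exchange the branch `B` at `p` with the branch `B'` at `q`. -/
def exchange (g : ι → V → V) (p q : V) (B B' : Finset V) : ι → V → V :=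
  move (move g p q B) q p B'

lemma isGateTree_exchange (h : IsGateTree g) (hB : IsBranch g p B) (hB' : IsBranch g q B')
    (hd : Disjoint B B') (hq : q ∉ B) (hp : p ∉ B') : IsGateTree (exchange g p q B B') :=
  isGateTree_move (isGateTree_move h hB hq) (hB.move_of_disjoint h hB' hd hq) hp

lemma card_edge_exchange (h : IsGateTree g) (hB : IsBranch g p B) (hB' : IsBranch g q B')
    (hd : Disjoint B B') (hq : q ∉ B) (hp : p ∉ B') (j : ι) :
    (edge (exchange g p q B B') j).card = (edge g j).card := by
  rw [exchange, card_edge_move (isGateTree_move h hB hq) (hB.move_of_disjoint h hB' hd hq) hp,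
    card_edge_move h hB hq]

lemma deg_exchange (h : IsGateTree g) (hB : IsBranch g p B) (hB' : IsBranch g q B')
    (hd : Disjoint B B') (hq : q ∉ B) (hp : p ∉ B') (hpq : p ≠ q)
    (ha : attach g p B = attach g q B') (v : V) : deg (exchange g p q B B') v = deg g v := by
  have h1 := isGateTree_move h hB hq
  have h2 := hB.move_of_disjoint h hB' hd hq
  have h3 := attach_move_of_disjoint h hB hB' hd hq hp
  have h4 := deg_move_left h hB hq hpq
  have h5 := deg_move_right h hB hq hpq
  by_cases hvp : v = p
  · subst hvp
    rw [exchange, deg_move_right h1 h2 hp hpq.symm]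
    omega
  · by_cases hvq : v = q
    · subst hvq
      have := deg_move_left h1 h2 hp hpq.symm
      rw [exchange]
      omega
    · rw [exchange, deg_move_of_ne h1 h2 hp hvq hvp, deg_move_of_ne h hB hq hvp hvq]

/-- The two moves contribute opposite terms on the common complement. Their interaction terms, both
the product of the two weights with `gdist g p q`, cancel, since the distances between `B` and `B'`
are restored. -/
lemma form_exchange (h : IsGateTree g) (hB : IsBranch g p B) (hB' : IsBranch g q B')
    (hd : Disjoint B B') (hq : q ∉ B) (hp : p ∉ B') (x : V → ℝ) :
    form (exchange g p q B B') x = form g x + 2 * (∑ b ∈ B, x b - ∑ b ∈ B', x b) *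
      ∑ a ∈ (B ∪ B')ᶜ, x a * ((gdist g a q : ℝ) - gdist g a p) := by
  have h1 := isGateTree_move h hB hq
  have h2 := hB.move_of_disjoint h hB' hd hq
  rw [exchange, form_move h1 h2 hp, form_move h hB hq]
  have hc : Bᶜ = (B ∪ B')ᶜ ∪ B' := by
    ext a
    have : a ∈ B → a ∉ B' := fun h3 => Finset.disjoint_left.1 hd h3
    simp only [Finset.mem_compl, Finset.mem_union]
    tauto
  have hc' : B'ᶜ = (B ∪ B')ᶜ ∪ B := by
    ext a
    have : a ∈ B → a ∉ B' := fun h3 => Finset.disjoint_left.1 hd h3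
    simp only [Finset.mem_compl, Finset.mem_union]
    tauto
  have hd1 : Disjoint (B ∪ B')ᶜ B' := by
    rw [Finset.disjoint_left]; intro a; simp only [Finset.mem_compl, Finset.mem_union]; tauto
  have hd2 : Disjoint (B ∪ B')ᶜ B := by
    rw [Finset.disjoint_left]; intro a; simp only [Finset.mem_compl, Finset.mem_union]; tauto
  have e1 : ∑ a ∈ Bᶜ, x a * ((gdist g a q : ℝ) - gdist g a p)
      = ∑ a ∈ (B ∪ B')ᶜ, x a * ((gdist g a q : ℝ) - gdist g a p)
        - (∑ b ∈ B', x b) * gdist g p q := by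
    rw [hc, Finset.sum_union hd1, Finset.sum_mul, sub_eq_add_neg, ← Finset.sum_neg_distrib]
    congr 1
    refine Finset.sum_congr rfl fun a ha => ?_
    rw [gdist_comm a p, hB'.gdist_add h hp ha, gdist_comm a q]
    push_cast; ring
  have e2 : ∑ a ∈ B'ᶜ, x a * ((gdist (move g p q B) a p : ℝ) - gdist (move g p q B) a q)
      = -∑ a ∈ (B ∪ B')ᶜ, x a * ((gdist g a q : ℝ) - gdist g a p)
        + (∑ b ∈ B, x b) * gdist g p q := by
    rw [hc', Finset.sum_union hd2, Finset.sum_mul, ← Finset.sum_neg_distrib]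
    congr 1
    · refine Finset.sum_congr rfl fun a ha => ?_
      have haB : a ∉ B := fun h3 => Finset.disjoint_left.1 hd2 ha h3
      rw [gdist_move_notMem h hB haB hB.notMem, gdist_move_notMem h hB haB hq]
      ring
    · refine Finset.sum_congr rfl fun a ha => ?_
      rw [gdist_comm a p, gdist_comm a q, gdist_move h hB hq hB.notMem ha,
        gdist_move_left h hB hq ha]
      push_cast; ring
  rw [e1, e2]
  ring

/-- Here `w` lies on `i₁`, the edge at `u` with the lightest branch. The branch `i₂` at `u` is
exchanged with a branch at `w` starting with a further edge `f`. Each is joined by a single edge, so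
all degrees persist. The branch of `f` is a proper part of the lightest branch, hence lighter than
that of `i₂`; and among the vertices not exchanged, `u` with branch `i₃` outweighs what remains of
branch `i₁`. So both factors in `form_exchange` are positive. -/
lemma IsExtremal.not_three_long_of_le (hg : IsExtremal k n g) (hk : 2 ≤ k) {x : V → ℝ}
    (hx0 : ∀ v, 0 < x v) (hx : ∀ v, ∑ w, (gdist g v w : ℝ) * x w = rad g * x v)
    {u w : V} {i₁ i₂ i₃ : ι} (h₁₂ : i₁ ≠ i₂) (h₁₃ : i₁ ≠ i₃) (h₂₃ : i₂ ≠ i₃) (h₁ : g i₁ u = u)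
    (h₂ : g i₂ u = u) (h₃ : g i₃ u = u) (hw : g i₁ w = w) (hwu : w ≠ u) (hdw : 2 ≤ deg g w)
    (hm₂ : mass x (edgeBranch g i₁ u) ≤ mass x (edgeBranch g i₂ u))
    (hm₃ : mass x (edgeBranch g i₁ u) ≤ mass x (edgeBranch g i₃ u)) : False := by
  have h := hg.tree
  have h2 := hg.two_le hk
  obtain ⟨f, hf, hfw⟩ : ∃ f, f ≠ i₁ ∧ g f w = w := by
    obtain ⟨i, j, hij, hi, hj⟩ := exists_two_edges hdw
    by_cases hi1 : i = i₁
    · exact ⟨j, fun hj1 => hij (hi1.trans hj1.symm), hj⟩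
    · exact ⟨i, hi1, hi⟩
  have hB₁ := isBranch_edgeBranch h h₁
  have hB₂ := isBranch_edgeBranch h h₂
  have hB₃ := isBranch_edgeBranch h h₃
  have hBf := isBranch_edgeBranch h hfw
  have hsub : edgeBranch g f w ⊆ edgeBranch g i₁ u := by
    intro v hv
    rw [mem_edgeBranch] at hv ⊢
    rw [gate_eq_of_gate_ne h hf hfw hw hv]
    exact hwu
  have hw1 : w ∈ edgeBranch g i₁ u := by rw [mem_edgeBranch, hw]; exact hwu
  have hd12 := edgeBranch_disjoint h h₁₂ h₁ h₂
  have hd : Disjoint (edgeBranch g i₂ u) (edgeBranch g f w) :=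
    (Finset.disjoint_of_subset_left hsub hd12).symm
  have hw2 : w ∉ edgeBranch g i₂ u := Finset.disjoint_left.1 hd12 hw1
  have huf : u ∉ edgeBranch g f w := fun h3 => hB₁.notMem (hsub h3)
  have hatt : attach g u (edgeBranch g i₂ u) = attach g w (edgeBranch g f w) := by
    rw [attach_edgeBranch h h₂ (exists_ne_of_two_le h2 _ _),
      attach_edgeBranch h hfw (exists_ne_of_two_le h2 _ _)]
  have hclass : InClass k n (exchange g u w (edgeBranch g i₂ u) (edgeBranch g f w)) := by
    refine ⟨isGateTree_exchange h hB₂ hBf hd hw2 huf, fun i => ?_, ?_⟩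
    · rw [card_edge_exchange h hB₂ hBf hd hw2 huf, hg.unif]
    · rw [big]
      simp_rw [deg_exchange h hB₂ hBf hd hw2 huf hwu.symm hatt]
      exact hg.many
  have : Nontrivial V := ⟨w, u, hwu⟩
  have hle := hg.form_le hx hclass (y := x) rfl
  rw [form_exchange h hB₂ hBf hd hw2 huf] at hle
  have hlt : mass x (edgeBranch g f w) + x w ≤ mass x (edgeBranch g i₁ u) := by
    rw [mass, add_comm, ← Finset.sum_insert hBf.notMem]
    exact Finset.sum_le_sum_of_subset_of_nonneg (Finset.insert_subset hw1 hsub)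
      fun a _ _ => (hx0 a).le
  have hxw := hx0 w
  have ht : 0 < ∑ b ∈ edgeBranch g i₂ u, x b - ∑ b ∈ edgeBranch g f w, x b := by
    rw [mass, mass] at *
    linarith
  have hφ := shift_pos h hB₁ hw1 (edgeBranch g i₂ u ∪ edgeBranch g f w)ᶜ hx0 ?_
  · have := mul_pos ht hφ
    linarith
  · have h7 : ∑ a ∈ (edgeBranch g i₂ u ∪ edgeBranch g f w)ᶜ with a ∈ edgeBranch g i₁ u, x a
        ≤ mass x (edgeBranch g i₁ u) := by
      refine Finset.sum_le_sum_of_subset_of_nonneg ?_ fun a _ _ => (hx0 a).le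
      intro a ha
      exact (Finset.mem_filter.1 ha).2
    have h8 : x u + mass x (edgeBranch g i₃ u)
        ≤ ∑ a ∈ (edgeBranch g i₂ u ∪ edgeBranch g f w)ᶜ with a ∉ edgeBranch g i₁ u, x a := by
      rw [mass, ← Finset.sum_insert hB₃.notMem]
      refine Finset.sum_le_sum_of_subset_of_nonneg ?_ fun a _ _ => (hx0 a).le
      intro a ha
      rw [Finset.mem_filter, Finset.mem_compl, Finset.mem_union, not_or]
      rcases Finset.mem_insert.1 ha with rfl | ha
      · exact ⟨⟨hB₂.notMem, huf⟩, hB₁.notMem⟩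
      · have h9 := Finset.disjoint_left.1 (edgeBranch_disjoint h h₁₃.symm h₃ h₁) ha
        exact ⟨⟨Finset.disjoint_left.1 (edgeBranch_disjoint h h₂₃.symm h₃ h₂) ha,
          fun h10 => h9 (hsub h10)⟩, h9⟩
    have := hx0 u
    linarith

/-- Of three edges at a vertex of an extremal hypertree, one is pendant. -/
lemma IsExtremal.exists_pendant (hg : IsExtremal k n g) (hk : 2 ≤ k)
    {u : V} {i₁ i₂ i₃ : ι} (h₁₂ : i₁ ≠ i₂) (h₁₃ : i₁ ≠ i₃) (h₂₃ : i₂ ≠ i₃) (h₁ : g i₁ u = u)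
    (h₂ : g i₂ u = u) (h₃ : g i₃ u = u) :
    (∀ w, g i₁ w = w → w ≠ u → deg g w ≤ 1) ∨ (∀ w, g i₂ w = w → w ≠ u → deg g w ≤ 1) ∨
      (∀ w, g i₃ w = w → w ≠ u → deg g w ≤ 1) := by
  have := hg.toInClass.nontrivial hk i₁
  obtain ⟨x, hx0, hx, -⟩ := exists_perron hg.tree
  by_contra hcon
  push Not at hcon
  obtain ⟨⟨w₁, a₁, b₁, c₁⟩, ⟨w₂, a₂, b₂, c₂⟩, ⟨w₃, a₃, b₃, c₃⟩⟩ := hcon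
  set S : ι → ℝ := fun i => mass x (edgeBranch g i u) with hS
  by_cases h4 : S i₁ ≤ S i₂ ∧ S i₁ ≤ S i₃
  · exact hg.not_three_long_of_le hk hx0 hx h₁₂ h₁₃ h₂₃ h₁ h₂ h₃ a₁ b₁ c₁ h4.1 h4.2
  · by_cases h5 : S i₂ ≤ S i₁ ∧ S i₂ ≤ S i₃
    · exact hg.not_three_long_of_le hk hx0 hx h₁₂.symm h₂₃ h₁₃ h₂ h₁ h₃ a₂ b₂ c₂ h5.1 h5.2
    · have h6 : S i₃ ≤ S i₁ ∧ S i₃ ≤ S i₂ := by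
        constructor <;> by_contra h6 <;> grind
      exact hg.not_three_long_of_le hk hx0 hx h₁₃.symm h₂₃.symm h₁₂ h₃ h₁ h₂ a₃ b₃ c₃ h6.1 h6.2

end Exchange

end GateTree

/-! ### Embeddings of hypertrees are isometric -/

namespace GateTree

section Embedding

variable {ι V ι' V' : Type*} [Fintype ι] [DecidableEq ι] [Fintype V] [DecidableEq V]
  [Fintype ι'] [DecidableEq ι'] [Fintype V'] [DecidableEq V']

/-- `φ` and `ε` map the vertices and the edges of a hypertree to those of another one. -/
structure IsEmb (g : ι → V → V) (g' : ι' → V' → V') (φ : V → V') (ε : ι → ι') : Prop where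
  inj : Function.Injective ε
  mem : ∀ i v, g i v = v → g' (ε i) (φ v) = φ v
  injOn : ∀ i u v, g i u = u → g i v = v → φ u = φ v → u = v

variable {g : ι → V → V} {g' : ι' → V' → V'} {φ : V → V'} {ε : ι → ι'}

/-- Preservation of incidences already determines the gates: on the way from `v` to its gate `w` in
`i`, every edge used differs from `i`, so its image differs from `ε i` and cannot change the gate in
`ε i`. -/
lemma IsEmb.gate (H : IsEmb g g' φ ε) (h : IsGateTree g) (h' : IsGateTree g') (i : ι) (v : V) :
    g' (ε i) (φ v) = φ (g i v) := by
  have key : ∀ w, g i w = w → g i v = w → g' (ε i) (φ v) = φ w := by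
    intro w hw
    refine gate_induction h w (P := fun v => g i v = w → g' (ε i) (φ v) = φ w)
      (fun _ => H.mem i w hw) ?_ v
    intro u j _ hu hv ih hiu
    by_cases hji : j = i
    · subst hji
      exact absurd (hw.trans (hiu.symm.trans hu)) hv
    · have h1 : g i (g j w) = w := (const' h hji hu (h.idem j w)).symm.trans hiu
      rw [const' h' (fun e => hji (H.inj e)) (H.mem j u hu) (H.mem j _ (h.idem j w)), ih h1]
  exact key _ (h.idem i v) rfl

lemma IsEmb.gate_of_notMem (H : IsEmb g g' φ ε) (h : IsGateTree g) (h' : IsGateTree g') {f : ι'}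
    (hf : ∀ i, ε i ≠ f) (u v : V) : g' f (φ u) = g' f (φ v) := by
  refine gate_induction h v (P := fun u => g' f (φ u) = g' f (φ v)) rfl ?_ u
  intro u j _ hu _ ih
  rw [← ih, const' h' (hf j) (H.mem j u hu) (H.mem j _ (h.idem j v))]

/-- Edges outside the image of `ε` never separate two vertices in the image of `φ`, and the edge `ε
i` does so exactly when `i` separates their preimages. -/
lemma IsEmb.gdist (H : IsEmb g g' φ ε) (h : IsGateTree g) (h' : IsGateTree g') (u v : V) :
    gdist g' (φ u) (φ v) = GateTree.gdist g u v := by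
  have : sep g' (φ u) (φ v) = (sep g u v).map ⟨ε, H.inj⟩ := by
    ext f
    simp only [mem_sep, Finset.mem_map, Function.Embedding.coeFn_mk]
    constructor
    · intro h1
      by_cases hf : ∃ i, ε i = f
      · obtain ⟨i, rfl⟩ := hf
        rw [H.gate h h', H.gate h h'] at h1
        exact ⟨i, fun e => h1 (by rw [e]), rfl⟩
      · push Not at hf
        exact absurd (H.gate_of_notMem h h' hf u v) h1
    · rintro ⟨i, hi, rfl⟩
      rw [H.gate h h', H.gate h h']
      exact fun e => hi (H.injOn i _ _ (h.idem i u) (h.idem i v) e)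
  rw [GateTree.gdist, this, Finset.card_map, GateTree.gdist]

lemma IsEmb.injective (H : IsEmb g g' φ ε) (h : IsGateTree g) (h' : IsGateTree g') :
    Function.Injective φ := by
  intro u v huv
  rw [← gdist_eq_zero h, ← H.gdist h h', huv, gdist_self]

lemma IsEmb.map_edge (H : IsEmb g g' φ ε) (h : IsGateTree g) (h' : IsGateTree g') {i : ι}
    (hc : (edge g i).card = (edge g' (ε i)).card) :
    (edge g i).image φ = edge g' (ε i) := by
  refine Finset.eq_of_subset_of_card_le ?_ ?_
  · intro v hv
    obtain ⟨u, hu, rfl⟩ := Finset.mem_image.1 hv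
    exact mem_edge.2 (H.mem i u (mem_edge.1 hu))
  · rw [Finset.card_image_of_injective _ (H.injective h h'), hc]

lemma IsEmb.surjective (H : IsEmb g g' φ ε) (h : IsGateTree g) (h' : IsGateTree g')
    (hc : ∀ i, (edge g i).card = (edge g' (ε i)).card) (hε : Function.Surjective ε)
    [Nontrivial V'] : Function.Surjective φ := by
  intro v
  obtain ⟨w, hw⟩ := exists_ne v
  obtain ⟨f, hf, -⟩ := h'.step hw.symm
  obtain ⟨i, rfl⟩ := hε f
  have h1 : v ∈ (edge g i).image φ := by rw [H.map_edge h h' (hc i)]; exact mem_edge.2 hf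
  obtain ⟨u, -, hu⟩ := Finset.mem_image.1 h1
  exact ⟨u, hu⟩

lemma hasEigenvalue_of_gdist_eq (f : V ≃ V')
    (hf : ∀ u v, gdist g' (f u) (f v) = gdist g u v) {μ : ℝ}
    (hμ : Module.End.HasEigenvalue (distMat g).mulVecLin μ) :
    Module.End.HasEigenvalue (distMat g').mulVecLin μ := by
  obtain ⟨z, hz⟩ := hμ.exists_hasEigenvector
  refine Module.End.hasEigenvalue_of_hasEigenvector (x := fun v => z (f.symm v)) ⟨?_, ?_⟩
  · rw [Module.End.mem_eigenspace_iff]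
    ext v
    have h1 := congrFun (Module.End.mem_eigenspace_iff.1 hz.1) (f.symm v)
    simp only [distMat, Matrix.mulVecLin_apply, Matrix.mulVec, dotProduct, Matrix.of_apply,
      Pi.smul_apply] at h1 ⊢
    rw [← h1, ← Equiv.sum_comp f]
    refine Finset.sum_congr rfl fun w _ => ?_
    rw [Equiv.symm_apply_apply, ← hf, Equiv.apply_symm_apply]
  · intro h0
    apply hz.2
    ext v
    simpa using congrFun h0 (f v)

lemma rad_eq_of_gdist_eq (f : V ≃ V') (hf : ∀ u v, gdist g' (f u) (f v) = gdist g u v) :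
    rad g = rad g' := by
  rw [rad, rad]
  congr 1
  ext μ
  refine ⟨hasEigenvalue_of_gdist_eq f hf, hasEigenvalue_of_gdist_eq f.symm fun u v => ?_⟩
  rw [← hf, Equiv.apply_symm_apply, Equiv.apply_symm_apply]

end Embedding

/-! ### Caterpillars as gate trees -/

section Caterpillar

open Hypergraph

/-- The edges of a caterpillar with stars. -/
abbrev CatEdge (L : ℕ) (c : Fin (L + 1) → ℕ) : Type := Fin L ⊕ ((i : Fin (L + 1)) × Fin (c i))

/-- The gate maps of a caterpillar with stars. -/
def catGate (k L : ℕ) (c : Fin (L + 1) → ℕ) :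
    CatEdge L c → StarCaterpillarVertex k L c → StarCaterpillarVertex k L c
  | .inl j, .inl i => if (i : ℕ) ≤ j then .inl j.castSucc else .inl j.succ
  | .inl j, .inr (.inl (j', x)) =>
      if j' = j then .inr (.inl (j', x)) else if (j' : ℕ) < j then .inl j.castSucc else .inl j.succ
  | .inl j, .inr (.inr ⟨i, _, _⟩) => if (i : ℕ) ≤ j then .inl j.castSucc else .inl j.succ
  | .inr s, .inl _ => .inl s.1
  | .inr s, .inr (.inl _) => .inl s.1
  | .inr s, .inr (.inr ⟨i, t, x⟩) =>
      if (⟨i, t⟩ : (i : Fin (L + 1)) × Fin (c i)) = s then .inr (.inr ⟨i, t, x⟩) else .inl s.1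

variable {k L : ℕ} {c : Fin (L + 1) → ℕ}

@[simp] lemma catGate_path_inl (j : Fin L) (i : Fin (L + 1)) :
    catGate k L c (.inl j) (.inl i) = if (i : ℕ) ≤ j then .inl j.castSucc else .inl j.succ := rfl

@[simp] lemma catGate_path_leaf (j j' : Fin L) (x : Fin (k - 2)) :
    catGate k L c (.inl j) (.inr (.inl (j', x))) =
      if j' = j then .inr (.inl (j', x)) else if (j' : ℕ) < j then .inl j.castSucc else .inl j.succ := rfl

@[simp] lemma catGate_path_star (j : Fin L) (i : Fin (L + 1)) (t : Fin (c i)) (x : Fin (k - 1)) :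
    catGate k L c (.inl j) (.inr (.inr ⟨i, t, x⟩)) =
      if (i : ℕ) ≤ j then .inl j.castSucc else .inl j.succ := rfl

@[simp] lemma catGate_star_inl (s : (i : Fin (L + 1)) × Fin (c i)) (i : Fin (L + 1)) :
    catGate k L c (.inr s) (.inl i) = .inl s.1 := rfl

@[simp] lemma catGate_star_leaf (s : (i : Fin (L + 1)) × Fin (c i)) (y : Fin L × Fin (k - 2)) :
    catGate k L c (.inr s) (.inr (.inl y)) = .inl s.1 := rfl

@[simp] lemma catGate_star_star (s : (i : Fin (L + 1)) × Fin (c i)) (i : Fin (L + 1))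
    (t : Fin (c i)) (x : Fin (k - 1)) : catGate k L c (.inr s) (.inr (.inr ⟨i, t, x⟩)) =
      if (⟨i, t⟩ : (i : Fin (L + 1)) × Fin (c i)) = s then .inr (.inr ⟨i, t, x⟩) else .inl s.1 := rfl

lemma isGateTree_catGate (k L : ℕ) (c : Fin (L + 1) → ℕ) : IsGateTree (catGate k L c) := by
  refine ⟨?_, ?_, ?_⟩
  · rintro (j | s) (i | ⟨j', x⟩ | ⟨i, t, x⟩)
    · simp only [catGate_path_inl]; split_ifs <;> simp
    · simp only [catGate_path_leaf]; split_ifs <;> simp [*]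
    · simp only [catGate_path_star]; split_ifs <;> simp
    · simp
    · simp
    · simp only [catGate_star_star]; split_ifs <;> simp [*]
  · have key : ∀ (i j : CatEdge L c), i ≠ j → ∃ w, ∀ u, catGate k L c j (catGate k L c i u) = w := by
      rintro (i | s) (j | s') hij
      · have hij' : (i : ℕ) ≠ j := fun e => hij (by rw [Fin.ext e])
        have hij2 : i ≠ j := fun e => hij (by rw [e])
        rcases lt_or_gt_of_ne hij' with hlt | hlt
        · refine ⟨.inl j.castSucc, ?_⟩
          have e1 : catGate k L c (.inl j) (.inl i.castSucc) = .inl j.castSucc := by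
            rw [catGate_path_inl, if_pos (by rw [Fin.val_castSucc]; omega)]
          have e2 : catGate k L c (.inl j) (.inl i.succ) = .inl j.castSucc := by
            rw [catGate_path_inl, if_pos (by rw [Fin.val_succ]; omega)]
          rintro (i' | ⟨j', x⟩ | ⟨i', t, x⟩)
          · rw [catGate_path_inl]; split_ifs <;> assumption
          · rw [catGate_path_leaf]
            split_ifs with h1 h2
            · rw [catGate_path_leaf, h1, if_neg hij2, if_pos hlt]
            · assumption
            · assumption
          · rw [catGate_path_star]; split_ifs <;> assumption
        · refine ⟨.inl j.succ, ?_⟩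
          have e1 : catGate k L c (.inl j) (.inl i.castSucc) = .inl j.succ := by
            rw [catGate_path_inl, if_neg (by rw [Fin.val_castSucc]; omega)]
          have e2 : catGate k L c (.inl j) (.inl i.succ) = .inl j.succ := by
            rw [catGate_path_inl, if_neg (by rw [Fin.val_succ]; omega)]
          rintro (i' | ⟨j', x⟩ | ⟨i', t, x⟩)
          · rw [catGate_path_inl]; split_ifs <;> assumption
          · rw [catGate_path_leaf]
            split_ifs with h1 h2
            · rw [catGate_path_leaf, h1, if_neg hij2, if_neg (by omega)]
            · assumption
            · assumption
          · rw [catGate_path_star]; split_ifs <;> assumption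
      · refine ⟨.inl s'.1, ?_⟩
        rintro (i' | ⟨j', x⟩ | ⟨i', t, x⟩)
        · rw [catGate_path_inl]; split_ifs <;> simp
        · rw [catGate_path_leaf]; split_ifs <;> simp
        · rw [catGate_path_star]; split_ifs <;> simp
      · refine ⟨catGate k L c (.inl j) (.inl s.1), ?_⟩
        rintro (i' | ⟨j', x⟩ | ⟨i', t, x⟩)
        · rw [catGate_star_inl]
        · rw [catGate_star_leaf]
        · rw [catGate_star_star]
          split_ifs with hs
          · subst hs; rw [catGate_path_star, catGate_path_inl]
          · rfl
      · refine ⟨.inl s'.1, ?_⟩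
        have hss : s ≠ s' := fun e => hij (by rw [e])
        rintro (i' | ⟨j', x⟩ | ⟨i', t, x⟩)
        · rw [catGate_star_inl, catGate_star_inl]
        · rw [catGate_star_leaf, catGate_star_inl]
        · rw [catGate_star_star]
          split_ifs with hs
          · subst hs
            rw [catGate_star_star, if_neg hss]
          · rw [catGate_star_inl]
    intro i j hij u v
    obtain ⟨w, hw⟩ := key i j hij
    rw [hw, hw]
  · have key : ∀ (i i' : Fin (L + 1)), i ≠ i' → ∃ j : Fin L,
        catGate k L c (.inl j) (.inl i) = .inl i ∧
          (if (i' : ℕ) ≤ j then (.inl j.castSucc : StarCaterpillarVertex k L c)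
            else .inl j.succ) ≠ .inl i := by
      intro i i' hii
      have hii' : (i : ℕ) ≠ i' := fun e => hii (Fin.ext e)
      rcases lt_or_gt_of_ne hii' with hlt | hlt
      · refine ⟨⟨i, by omega⟩, ?_, ?_⟩
        · rw [catGate_path_inl, if_pos le_rfl]; rfl
        · rw [if_neg (not_le.2 hlt)]
          simp [Fin.ext_iff]
      · refine ⟨⟨i - 1, by omega⟩, ?_, ?_⟩
        · rw [catGate_path_inl, if_neg (by simp only; omega)]
          simp [Fin.ext_iff]; omega
        · rw [if_pos (by simp only; omega)]
          simp [Fin.ext_iff]; omega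
    rintro (i | ⟨j, x⟩ | ⟨i, t, x⟩) (i' | ⟨j', x'⟩ | ⟨i', t', x'⟩) huv
    · have hii : i ≠ i' := fun e => huv (by rw [e])
      obtain ⟨j, h1, h2⟩ := key i i' hii
      exact ⟨.inl j, h1, h2⟩
    · by_cases hlt : (i : ℕ) ≤ j'
      · refine ⟨.inl ⟨i, by omega⟩, ?_, ?_⟩
        · rw [catGate_path_inl, if_pos le_rfl]; rfl
        · rw [catGate_path_leaf, if_neg (c := (j' : ℕ) < _) (not_lt.2 hlt)]
          split_ifs with h1
          · simp
          · simp [Fin.ext_iff]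
      · refine ⟨.inl ⟨i - 1, by omega⟩, ?_, ?_⟩
        · rw [catGate_path_inl, if_neg (by simp only; omega)]
          simp [Fin.ext_iff]; omega
        · rw [catGate_path_leaf]
          split_ifs with h1 h2
          · simp
          · simp [Fin.ext_iff]; omega
          · rw [Fin.ext_iff] at h1; simp only at h1 h2; omega
    · by_cases hii : i = i'
      · subst hii
        exact ⟨.inr ⟨i, t'⟩, rfl, by simp⟩
      · obtain ⟨j, h1, h2⟩ := key i i' hii
        exact ⟨.inl j, h1, h2⟩
    · exact ⟨.inl j, by simp, by rw [catGate_path_inl]; split_ifs <;> simp⟩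
    · refine ⟨.inl j, by simp, ?_⟩
      rw [catGate_path_leaf]
      split_ifs with h1
      · exact huv.symm
      · simp
      · simp
    · exact ⟨.inl j, by simp, by rw [catGate_path_star]; split_ifs <;> simp⟩
    · exact ⟨.inr ⟨i, t⟩, by simp, by simp⟩
    · exact ⟨.inr ⟨i, t⟩, by simp, by simp⟩
    · refine ⟨.inr ⟨i, t⟩, by simp, ?_⟩
      rw [catGate_star_star]
      split_ifs with h1
      · exact huv.symm
      · simp

lemma mem_pathEdge {j : Fin L} {v : StarCaterpillarVertex k L c} :
    v ∈ starCaterpillarPathEdge k L c j ↔ catGate k L c (.inl j) v = v := by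
  rw [starCaterpillarPathEdge]
  rcases v with i | ⟨j', x⟩ | ⟨i, t, x⟩
  · rw [catGate_path_inl]
    split_ifs with h
    · simp [Fin.ext_iff]; omega
    · simp [Fin.ext_iff]; omega
  · rw [catGate_path_leaf]
    split_ifs with h1 h2
    · simp [h1]
    · simp [Ne.symm h1]
    · simp [Ne.symm h1]
  · rw [catGate_path_star]
    split_ifs <;> simp

lemma mem_starEdge {i : Fin (L + 1)} {t : Fin (c i)} {v : StarCaterpillarVertex k L c} :
    v ∈ starCaterpillarStarEdge k L c i t ↔ catGate k L c (.inr ⟨i, t⟩) v = v := by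
  rw [starCaterpillarStarEdge]
  rcases v with i' | ⟨j', x⟩ | ⟨i', t', x⟩
  · simp [eq_comm]
  · simp
  · rw [catGate_star_star]
    split_ifs with h1
    · cases h1
      simp
    · simp only [Set.mem_union, Set.mem_singleton_iff, reduceCtorEq, Set.mem_range, Sum.inr.injEq,
        false_or, iff_false, not_exists]
      intro y hy
      cases hy
      exact h1 rfl

lemma card_edge_path (hk : 2 ≤ k) (j : Fin L) : (edge (catGate k L c) (.inl j)).card = k := by
  have : edge (catGate k L c) (.inl j) = ({.inl j.castSucc, .inl j.succ} : Finset _) ∪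
      Finset.univ.image fun x : Fin (k - 2) => .inr (.inl (j, x)) := by
    ext v
    rw [mem_edge, ← mem_pathEdge, starCaterpillarPathEdge]
    simp [or_assoc]
  rw [this, Finset.card_union_of_disjoint, Finset.card_pair, Finset.card_image_of_injective,
    Finset.card_univ, Fintype.card_fin]
  · omega
  · intro x y; simp
  · simp [Fin.ext_iff]
  · rw [Finset.disjoint_left]; simp

lemma card_edge_star (hk : 2 ≤ k) (s : (i : Fin (L + 1)) × Fin (c i)) :
    (edge (catGate k L c) (.inr s)).card = k := by
  have : edge (catGate k L c) (.inr s) = ({.inl s.1} : Finset _) ∪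
      Finset.univ.image fun x : Fin (k - 1) => .inr (.inr ⟨s.1, s.2, x⟩) := by
    ext v
    rw [mem_edge, show s = ⟨s.1, s.2⟩ from rfl, ← mem_starEdge, starCaterpillarStarEdge]
    simp
  rw [this, Finset.card_union_of_disjoint, Finset.card_singleton, Finset.card_image_of_injective,
    Finset.card_univ, Fintype.card_fin]
  · omega
  · intro x y; simp
  · rw [Finset.disjoint_left]; simp

lemma card_edge_cat (hk : 2 ≤ k) (i : CatEdge L c) : (edge (catGate k L c) i).card = k := by
  rcases i with j | s
  · exact card_edge_path hk j
  · exact card_edge_star hk s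

variable {ι V : Type*} [Fintype ι] [DecidableEq ι] [Fintype V] [DecidableEq V]

/-- A path with further edges at its vertices gives an embedded caterpillar. -/
lemma exists_emb_cat {g : ι → V → V} (hcard : ∀ i, (edge g i).card = k)
    (u : Fin (L + 1) → V) (e : Fin L → ι) (p : ((i : Fin (L + 1)) × Fin (c i)) → ι)
    (hinj : Function.Injective (Sum.elim e p)) (h1 : ∀ j : Fin L, g (e j) (u j.castSucc) = u j.castSucc)
    (h2 : ∀ j : Fin L, g (e j) (u j.succ) = u j.succ)
    (h3 : ∀ j : Fin L, u j.castSucc ≠ u j.succ) (h4 : ∀ s, g (p s) (u s.1) = u s.1) :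
    ∃ φ : StarCaterpillarVertex k L c → V, (∀ i, φ (.inl i) = u i) ∧
      IsEmb (catGate k L c) g φ (Sum.elim e p) := by
  -- The remaining `k - 2` vertices of each path edge, and below the `k - 1` noncentral vertices of
  -- each star edge, are enumerated arbitrarily.
  have hl : ∀ j : Fin L, ∃ f : Fin (k - 2) → V, Function.Injective f ∧
      ∀ x, g (e j) (f x) = f x ∧ f x ≠ u j.castSucc ∧ f x ≠ u j.succ := by
    intro j
    have hc : (((edge g (e j)).erase (u j.castSucc)).erase (u j.succ)).card = k - 2 := by
      rw [Finset.card_erase_of_mem, Finset.card_erase_of_mem, hcard]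
      · rfl
      · exact mem_edge.2 (h1 j)
      · exact Finset.mem_erase.2 ⟨(h3 j).symm, mem_edge.2 (h2 j)⟩
    refine ⟨fun x => ((Finset.equivFinOfCardEq hc).symm x).1, ?_, ?_⟩
    · exact Subtype.val_injective.comp (Equiv.injective _)
    · intro x
      have := ((Finset.equivFinOfCardEq hc).symm x).2
      rw [Finset.mem_erase, Finset.mem_erase, mem_edge] at this
      exact ⟨this.2.2, this.2.1, this.1⟩
  have hs : ∀ s, ∃ f : Fin (k - 1) → V, Function.Injective f ∧
      ∀ x, g (p s) (f x) = f x ∧ f x ≠ u s.1 := by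
    intro s
    have hc : ((edge g (p s)).erase (u s.1)).card = k - 1 := by
      rw [Finset.card_erase_of_mem, hcard]
      exact mem_edge.2 (h4 s)
    refine ⟨fun x => ((Finset.equivFinOfCardEq hc).symm x).1, ?_, ?_⟩
    · exact Subtype.val_injective.comp (Equiv.injective _)
    · intro x
      have := ((Finset.equivFinOfCardEq hc).symm x).2
      rw [Finset.mem_erase, mem_edge] at this
      exact ⟨this.2, this.1⟩
  choose f hf1 hf2 using hl
  choose f' hf1' hf2' using hs
  let φ : StarCaterpillarVertex k L c → V := fun v => match v with
    | .inl i => u i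
    | .inr (.inl (j, x)) => f j x
    | .inr (.inr ⟨i, t, x⟩) => f' ⟨i, t⟩ x
  refine ⟨φ, fun _ => rfl, hinj, ?_, ?_⟩
  · rintro (j | ⟨i, t⟩) v hv
    · rw [← mem_pathEdge] at hv
      rcases hv with (rfl | rfl) | ⟨x, rfl⟩
      · exact h1 j
      · exact h2 j
      · exact (hf2 j x).1
    · rw [← mem_starEdge] at hv
      rcases hv with rfl | ⟨x, rfl⟩
      · exact h4 ⟨i, t⟩
      · exact (hf2' ⟨i, t⟩ x).1
  · rintro (j | ⟨i, t⟩) v w hv hw hvw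
    · rw [← mem_pathEdge] at hv hw
      rcases hv with (rfl | rfl) | ⟨x, rfl⟩ <;> rcases hw with (rfl | rfl) | ⟨y, rfl⟩
      · rfl
      · exact absurd hvw (h3 j)
      · exact absurd hvw.symm (hf2 j y).2.1
      · exact absurd hvw.symm (h3 j)
      · rfl
      · exact absurd hvw.symm (hf2 j y).2.2
      · exact absurd hvw (hf2 j x).2.1
      · exact absurd hvw (hf2 j x).2.2
      · rw [hf1 j hvw]
    · rw [← mem_starEdge] at hv hw
      rcases hv with rfl | ⟨x, rfl⟩ <;> rcases hw with rfl | ⟨y, rfl⟩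
      · rfl
      · exact absurd hvw.symm (hf2' _ y).2
      · exact absurd hvw (hf2' _ x).2
      · have : x = y := hf1' _ hvw
        rw [this]

end Caterpillar

end GateTree

/-! ### Longest paths in extremal hypertrees -/

namespace GateTree

section Spine

variable {ι V : Type*} [Fintype ι] [DecidableEq ι] [Fintype V] [DecidableEq V]
variable {g : ι → V → V} {k n L : ℕ} {u : ℕ → V} {e : ℕ → ι}

/-- `(u 0, e 0, u 1, …, e (L - 1), u L)` is a path with distinct edges. -/
structure IsSpine (g : ι → V → V) (L : ℕ) (u : ℕ → V) (e : ℕ → ι) : Prop where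
  left : ∀ j < L, g (e j) (u j) = u j
  right : ∀ j < L, g (e j) (u (j + 1)) = u (j + 1)
  ne : ∀ j < L, u j ≠ u (j + 1)
  inj : ∀ i < L, ∀ j < L, e i = e j → i = j

/-- Each step crosses an edge at the current vertex that separates it from `t`. That edge is erased
from the separating set of the next vertex; carrying along `e j ∈ sep g s t` therefore gives the
distinctness of the edges. -/
lemma exists_spine [Nonempty ι] (h : IsGateTree g) (s t : V) :
    ∃ u e, IsSpine g (gdist g s t) u e ∧ u 0 = s ∧ u (gdist g s t) = t ∧
      ∀ j < gdist g s t, e j ∈ sep g s t := by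
  induction hd : gdist g s t generalizing s with
  | zero =>
    obtain rfl := (gdist_eq_zero h).1 hd
    exact ⟨fun _ => s, fun _ => Classical.arbitrary ι, ⟨by simp, by simp, by simp, by simp⟩, rfl, rfl,
      by simp⟩
  | succ d ih =>
    have hst : s ≠ t := by rintro rfl; simp at hd
    obtain ⟨i, hi, hit⟩ := h.step hst
    have h1 := gdist_gate h hi hit
    obtain ⟨u, e, hs, h0, hL, hsep⟩ := ih (g i t) (by omega)
    rw [sep_gate h hi] at hsep
    refine ⟨fun j => if j = 0 then s else u (j - 1), fun j => if j = 0 then i else e (j - 1),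
      ⟨?_, ?_, ?_, ?_⟩, rfl, by simpa using hL, ?_⟩
    · rintro (_ | j) hj
      · simpa using hi
      · simpa using hs.left j (by omega)
    · rintro (_ | j) hj
      · simp [h0, h.idem]
      · simpa using hs.right j (by omega)
    · rintro (_ | j) hj
      · simp [h0, Ne.symm hit]
      · simpa using hs.ne j (by omega)
    · rintro (_ | j) hj (_ | j') hj' hjj
      · rfl
      · have := hsep j' (by omega)
        simp only [if_true, Nat.add_sub_cancel, if_neg (Nat.succ_ne_zero _)] at hjj
        rw [← hjj] at this
        simp at this
      · have := hsep j (by omega)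
        simp only [if_true, Nat.add_sub_cancel, if_neg (Nat.succ_ne_zero _)] at hjj
        rw [hjj] at this
        simp at this
      · simp only [Nat.add_sub_cancel, if_neg (Nat.succ_ne_zero _)] at hjj
        rw [hs.inj j (by omega) j' (by omega) hjj]
    · rintro (_ | j) hj
      · simpa [hi] using Ne.symm hit
      · have := Finset.mem_of_mem_erase (hsep j (by omega))
        simpa using this

lemma IsSpine.reverse (hs : IsSpine g L u e) :
    IsSpine g L (fun i => u (L - i)) (fun j => e (L - 1 - j)) := by
  refine ⟨fun j hj => ?_, fun j hj => ?_, fun j hj => ?_, fun i hi j hj hij => ?_⟩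
  · have := hs.right (L - 1 - j) (by omega)
    rwa [show L - 1 - j + 1 = L - j by omega] at this
  · have := hs.left (L - 1 - j) (by omega)
    rwa [show L - 1 - j = L - (j + 1) by omega] at this ⊢
  · have := hs.ne (L - 1 - j) (by omega)
    rw [show L - 1 - j + 1 = L - j by omega, show L - 1 - j = L - (j + 1) by omega] at this
    exact this.symm
  · have := hs.inj _ (by omega) _ (by omega) hij
    omega

lemma IsSpine.gate_le (h : IsGateTree g) (hs : IsSpine g L u e) {i j : ℕ} (hij : i ≤ j)
    (hj : j < L) : g (e j) (u i) = u j := by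
  induction hd : j - i generalizing i with
  | zero => obtain rfl : i = j := by omega
            exact hs.left i hj
  | succ d ih =>
    rw [← ih (i := i + 1) (by omega) (by omega)]
    refine const' h (fun e => ?_) (hs.left i (by omega)) (hs.right i (by omega))
    have := hs.inj i (by omega) j hj e
    omega

lemma IsSpine.gate_lt (h : IsGateTree g) (hs : IsSpine g L u e) {i j : ℕ} (hij : j < i)
    (hi : i ≤ L) : g (e j) (u i) = u (j + 1) := by
  have := hs.reverse.gate_le h (i := L - i) (j := L - 1 - j) (by omega) (by omega)
  rwa [show L - (L - i) = i by omega, show L - 1 - (L - 1 - j) = j by omega,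
    show L - (L - 1 - j) = j + 1 by omega] at this

/-- Consecutive path vertices share an edge other than `f`, so `f` sees them through the same gate:
an edge off the path sees the whole path through one vertex. -/
lemma IsSpine.gate_off (h : IsGateTree g) (hs : IsSpine g L u e) {f : ι}
    (hf : ∀ j < L, e j ≠ f) {i : ℕ} (hi : i ≤ L) : g f (u i) = g f (u 0) := by
  induction i with
  | zero => rfl
  | succ i ih =>
    rw [← ih (by omega)]
    exact (const' h (hf i (by omega)) (hs.left i (by omega)) (hs.right i (by omega))).symm

lemma IsSpine.gdist_last (h : IsGateTree g) (hs : IsSpine g L u e) {i : ℕ} (hi : i ≤ L) :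
    gdist g (u i) (u L) = L - i := by
  induction hd : L - i generalizing i with
  | zero => obtain rfl : i = L := by omega
            simp
  | succ d ih =>
    have h1 := hs.gate_lt h (i := L) (j := i) (by omega) le_rfl
    rw [gdist_gate h (hs.left i (by omega)) (by rw [h1]; exact (hs.ne i (by omega)).symm), h1,
      ih (by omega) (by omega)]

lemma two_le_deg {v : V} {i j : ι} (hij : i ≠ j) (hi : g i v = v) (hj : g j v = v) :
    2 ≤ deg g v :=
  Finset.one_lt_card.2 ⟨i, by simpa using hi, j, by simpa using hj, hij⟩

lemma three_le_deg {v : V} {i j l : ι} (hij : i ≠ j) (hil : i ≠ l) (hjl : j ≠ l) (hi : g i v = v)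
    (hj : g j v = v) (hl : g l v = v) : 3 ≤ deg g v :=
  Finset.two_lt_card.2 ⟨i, by simpa using hi, j, by simpa using hj, l, by simpa using hl,
    hij, hil, hjl⟩

lemma IsSpine.two_le_deg (hs : IsSpine g L u e) {i : ℕ} (h0 : 1 ≤ i) (hi : i < L) :
    2 ≤ deg g (u i) := by
  refine GateTree.two_le_deg (i := e (i - 1)) (j := e i) ?_ ?_ (hs.left i hi)
  · intro e
    have := hs.inj _ (by omega) _ hi e
    omega
  · have := hs.right (i - 1) (by omega)
    rwa [Nat.sub_add_cancel h0] at this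

lemma two_le_deg_of_beyond (h : IsGateTree g) {i f : ι} {y w : V} (hiy : g i w = y)
    (hfw : g f w = w) (hfi : f ≠ i) : 2 ≤ deg g y := by
  have hi : g i y = y := by rw [← hiy, h.idem]
  by_cases hyw : y = w
  · subst hyw
    exact two_le_deg hfi hfw hi
  · obtain ⟨j, hj, hjw⟩ := h.step hyw
    refine two_le_deg (j := i) ?_ hj hi
    rintro rfl
    exact hjw hiy

/-- From a vertex of an edge `i` one can walk away from `t` along a further edge. -/
lemma exists_gdist_succ (h : IsGateTree g) (h2 : ∀ i, 2 ≤ (edge g i).card) {y t : V} {i : ι}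
    (hi : g i y = y) (hit : g i t ≠ y) (hy : 2 ≤ deg g y) :
    ∃ v, gdist g v t = gdist g y t + 1 := by
  obtain ⟨f, hf, hfy⟩ : ∃ f, i ≠ f ∧ g f y = y := by
    obtain ⟨a, b, hab, ha, hb⟩ := exists_two_edges hy
    by_cases hia : i = a
    · exact ⟨b, fun hib => hab (hia.symm.trans hib), hb⟩
    · exact ⟨a, hia, ha⟩
  obtain ⟨v, hv, hvy⟩ := exists_ne_of_two_le h2 f y
  have hft := gate_eq_of_gate_ne h hf hi hfy hit
  refine ⟨v, ?_⟩
  rw [gdist_gate h hv (by rw [hft]; exact hvy.symm), hft]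

/-- The spine is a longest path. -/
structure IsLongest (g : ι → V → V) (L : ℕ) (u : ℕ → V) (e : ℕ → ι) : Prop extends
    IsSpine g L u e where
  pos : 1 ≤ L
  diam : ∀ a b, gdist g a b ≤ L

lemma IsLongest.reverse (hs : IsLongest g L u e) :
    IsLongest g L (fun i => u (L - i)) (fun j => e (L - 1 - j)) :=
  ⟨hs.toIsSpine.reverse, hs.pos, hs.diam⟩

/-- A second edge at the end of a longest path would lead to a vertex at distance `L + 1` from the
other end. -/
lemma IsLongest.eq_of_mem_zero (h : IsGateTree g) (h2 : ∀ i, 2 ≤ (edge g i).card)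
    (hs : IsLongest g L u e) {f : ι} (hf : g f (u 0) = u 0) : f = e 0 := by
  by_contra hfe
  have hL := hs.pos
  have hs' := hs.toIsSpine
  have h1 := hs'.gate_lt h (i := L) (j := 0) (by omega) le_rfl
  obtain ⟨v, hv⟩ := exists_gdist_succ h h2 (t := u L) (hs.left 0 hL)
    (by rw [h1]; exact (hs.ne 0 hL).symm) (GateTree.two_le_deg hfe hf (hs.left 0 hL))
  have := hs.diam v (u L)
  rw [hv, hs'.gdist_last h (Nat.zero_le L)] at this
  omega

lemma IsLongest.eq_of_mem_last (h : IsGateTree g) (h2 : ∀ i, 2 ≤ (edge g i).card)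
    (hs : IsLongest g L u e) {f : ι} (hf : g f (u L) = u L) : f = e (L - 1) :=
  hs.reverse.eq_of_mem_zero h h2 hf

lemma IsLongest.deg_zero (h : IsGateTree g) (h2 : ∀ i, 2 ≤ (edge g i).card)
    (hs : IsLongest g L u e) : deg g (u 0) = 1 := by
  rw [deg, Finset.card_eq_one]
  refine ⟨e 0, ?_⟩
  ext f
  rw [Finset.mem_filter_univ, Finset.mem_singleton]
  constructor
  · exact hs.eq_of_mem_zero h h2
  · rintro rfl
    exact hs.left 0 hs.pos

/-- A vertex of the first edge off the path is a leaf. -/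
lemma IsLongest.leaf_first (h : IsGateTree g) (h2 : ∀ i, 2 ≤ (edge g i).card)
    (hs : IsLongest g L u e) {y : V} (hy : g (e 0) y = y) (hy1 : y ≠ u 1) : deg g y ≤ 1 := by
  by_contra hdeg
  have hL := hs.pos
  have hs' := hs.toIsSpine
  have h1 := hs'.gate_lt h (i := L) (j := 0) (by omega) le_rfl
  obtain ⟨v, hv⟩ := exists_gdist_succ h h2 (t := u L) hy (by rw [h1]; exact hy1.symm)
    (not_le.1 hdeg)
  have h3 := hs.diam v (u L)
  rw [hv, gdist_gate h hy (by rw [h1]; exact hy1.symm), h1, hs'.gdist_last h hL] at h3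
  omega

lemma IsLongest.leaf_last (h : IsGateTree g) (h2 : ∀ i, 2 ≤ (edge g i).card)
    (hs : IsLongest g L u e) {y : V} (hy : g (e (L - 1)) y = y) (hy1 : y ≠ u (L - 1)) :
    deg g y ≤ 1 :=
  hs.reverse.leaf_first h h2 hy hy1

/-- The other vertices of the edges of the path are leaves. -/
lemma IsLongest.leaf_of_mem (hg : IsExtremal k n g) (hk : 2 ≤ k) (hs : IsLongest g L u e)
    {j : ℕ} (hj : j < L) {y : V} (hy : g (e j) y = y) (hy0 : y ≠ u j) (hy1 : y ≠ u (j + 1)) :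
    deg g y ≤ 1 := by
  have h := hg.tree
  have h2 := hg.two_le hk
  by_contra hdeg
  rcases Nat.eq_zero_or_pos j with rfl | hj0
  · exact hdeg (hs.leaf_first h h2 hy hy1)
  · by_cases hjL : j + 1 = L
    · obtain rfl : j = L - 1 := by omega
      exact hdeg (hs.leaf_last h h2 hy hy0)
    -- Both ends of an inner edge of the path have degree at least two already, so a third such
    -- vertex is excluded; the end edges were settled by maximality of the path.
    · exact hg.not_three_branching hk hy0 hy1 (hs.ne j hj) hy (hs.left j hj) (hs.right j hj)
        (not_le.1 hdeg) (hs.toIsSpine.two_le_deg hj0 hj)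
        (hs.toIsSpine.two_le_deg (by omega) (by omega))

/-- The vertex `w` is already at distance `L` from `u L`; a further edge at `w` would exceed the
diameter. -/
lemma IsLongest.pendant_of_second (h : IsGateTree g) (h2 : ∀ i, 2 ≤ (edge g i).card)
    (hs : IsLongest g L u e) {f : ι} (hf : ∀ j < L, e j ≠ f) (hfu : g f (u 1) = u 1) {w : V}
    (hw : g f w = w) (hwu : w ≠ u 1) : deg g w ≤ 1 := by
  by_contra hdeg
  have hL := hs.pos
  have hs' := hs.toIsSpine
  have h1 : g f (u L) = u 1 := by
    rw [hs'.gate_off h hf le_rfl, ← hs'.gate_off h hf hL, hfu]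
  obtain ⟨v, hv⟩ := exists_gdist_succ h h2 (t := u L) hw (by rw [h1]; exact hwu.symm)
    (not_le.1 hdeg)
  have h3 := hs.diam v (u L)
  rw [hv, gdist_gate h hw (by rw [h1]; exact hwu.symm), h1, hs'.gdist_last h hL] at h3
  omega

/-- An edge attached at a vertex of the path is pendant. -/
lemma IsLongest.pendant_of_mem (hg : IsExtremal k n g) (hk : 2 ≤ k) (hs : IsLongest g L u e)
    {f : ι} (hf : ∀ j < L, e j ≠ f) {i : ℕ} (hi : i ≤ L) (hfi : g f (u i) = u i) :
    1 ≤ i ∧ i < L ∧ 3 ≤ deg g (u i) ∧ ∀ w, g f w = w → w ≠ u i → deg g w ≤ 1 := by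
  have h := hg.tree
  have h2 := hg.two_le hk
  have hL := hs.pos
  have h0 : 1 ≤ i := by
    by_contra hi0
    obtain rfl : i = 0 := by omega
    exact hf 0 hL (hs.eq_of_mem_zero h h2 hfi).symm
  have hiL : i < L := by
    by_contra hiL
    obtain rfl : i = L := by omega
    exact hf (i - 1) (by omega) (hs.eq_of_mem_last h h2 hfi).symm
  have hne : e (i - 1) ≠ e i := by
    intro e
    have := hs.inj _ (by omega) _ hiL e
    omega
  have hl : g (e (i - 1)) (u i) = u i := by
    have := hs.right (i - 1) (by omega)
    rwa [Nat.sub_add_cancel h0] at this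
  have hr := hs.left i hiL
  have hnel := hf (i - 1) (by omega)
  have hner := hf i hiL
  refine ⟨h0, hiL, three_le_deg hne hnel hner hl hr hfi, ?_⟩
  -- One of the three edges at `u i` is pendant. If it is a path edge, then `u i` is the first or
  -- the last inner vertex, where maximality of the path forces `f` to be pendant as well.
  rcases hg.exists_pendant hk hne hnel hner hl hr hfi with h3 | h3 | h3
  · have h4 := h3 (u (i - 1)) (hs.left _ (by omega)) (by
      have := hs.ne (i - 1) (by omega)
      rwa [Nat.sub_add_cancel h0] at this)
    obtain rfl : i = 1 := by
      by_contra hi1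
      have := hs.toIsSpine.two_le_deg (i := i - 1) (by omega) (by omega)
      omega
    exact fun w => hs.pendant_of_second h h2 hf hfi
  · have h4 := h3 (u (i + 1)) (hs.right _ hiL) (hs.ne i hiL).symm
    obtain rfl : i = L - 1 := by
      by_contra hi1
      have := hs.toIsSpine.two_le_deg (i := i + 1) (by omega) (by omega)
      omega
    exact fun w => hs.reverse.pendant_of_second h h2 (f := f) (fun j hj => hf _ (by omega)) hfi
  · exact h3

/-- The projection of `w` is the left end of the first path edge that has its left end as gate for
`w`, or `u L` if there is none. All earlier edges have their right end as gate, and the later ones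
lie on the other side of the projection. -/
lemma IsSpine.exists_proj (h : IsGateTree g) (hs : IsSpine g L u e) {w : V}
    (hw : ∀ j < L, g (e j) w = u j ∨ g (e j) w = u (j + 1)) :
    ∃ i ≤ L, ∀ j < L, g (e j) w = g (e j) (u i) := by
  classical
  by_cases hall : ∃ j, j < L ∧ g (e j) w = u j
  · obtain ⟨hi, hiw⟩ := Nat.find_spec hall
    have hmin := fun j (hj : j < Nat.find hall) => Nat.find_min hall hj
    set i := Nat.find hall
    refine ⟨i, hi.le, fun j hj => ?_⟩
    rcases lt_trichotomy j i with hji | hji | hji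
    · rw [hs.gate_lt h hji hi.le]
      exact (hw j hj).resolve_left fun h1 => hmin j hji ⟨hj, h1⟩
    · rw [hji, hiw, hs.left i hi]
    · by_cases hwi : w = u i
      · rw [hwi]
      · refine (isBranch_coBranch h (i := e i) (p := u i)).gate_mem h ?_
          (mem_coBranch.2 ⟨hiw, hwi⟩)
        intro b hb hjb
        have h1 : g (e i) b = g (e i) (u j) :=
          const' h (fun e => by have := hs.inj _ hj _ hi e; omega) hjb (hs.left j hj)
        rw [(mem_coBranch.1 hb).1, hs.gate_lt h hji hj.le] at h1
        exact hs.ne i hi h1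
  · push Not at hall
    refine ⟨L, le_rfl, fun j hj => ?_⟩
    rw [hs.gate_lt h hj le_rfl]
    exact (hw j hj).resolve_left (hall j hj)

/-- Every edge off the path is attached at an inner vertex of the path. -/
lemma IsLongest.exists_attach (hg : IsExtremal k n g) (hk : 2 ≤ k) (hs : IsLongest g L u e)
    {f : ι} (hf : ∀ j < L, e j ≠ f) : ∃ i, 1 ≤ i ∧ i < L ∧ g f (u i) = u i := by
  have h := hg.tree
  have hs' := hs.toIsSpine
  set w := g f (u 0) with hw
  have hfw : g f w = w := h.idem _ _
  have hfu : ∀ i ≤ L, g f (u i) = w := fun i hi => hs'.gate_off h hf hi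
  -- A gate for `w` in a path edge that is not one of the two path vertices would be a leaf; but `f`
  -- lies beyond it, which forces degree at least two.
  obtain ⟨i, hi, hproj⟩ := hs'.exists_proj h (w := w) (by
    intro j hj
    by_contra hcon
    push Not at hcon
    have h1 := hs.leaf_of_mem hg hk hj (h.idem _ _) hcon.1 hcon.2
    have h3 := two_le_deg_of_beyond h rfl hfw (hf j hj).symm
    omega)
  suffices hwu : w = u i by
    have h1 : g f (u i) = u i := by rw [hfu i hi, hwu]
    obtain ⟨h3, h4, -, -⟩ := hs.pendant_of_mem hg hk hf hi h1
    exact ⟨i, h3, h4, h1⟩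
  -- Otherwise the edge `f'` leading from `u i` towards `w` is off the path, hence pendant, while
  -- `f` lies beyond it: again a leaf would have degree at least two.
  by_contra hwu
  obtain ⟨f', hf', hf'w⟩ := h.step (Ne.symm hwu)
  have hoff : ∀ j < L, e j ≠ f' := by
    rintro j hj rfl
    exact hf'w (by rw [hproj j hj, hf'])
  obtain ⟨-, -, -, h3⟩ := hs.pendant_of_mem hg hk hoff hi hf'
  have h4 := h3 (g f' w) (h.idem _ _) hf'w
  have h5 : f ≠ f' := by
    rintro rfl
    exact hwu (by rw [← hfu i hi, hf'])
  have h6 := two_le_deg_of_beyond h rfl hfw h5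
  omega

/-- Two such edges together with the two path edges would give degree four. -/
lemma IsLongest.attach_unique (hg : IsExtremal k n g) (hk : 2 ≤ k) (hs : IsLongest g L u e)
    {f f' : ι} (hf : ∀ j < L, e j ≠ f) (hf' : ∀ j < L, e j ≠ f') {i : ℕ} (h0 : 1 ≤ i)
    (hi : i < L) (hfi : g f (u i) = u i) (hfi' : g f' (u i) = u i) : f = f' := by
  by_contra hff
  have hl : g (e (i - 1)) (u i) = u i := by
    have := hs.right (i - 1) (by omega)
    rwa [Nat.sub_add_cancel h0] at this
  have h1 : ({e (i - 1), e i, f, f'} : Finset ι) ⊆ Finset.univ.filter fun j => g j (u i) = u i := by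
    intro j hj
    simp only [Finset.mem_insert, Finset.mem_singleton] at hj
    rw [Finset.mem_filter_univ]
    rcases hj with rfl | rfl | rfl | rfl
    · exact hl
    · exact hs.left i hi
    · exact hfi
    · exact hfi'
  have h2 := Finset.card_le_card h1
  have hne : e (i - 1) ≠ e i := by
    intro e
    have := hs.inj _ (by omega) _ hi e
    omega
  rw [Finset.card_insert_of_notMem, Finset.card_insert_of_notMem, Finset.card_pair hff] at h2
  · have := hg.deg_le_three hk (u i)
    rw [deg] at this
    omega
  · simp [hf i hi, hf' i hi]
  · simp [hf (i - 1) (by omega), hf' (i - 1) (by omega), hne]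

lemma IsLongest.exists_off_iff (hg : IsExtremal k n g) (hk : 2 ≤ k) (hs : IsLongest g L u e)
    {i : ℕ} (h0 : 1 ≤ i) (hi : i < L) :
    3 ≤ deg g (u i) ↔ ∃ f, (∀ j < L, e j ≠ f) ∧ g f (u i) = u i := by
  have h := hg.tree
  have hs' := hs.toIsSpine
  constructor
  · intro h3
    obtain ⟨f, hf, hne⟩ : ∃ f ∈ Finset.univ.filter (fun j => g j (u i) = u i),
        f ∉ ({e (i - 1), e i} : Finset ι) :=
      Finset.exists_mem_notMem_of_card_lt_card (lt_of_le_of_lt Finset.card_le_two h3)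
    rw [Finset.mem_filter_univ] at hf
    rw [Finset.mem_insert, Finset.mem_singleton, not_or] at hne
    refine ⟨f, ?_, hf⟩
    rintro j hj rfl
    rcases lt_trichotomy j i with hji | rfl | hji
    · rw [hs'.gate_lt h hji hi.le] at hf
      by_cases hj1 : j = i - 1
      · exact hne.1 (by rw [hj1])
      · have h4 := hs'.gdist_last h (i := j + 1) (by omega)
        rw [hf, hs'.gdist_last h hi.le] at h4
        omega
    · exact hne.2 rfl
    · rw [hs'.gate_le h hji.le hj] at hf
      have h4 := hs'.gdist_last h (i := j) (by omega)
      rw [hf, hs'.gdist_last h hi.le] at h4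
      omega
  · rintro ⟨f, hf, hfi⟩
    exact (hs.pendant_of_mem hg hk hf hi.le hfi).2.2.1

/-- The vertices of degree three lie on the path. -/
lemma IsLongest.exists_of_big (hg : IsExtremal k n g) (hk : 2 ≤ k) (hs : IsLongest g L u e)
    {v : V} (hv : 3 ≤ deg g v) : ∃ i, 1 ≤ i ∧ i < L ∧ v = u i := by
  have h := hg.tree
  have h2 := hg.two_le hk
  obtain ⟨f, f', hff, hf, hf'⟩ := exists_two_edges (g := g) (u := v) (by omega)
  by_cases hoff : ∀ j < L, e j ≠ f
  · obtain ⟨i, h0, hi, hfi⟩ := hs.exists_attach hg hk hoff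
    refine ⟨i, h0, hi, ?_⟩
    by_contra hvi
    have := (hs.pendant_of_mem hg hk hoff hi.le hfi).2.2.2 v hf hvi
    omega
  · push Not at hoff
    obtain ⟨j, hj, rfl⟩ := hoff
    have key : ∃ i ≤ L, v = u i := by
      by_cases hvj : v = u j
      · exact ⟨j, hj.le, hvj⟩
      · by_cases hvj' : v = u (j + 1)
        · exact ⟨j + 1, hj, hvj'⟩
        · have := hs.leaf_of_mem hg hk hj hf hvj hvj'
          omega
    obtain ⟨i, hi, rfl⟩ := key
    refine ⟨i, ?_, ?_, rfl⟩
    · by_contra h0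
      obtain rfl : i = 0 := by omega
      rw [hs.deg_zero h h2] at hv
      omega
    · by_contra h0
      obtain rfl : i = L := by omega
      have := hs.reverse.deg_zero h h2
      rw [Nat.sub_zero] at this
      omega

lemma IsSpine.injOn (h : IsGateTree g) (hs : IsSpine g L u e) {i j : ℕ} (hi : i ≤ L) (hj : j ≤ L)
    (hij : u i = u j) : i = j := by
  have h1 := hs.gdist_last h hi
  rw [hij, hs.gdist_last h hj] at h1
  omega

/-- The positions on the path of the vertices of degree three. -/
def bigPos (g : ι → V → V) (L : ℕ) (u : ℕ → V) : Finset ℕ :=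
  (Finset.Ico 1 L).filter fun i => 3 ≤ deg g (u i)

@[simp] lemma mem_bigPos {i : ℕ} : i ∈ bigPos g L u ↔ (1 ≤ i ∧ i < L) ∧ 3 ≤ deg g (u i) := by
  rw [bigPos, Finset.mem_filter, Finset.mem_Ico]

lemma IsLongest.card_bigPos (hg : IsExtremal k n g) (hk : 2 ≤ k) (hs : IsLongest g L u e) :
    (bigPos g L u).card = n := by
  rw [← hg.card_big hk]
  have : big g = (bigPos g L u).image u := by
    ext v
    rw [mem_big, Finset.mem_image]
    constructor
    · intro hv
      obtain ⟨i, h0, hi, rfl⟩ := hs.exists_of_big hg hk hv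
      exact ⟨i, mem_bigPos.2 ⟨⟨h0, hi⟩, hv⟩, rfl⟩
    · rintro ⟨i, hi, rfl⟩
      exact (mem_bigPos.1 hi).2
  rw [this, Finset.card_image_of_injOn]
  intro i hi j hj hij
  rw [Finset.mem_coe, mem_bigPos] at hi hj
  exact hs.toIsSpine.injOn hg.tree hi.1.2.le hj.1.2.le hij

/-- The edges off the path correspond bijectively to the positions of degree three, of which there
are `n`. -/
lemma IsLongest.card_edges (hg : IsExtremal k n g) (hk : 2 ≤ k) (hs : IsLongest g L u e) :
    Fintype.card ι = L + n := by
  classical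
  have h := hg.tree
  have : Nonempty ι := ⟨e 0⟩
  choose! p hp1 hp2 using fun i (hi : i ∈ bigPos g L u) =>
    (hs.exists_off_iff hg hk (mem_bigPos.1 hi).1.1 (mem_bigPos.1 hi).1.2).1 (mem_bigPos.1 hi).2
  have huniv : (Finset.univ : Finset ι)
      = (Finset.range L).image e ∪ (bigPos g L u).image p := by
    ext f
    simp only [Finset.mem_univ, Finset.mem_union, Finset.mem_image, Finset.mem_range, true_iff]
    by_cases hf : ∀ j < L, e j ≠ f
    · right
      obtain ⟨i, h0, hi, hfi⟩ := hs.exists_attach hg hk hf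
      have hib : i ∈ bigPos g L u :=
        mem_bigPos.2 ⟨⟨h0, hi⟩, (hs.exists_off_iff hg hk h0 hi).2 ⟨f, hf, hfi⟩⟩
      exact ⟨i, hib, hs.attach_unique hg hk (hp1 i hib) hf h0 hi (hp2 i hib) hfi⟩
    · left
      push Not at hf
      exact hf
  rw [← Finset.card_univ, huniv, Finset.card_union_of_disjoint, Finset.card_image_of_injOn,
    Finset.card_image_of_injOn, Finset.card_range, hs.card_bigPos hg hk]
  · intro i hi j hj hij
    rw [Finset.mem_coe] at hi hj
    have h1 := mem_bigPos.1 hi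
    have h2 := mem_bigPos.1 hj
    have h3 : g (p i) (u i) = u i := hp2 i hi
    have h4 : g (p i) (u j) = u j := by rw [show p i = p j from hij]; exact hp2 j hj
    rw [hs.toIsSpine.gate_off h (hp1 i hi) h1.1.2.le] at h3
    rw [hs.toIsSpine.gate_off h (hp1 i hi) h2.1.2.le, h3] at h4
    exact hs.toIsSpine.injOn h h1.1.2.le h2.1.2.le h4
  · intro i hi j hj hij
    rw [Finset.mem_coe, Finset.mem_range] at hi hj
    exact hs.inj i hi j hj hij
  · rw [Finset.disjoint_left]
    intro f h1 h2
    obtain ⟨j, hj, rfl⟩ := Finset.mem_image.1 h1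
    obtain ⟨i, hi, hij⟩ := Finset.mem_image.1 h2
    exact hp1 i hi j (Finset.mem_range.1 hj) hij.symm

/-- The inner vertices on one side of a vertex of degree three have degree three. -/
lemma IsLongest.bigPos_side (hg : IsExtremal k n g) (hk : 2 ≤ k) (hs : IsLongest g L u e) {i : ℕ}
    (hi : i ∈ bigPos g L u) : (∀ j, 1 ≤ j → j < i → j ∈ bigPos g L u) ∨
      ∀ j, i < j → j < L → j ∈ bigPos g L u := by
  have h := hg.tree
  have hs' := hs.toIsSpine
  obtain ⟨⟨h0, hiL⟩, h3⟩ := mem_bigPos.1 hi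
  have hne : e (i - 1) ≠ e i := by
    intro e
    have := hs.inj _ (by omega) _ hiL e
    omega
  have hl : g (e (i - 1)) (u i) = u i := by
    have := hs.right (i - 1) (by omega)
    rwa [Nat.sub_add_cancel h0] at this
  -- Inner vertices of the path have degree at least two, so on the side without vertices of degree
  -- two they all have degree at least three.
  rcases hg.deg_ne_two hk h3 hne hl (hs.left i hiL) with h4 | h4
  · left
    intro j hj hji
    have h5 := h4 (u j) (by
      rw [mem_edgeBranch, hs'.gate_le h (by omega) (by omega)]
      intro h6
      have := hs'.injOn h (by omega) hiL.le h6
      omega)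
    have h6 := hs'.two_le_deg hj (by omega)
    exact mem_bigPos.2 ⟨⟨hj, by omega⟩, by omega⟩
  · right
    intro j hj hjL
    have h5 := h4 (u j) (by
      rw [mem_edgeBranch, hs'.gate_lt h hj (by omega)]
      exact (hs.ne i hiL).symm)
    have h6 := hs'.two_le_deg (i := j) (by omega) hjL
    exact mem_bigPos.2 ⟨⟨by omega, by omega⟩, by omega⟩

lemma exists_longest (h : IsGateTree g) [Nontrivial V] : ∃ L u e, IsLongest g L u e := by
  obtain ⟨⟨s, t⟩, -, hmax⟩ := (Finset.univ : Finset (V × V)).exists_max_image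
    (fun q => gdist g q.1 q.2) Finset.univ_nonempty
  obtain ⟨a, b, hab⟩ := exists_pair_ne V
  have : Nonempty ι := ⟨(h.step hab).choose⟩
  obtain ⟨u, e, hs, -, -, -⟩ := exists_spine h s t
  refine ⟨gdist g s t, u, e, hs, ?_, fun a b => hmax (a, b) (Finset.mem_univ _)⟩
  exact (gdist_pos h hab).trans_le (hmax (a, b) (Finset.mem_univ _))

end Spine

end GateTree

/-! ### Distance potentials and a maximum principle -/

namespace GateTree

section Harmonic

variable {ι W : Type*} [Fintype ι] [DecidableEq ι] [Fintype W] [DecidableEq W]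
variable {g : ι → W → W} {k : ℕ}

/-- The distance potential of a charge distribution of total charge zero satisfies a local
equation at each vertex. -/
lemma sum_sub_potential (h : IsGateTree g) (hk : ∀ i, (edge g i).card = k) {c H : W → ℝ}
    (hc : ∑ w, c w = 0) (hH : ∀ v, H v = ∑ w, (gdist g v w : ℝ) * c w) (v : W) :
    ∑ i with g i v = v, ∑ v' ∈ edge g i, (H v' - H v) = k * c v := by
  -- Reaching a charge from a vertex `v` of `i` costs one extra step unless the charge is seen
  -- through `v`. As the total charge is zero, `H` on the edge is a constant minus the charge seen
  -- through the vertex.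
  have key : ∀ i, ∀ v, g i v = v →
      H v = ∑ w, (gdist g (g i w) w : ℝ) * c w - ∑ w with g i w = v, c w := by
    intro i v hv
    have h1 : ∀ w, (gdist g v w : ℝ) * c w
        = (gdist g (g i w) w : ℝ) * c w + c w - if g i w = v then c w else 0 := by
      intro w
      rw [gdist_gate' h hv]
      split_ifs <;> push_cast <;> ring
    rw [hH]
    simp_rw [h1]
    rw [Finset.sum_sub_distrib, Finset.sum_add_distrib, hc, Finset.sum_filter, add_zero]
  have h2 : ∀ i, g i v = v →
      ∑ v' ∈ edge g i, (H v' - H v) = k * ∑ w with g i w = v, c w := by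
    intro i hv
    have h3 : ∀ v' ∈ edge g i, H v' - H v
        = ∑ w with g i w = v, c w - ∑ w with g i w = v', c w := by
      intro v' hv'
      rw [key i v hv, key i v' (mem_edge.1 hv')]
      ring
    rw [Finset.sum_congr rfl h3, Finset.sum_sub_distrib, Finset.sum_const, hk,
      Finset.sum_fiberwise_of_maps_to (fun w _ => mem_edge.2 (h.idem i w)), hc, nsmul_eq_mul,
      sub_zero]
  rw [Finset.sum_congr rfl fun i hi => h2 i (Finset.mem_filter_univ i |>.1 hi), ← Finset.mul_sum]
  congr 1
  have h4 : ∀ i, ∑ w with g i w = v, c w = -∑ w with g i w ≠ v, c w := by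
    intro i
    have := Finset.sum_filter_add_sum_filter_not Finset.univ (fun w => g i w = v) c
    rw [hc] at this
    linarith
  simp_rw [h4]
  rw [Finset.sum_neg_distrib]
  -- The branches at `v` partition the remaining vertices.
  have h5 : ∑ i with g i v = v, ∑ w with g i w ≠ v, c w = ∑ w ∈ Finset.univ.erase v, c w := by
    have h6 : (Finset.univ.erase v : Finset W)
        = (Finset.univ.filter fun i => g i v = v).biUnion
            fun i => Finset.univ.filter fun w => g i w ≠ v := by
      ext w
      simp only [Finset.mem_erase, Finset.mem_univ, and_true, Finset.mem_biUnion,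
        Finset.mem_filter, true_and]
      constructor
      · intro hw
        exact h.step hw.symm
      · rintro ⟨i, hi, hiw⟩ rfl
        exact hiw hi
    rw [h6, Finset.sum_biUnion]
    intro i hi j hj hij
    rw [Finset.mem_coe, Finset.mem_filter_univ] at hi hj
    rw [Function.onFun, Finset.disjoint_left]
    intro w h7 h8
    rw [Finset.mem_filter_univ] at h7 h8
    exact h8 (gate_eq_of_gate_ne h hij hi hj h7)
  have h7 := Finset.add_sum_erase Finset.univ c (Finset.mem_univ v)
  rw [h5]
  linarith

/-- Maximum principle for the response to a pair of opposite charges at `ω` and `ω'`, on the half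
`Z` of a hypertree with a reflection `σ`. -/
lemma response_neg (h : IsGateTree g) (hk : ∀ i, (edge g i).card = k) (hk0 : 0 < k) {ω ω' : W}
    {r t : ℝ} (hr : 0 < r) (ht : 0 < t) {α : W → ℝ} {σ : W → W} (hσ : Function.Involutive σ)
    (hασ : ∀ v, α (σ v) = -α v)
    (hα : ∀ v, r * α v = ∑ w, (gdist g v w : ℝ) * α w
      + t * ((gdist g v ω : ℝ) - gdist g v ω'))
    {Z : Finset W} (hω : ω ∈ Z) (hω' : ω' ∉ Z)
    (hZ : ∀ v ∈ Z, ∀ i, g i v = v → g i ω ∈ Z ∧ ((∀ w, g i w = w → w ∈ Z ∨ σ w = w) ∨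
      (g i ω = v ∧ ∀ w, g i w = w → g i (σ w) = σ w)))
    {v : W} (hv : v ∈ Z) : α v < 0 := by
  have hsum : ∑ w, α w = 0 := by
    have h1 : ∑ w, α (σ w) = ∑ w, α w := Equiv.sum_comp hσ.toPerm α
    simp_rw [hασ] at h1
    rw [Finset.sum_neg_distrib] at h1
    linarith
  -- Equation `hα` says that `r * α` is the distance potential of this charge, whose total vanishes
  -- because `α` is odd under `σ`.
  set c : W → ℝ := fun w => α w + t * ((Pi.single ω 1 : W → ℝ) w - (Pi.single ω' 1 : W → ℝ) w)
    with hc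
  have hc0 : ∑ w, c w = 0 := by
    simp only [hc]
    rw [Finset.sum_add_distrib, hsum, ← Finset.mul_sum, Finset.sum_sub_distrib,
      Finset.sum_pi_single', Finset.sum_pi_single']
    simp
  have hpot : ∀ v, r * α v = ∑ w, (gdist g v w : ℝ) * c w := by
    intro v
    have h1 : ∀ w, (gdist g v w : ℝ) * c w = gdist g v w * α w
        + t * ((if w = ω then (gdist g v w : ℝ) else 0) - if w = ω' then (gdist g v w : ℝ) else 0) := by
      intro w
      simp only [hc, Pi.single_apply]
      split_ifs <;> ring
    simp_rw [h1]
    rw [Finset.sum_add_distrib, ← Finset.mul_sum, Finset.sum_sub_distrib, Finset.sum_ite_eq',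
      Finset.sum_ite_eq', if_pos (Finset.mem_univ _), if_pos (Finset.mem_univ _), hα]
  have hloc := sum_sub_potential h hk (H := fun v => r * α v) hc0 hpot
  by_contra hneg
  obtain ⟨v₁, hv₁, hmax⟩ := Z.exists_max_image α ⟨v, hv⟩
  have hM : 0 ≤ α v₁ := (not_lt.1 hneg).trans (hmax v hv)
  -- Among the points of `Z` where `α` is maximal, one nearest to `ω` is chosen; the contradiction
  -- is a nearer one.
  obtain ⟨y, hy, hmin⟩ := (Z.filter fun w => α w = α v₁).exists_min_image (fun w => gdist g w ω)
    ⟨v₁, by simp [hv₁]⟩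
  rw [Finset.mem_filter] at hy
  obtain ⟨hyZ, hyM⟩ := hy
  have hinner : ∀ i, g i y = y → ∑ v' ∈ edge g i, (r * α v' - r * α y) ≤ 0 := by
    intro i hi
    rcases (hZ y hyZ i hi).2 with h1 | ⟨-, h1⟩
    · refine Finset.sum_nonpos fun w hw => ?_
      have h2 : α w ≤ α y := by
        rw [hyM]
        -- At fixed points of `σ` the odd function `α` vanishes, so it does not exceed the
        -- nonnegative maximum there.
        rcases h1 w (mem_edge.1 hw) with h3 | h3
        · exact hmax w h3
        · have := hασ w
          rw [h3] at this
          linarith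
      nlinarith
    -- This is the middle edge, which `σ` maps to itself. Its vertices need not satisfy the bound
    -- individually, but `α` sums to zero on it.
    · have h2 : ∑ w ∈ edge g i, α w = 0 := by
        have h3 : ∑ w ∈ edge g i, α w = ∑ w ∈ edge g i, α (σ w) := by
          refine Finset.sum_nbij' σ σ ?_ ?_ ?_ ?_ ?_
          · exact fun w hw => mem_edge.2 (h1 w (mem_edge.1 hw))
          · exact fun w hw => mem_edge.2 (h1 w (mem_edge.1 hw))
          · exact fun w _ => hσ w
          · exact fun w _ => hσ w
          · exact fun w _ => by rw [hσ w]
        simp_rw [hασ] at h3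
        rw [Finset.sum_neg_distrib] at h3
        linarith
      rw [Finset.sum_sub_distrib, ← Finset.mul_sum, h2, Finset.sum_const, hk, nsmul_eq_mul, hyM]
      have : 0 ≤ (k : ℝ) * (r * α v₁) := by positivity
      linarith
  have hyω' : y ≠ ω' := fun e => hω' (e ▸ hyZ)
  have hk' : (0 : ℝ) < k := by exact_mod_cast hk0
  have hle : (k : ℝ) * c y ≤ 0 := by
    rw [← hloc y]
    exact Finset.sum_nonpos fun i hi => hinner i (by simpa using hi)
  have hcy : c y = α v₁ + t * (Pi.single ω 1 : W → ℝ) y := by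
    simp [hc, hyM, hyω']
  have hyω : y ≠ ω := by
    rintro rfl
    rw [hcy] at hle
    simp only [Pi.single_eq_same, mul_one] at hle
    have : 0 < (k : ℝ) * (α v₁ + t) := by positivity
    linarith
  have hcy' : c y = α v₁ := by rw [hcy]; simp [hyω]
  have hM0 : α v₁ = 0 := by
    rw [hcy'] at hle
    nlinarith
  have hzero : ∑ i with g i y = y, ∑ v' ∈ edge g i, (r * α v' - r * α y) = 0 := by
    rw [hloc y, hcy', hM0, mul_zero]
  -- All differences on the edge towards `ω` vanish. It is not the middle edge, whose gate for `ω`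
  -- would be `y` itself, so its gate lies in `Z`, is nearer to `ω` and has the same value.
  obtain ⟨i, hi, hiω⟩ := h.step hyω
  obtain ⟨h1, h2⟩ := hZ y hyZ i hi
  have h3 := h2.resolve_right fun h4 => hiω h4.1
  have h4 := (Finset.sum_eq_zero_iff_of_nonpos
    (fun i hi => hinner i (by simpa using hi))).1 hzero i (by simpa using hi)
  have h5 := (Finset.sum_eq_zero_iff_of_nonpos (fun w hw => by
    have h6 : α w ≤ α y := by
      rw [hyM]
      rcases h3 w (mem_edge.1 hw) with h7 | h7
      · exact hmax w h7
      · have := hασ w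
        rw [h7] at this
        linarith
    nlinarith)).1 h4 (g i ω) (mem_edge.2 (h.idem i ω))
  have h6 : α (g i ω) = α v₁ := by
    rw [← hyM]
    have : r * (α (g i ω) - α y) = 0 := by linarith
    rcases mul_eq_zero.1 this with h7 | h7 <;> linarith
  have h7 := hmin (g i ω) (Finset.mem_filter.2 ⟨h1, h6⟩)
  have h8 := gdist_gate h hi hiω
  omega

end Harmonic

/-! ### Moving a branch across a symmetric part -/

section Reflection

variable {ι V ι' W : Type*} [Fintype ι] [DecidableEq ι] [Fintype V] [DecidableEq V]
  [Fintype ι'] [DecidableEq ι'] [Fintype W] [DecidableEq W]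
variable {g : ι → V → V} {g₀ : ι' → W → W} {k : ℕ}

/-- The spectral radius is not an eigenvalue of a proper isometric part. -/
lemma eq_zero_of_eigen (h : IsGateTree g) [Nontrivial V] {ψ : W → V} (hψ : Function.Injective ψ)
    (hd : ∀ a b, gdist g (ψ a) (ψ b) = gdist g₀ a b) {v₀ : V} (hv₀ : ∀ a, ψ a ≠ v₀) {z : W → ℝ}
    (hz : ∀ a, ∑ b, (gdist g₀ a b : ℝ) * z b = rad g * z a) : z = 0 := by
  obtain ⟨-, -, -, hmax⟩ := exists_perron h
  -- The extension of `|z|` by zero attains the maximal Rayleigh quotient of `g`, so it is an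
  -- eigenvector. At `v₀` the eigenvalue equation says that a sum of nonnegative terms with positive
  -- distances is zero.
  set y : V → ℝ := Function.extend ψ (fun a => |z a|) 0 with hy
  have hyψ : ∀ a, y (ψ a) = |z a| := fun a => hψ.extend_apply _ _ a
  have hy0 : ∀ v, v ∉ Set.range ψ → y v = 0 := by
    intro v hv
    rw [hy, Function.extend_apply' _ _ _ (fun ⟨a, ha⟩ => hv ⟨a, ha⟩)]
    rfl
  have hsq : ∑ v, y v ^ 2 = ∑ a, z a ^ 2 := by
    refine (Fintype.sum_of_injective ψ hψ _ _ (fun v hv => ?_) fun a => ?_).symm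
    · simp [hy0 v hv]
    · rw [hyψ, sq_abs]
  have hsum : ∀ v, ∑ w, (gdist g v w : ℝ) * y w = ∑ b, (gdist g v (ψ b) : ℝ) * |z b| := by
    intro v
    refine (Fintype.sum_of_injective ψ hψ _ _ (fun w hw => ?_) fun a => ?_).symm
    · simp [hy0 w hw]
    · rw [hyψ]
  have hform : form g y = form g₀ (fun a => |z a|) := by
    rw [form_eq_sum, form_eq_sum]
    refine (Fintype.sum_of_injective ψ hψ _ _ (fun v hv => ?_) fun a => ?_).symm
    · simp [hy0 v hv]
    · rw [hyψ, hsum]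
      simp_rw [hd]
  have hz' : form g₀ z = rad g * ∑ a, z a ^ 2 := by
    rw [form_eq_sum, Finset.mul_sum]
    refine Finset.sum_congr rfl fun a _ => ?_
    rw [hz]; ring
  have heq : form g y = rad g * ∑ v, y v ^ 2 := by
    refine le_antisymm (hmax y) ?_
    rw [hform, hsq, ← hz']
    exact form_le_form_abs _ _
  have heig := eigen_of_form_eq hmax heq v₀
  rw [hy0 v₀ (fun ⟨a, ha⟩ => hv₀ a ha), mul_zero, hsum] at heig
  have h0 := (Finset.sum_eq_zero_iff_of_nonneg (fun b _ => by positivity)).1 heig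
  ext a
  have h1 := h0 a (Finset.mem_univ a)
  have h2 : (0 : ℝ) < gdist g v₀ (ψ a) := by exact_mod_cast gdist_pos h (hv₀ a).symm
  rcases mul_eq_zero.1 h1 with h3 | h3
  · linarith
  · exact abs_eq_zero.1 h3

/-- If `r` is not an eigenvalue of the distance matrix, then `r - D` is an injective endomorphism of
a finite-dimensional space, hence surjective. -/
lemma exists_response {r : ℝ}
    (hr : ∀ z : W → ℝ, (∀ a, ∑ b, (gdist g₀ a b : ℝ) * z b = r * z a) → z = 0) (κ : W → ℝ) :
    ∃ α : W → ℝ, ∀ a, r * α a - ∑ b, (gdist g₀ a b : ℝ) * α b = κ a := by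
  let T : (W → ℝ) →ₗ[ℝ] (W → ℝ) := r • LinearMap.id - (distMat g₀).mulVecLin
  have hT : ∀ z a, T z a = r * z a - ∑ b, (gdist g₀ a b : ℝ) * z b := by
    intro z a
    simp [T, distMat, Matrix.mulVec, dotProduct]
  have hinj : Function.Injective T := by
    rw [← LinearMap.ker_eq_bot, LinearMap.ker_eq_bot']
    intro z hz
    refine hr z fun a => ?_
    have := congrFun hz a
    rw [hT, Pi.zero_apply] at this
    linarith
  obtain ⟨α, hα⟩ := LinearMap.injective_iff_surjective.1 hinj κ
  exact ⟨α, fun a => by rw [← hT, hα]⟩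

/-- Moving the branch `B` from one end of a symmetric part to the other end increases the distance
spectral radius if the rest of the hypertree is attached to the half at the first end. -/
lemma rad_lt_move_of_reflection (h : IsGateTree g) (h₀ : IsGateTree g₀)
    (hk : ∀ i, (edge g₀ i).card = k) (hk0 : 0 < k) {ψ : W → V} (hψ : Function.Injective ψ)
    (hd : ∀ a b, gdist g (ψ a) (ψ b) = gdist g₀ a b) {σ : W → W} (hσ : Function.Involutive σ)
    (hσd : ∀ a b, gdist g₀ (σ a) (σ b) = gdist g₀ a b) {ω ω' : W} (hσω : σ ω = ω')
    {Z : Finset W} (hω : ω ∈ Z) (hω' : ω' ∉ Z)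
    (hZ : ∀ v ∈ Z, ∀ i, g₀ i v = v → g₀ i ω ∈ Z ∧ ((∀ w, g₀ i w = w → w ∈ Z ∨ σ w = w) ∨
      (g₀ i ω = v ∧ ∀ w, g₀ i w = w → g₀ i (σ w) = σ w)))
    {B : Finset V} (hB : IsBranch g (ψ ω) B) (hBne : B.Nonempty) (hψB : ∀ a, ψ a ∉ B)
    (hX : ∀ b, b ∉ B → b ∉ Set.range ψ →
      ∃ y ∈ Z, ∃ s : ℕ, ∀ a, gdist g (ψ a) b = gdist g₀ a y + s)
    (hXne : ∃ b, b ∉ B ∧ b ∉ Set.range ψ) :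
    rad g < rad (move g (ψ ω) (ψ ω') B) := by
  classical
  have hωω' : ω ≠ ω' := fun e => hω' (e ▸ hω)
  have : Nontrivial V := ⟨ψ ω, ψ ω', fun e => hωω' (hψ e)⟩
  obtain ⟨x, hx0, hx, -⟩ := exists_perron h
  obtain ⟨b₀, hb₀B, hb₀⟩ := hXne
  set r := rad g with hr
  have hr0 : 0 < r := by
    have h1 := hx b₀
    have h2 : 0 < ∑ w, (gdist g b₀ w : ℝ) * x w := by
      refine Finset.sum_pos' (fun w _ => mul_nonneg (Nat.cast_nonneg _) (hx0 w).le)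
        ⟨ψ ω, Finset.mem_univ _, mul_pos ?_ (hx0 _)⟩
      exact_mod_cast gdist_pos h fun e => hb₀ ⟨ω, e.symm⟩
    rw [h1] at h2
    exact pos_of_mul_pos_left h2 (hx0 b₀).le
  set m := ∑ b ∈ B, x b with hm
  have hm0 : 0 < m := Finset.sum_pos (fun b _ => hx0 b) hBne
  have hker : ∀ z : W → ℝ, (∀ a, ∑ b, (gdist g₀ a b : ℝ) * z b = r * z a) → z = 0 :=
    fun z hz => eq_zero_of_eigen h hψ hd (fun a ha => hb₀ ⟨a, ha⟩) hz
  -- `κ` is the odd part under `σ` of the distance to `ω`, so `α` below is the odd response of the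
  -- symmetric part to the mass `m` of `B` at `ω`.
  set κ : W → ℝ := fun a => ((gdist g₀ a ω : ℝ) - gdist g₀ a ω') / 2 with hκ
  obtain ⟨α, hα⟩ := exists_response hker fun a => m * κ a
  have hσω' : σ ω' = ω := by rw [← hσω, hσ]
  have hκσ : ∀ a, κ (σ a) = -κ a := by
    intro a
    have h1 : gdist g₀ (σ a) ω = gdist g₀ a ω' := by rw [← hσω', hσd]
    have h2 : gdist g₀ (σ a) ω' = gdist g₀ a ω := by rw [← hσω, hσd]
    simp only [hκ, h1, h2]
    ring
  have hσsum : ∀ f : W → ℝ, ∑ b, f (σ b) = ∑ b, f b := fun f => Equiv.sum_comp hσ.toPerm f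
  -- The even combination solves the homogeneous equation, whose only solution is zero.
  have hασ : ∀ a, α (σ a) = -α a := by
    have h1 : (fun a => α (σ a) + α a) = 0 := by
      refine hker _ fun a => ?_
      have h2 := hα a
      have h3 := hα (σ a)
      rw [hκσ, ← hσsum] at h3
      simp_rw [hσd] at h3
      simp_rw [mul_add]
      rw [Finset.sum_add_distrib]
      linarith
    intro a
    have := congrFun h1 a
    simp only [Pi.zero_apply] at this
    linarith
  have hαsum : ∑ a, α a = 0 := by
    have h1 := hσsum α
    simp_rw [hασ] at h1
    rw [Finset.sum_neg_distrib] at h1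
    linarith
  have hneg : ∀ v ∈ Z, α v < 0 := fun v hv =>
    response_neg h₀ hk hk0 hr0 (half_pos hm0) hσ hασ (t := m / 2) (ω := ω) (ω' := ω')
      (fun a => by
        have := hα a
        simp only [hκ] at this
        linarith) hω hω' hZ hv
  set P : W → ℝ := fun y => ∑ a, (gdist g₀ y a : ℝ) * α a with hP
  have hPα : ∀ y, P y = r * α y - m * κ y := by
    intro y
    have := hα y
    simp only [hP]
    linarith
  have hακ : ∑ a, α a * κ a = P ω := by
    have h1 : ∑ a, α a * κ a = (P ω - P ω') / 2 := by
      simp only [hκ, hP]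
      rw [← Finset.sum_sub_distrib, Finset.sum_div]
      refine Finset.sum_congr rfl fun a _ => ?_
      rw [gdist_comm a ω, gdist_comm a ω']
      ring
    have h2 : P ω' = -P ω := by
      rw [hPα, hPα, ← hσω, hασ, hκσ]
      ring
    rw [h1, h2]
    ring
  -- the extension of `α` by zero
  set β : V → ℝ := Function.extend ψ α 0 with hβ
  have hβψ : ∀ a, β (ψ a) = α a := fun a => hψ.extend_apply _ _ a
  have hβ0 : ∀ v, v ∉ Set.range ψ → β v = 0 := by
    intro v hv
    rw [hβ, Function.extend_apply' _ _ _ (fun ⟨a, ha⟩ => hv ⟨a, ha⟩)]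
    rfl
  have hβsum : ∀ f : V → ℝ, ∑ v, β v * f v = ∑ a, α a * f (ψ a) := by
    intro f
    refine (Fintype.sum_of_injective ψ hψ _ _ (fun v hv => ?_) fun a => ?_).symm
    · simp [hβ0 v hv]
    · rw [hβψ]
  have hβB : ∀ b ∈ B, β b = 0 := by
    intro b hb
    refine hβ0 b ?_
    rintro ⟨a, rfl⟩
    exact hψB a hb
  set X : Finset V := Finset.univ.filter fun b => b ∉ B ∧ b ∉ Set.range ψ with hXdef
  have hsplit : ∀ f : V → ℝ, ∑ v, f v = ∑ a, f (ψ a) + ∑ b ∈ B, f b + ∑ b ∈ X, f b := by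
    intro f
    have h1 : (Finset.univ : Finset V) = Finset.univ.image ψ ∪ B ∪ X := by
      ext v
      simp only [hXdef, Finset.mem_univ, Finset.mem_union, Finset.mem_image, true_and,
        Finset.mem_filter, true_iff, Set.mem_range]
      tauto
    rw [h1, Finset.sum_union, Finset.sum_union, Finset.sum_image fun a _ b _ hab => hψ hab]
    · rw [Finset.disjoint_left]
      intro v hv
      obtain ⟨a, -, rfl⟩ := Finset.mem_image.1 hv
      exact hψB a
    · rw [Finset.disjoint_left]
      intro v hv hvX
      rw [hXdef, Finset.mem_filter_univ] at hvX
      rcases Finset.mem_union.1 hv with h2 | h2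
      · obtain ⟨a, -, rfl⟩ := Finset.mem_image.1 h2
        exact hvX.2 ⟨a, rfl⟩
      · exact hvX.1 h2
  have hsplit' : ∀ f : V → ℝ, ∑ v ∈ Bᶜ, f v = ∑ a, f (ψ a) + ∑ b ∈ X, f b := by
    intro f
    have h1 := hsplit f
    rw [← Finset.sum_compl_add_sum B] at h1
    linarith
  have : Nonempty W := ⟨ω⟩
  choose! y hyZ s hys using hX
  have hxX : ∀ b ∈ X, b ∉ B ∧ b ∉ Set.range ψ := by
    intro b hb
    rwa [hXdef, Finset.mem_filter_univ] at hb
  have hEX : ∀ b ∈ X, ∑ a, α a * (gdist g (ψ a) b : ℝ) = P (y b) := by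
    intro b hb
    have h1 := hxX b hb
    simp_rw [hys b h1.1 h1.2]
    push_cast
    simp_rw [mul_add]
    rw [Finset.sum_add_distrib, ← Finset.sum_mul, hαsum, zero_mul, add_zero]
    refine Finset.sum_congr rfl fun a _ => ?_
    rw [gdist_comm]; ring
  have hEB : ∀ b ∈ B, ∑ a, α a * (gdist g (ψ a) b : ℝ) = P ω := by
    intro b hb
    have h1 : ∀ a, α a * (gdist g (ψ a) b : ℝ)
        = α a * gdist g₀ a ω + α a * gdist g (ψ ω) b := by
      intro a
      rw [hB.gdist_add h (hψB a) hb, hd]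
      push_cast; ring
    simp_rw [h1]
    rw [Finset.sum_add_distrib, ← Finset.sum_mul, hαsum, zero_mul, add_zero]
    refine Finset.sum_congr rfl fun a _ => ?_
    rw [gdist_comm]; ring
  have hPsum : ∑ a, α a * P a = r * ∑ a, α a ^ 2 - m * P ω := by
    rw [← hακ, Finset.mul_sum, Finset.mul_sum, ← Finset.sum_sub_distrib]
    refine Finset.sum_congr rfl fun a _ => ?_
    rw [hPα]; ring
  -- the pairing of `x` with the response
  have hpair : m * ∑ a, x (ψ a) * κ a = m * P ω + ∑ b ∈ X, x b * P (y b) := by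
    have h1 : m * ∑ a, x (ψ a) * κ a = r * ∑ a, α a * x (ψ a) - ∑ a, x (ψ a) * P a := by
      rw [Finset.mul_sum, Finset.mul_sum, ← Finset.sum_sub_distrib]
      refine Finset.sum_congr rfl fun a _ => ?_
      rw [hPα]; ring
    have h2 : r * ∑ a, α a * x (ψ a) = ∑ w, x w * ∑ a, α a * (gdist g (ψ a) w : ℝ) := by
      simp_rw [Finset.mul_sum]
      rw [Finset.sum_comm]
      refine Finset.sum_congr rfl fun a _ => ?_
      have h3 := hx (ψ a)
      rw [show r * (α a * x (ψ a)) = α a * (r * x (ψ a)) by ring, ← h3, Finset.mul_sum]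
      refine Finset.sum_congr rfl fun w _ => ?_
      ring
    have h3 : ∀ a', ∑ a, α a * (gdist g (ψ a) (ψ a') : ℝ) = P a' := by
      intro a'
      refine Finset.sum_congr rfl fun a _ => ?_
      rw [hd, gdist_comm]; ring
    rw [h1, h2, hsplit]
    simp_rw [h3]
    have hb1 : ∑ b ∈ B, x b * ∑ a, α a * (gdist g (ψ a) b : ℝ) = m * P ω := by
      rw [hm, Finset.sum_mul]
      exact Finset.sum_congr rfl fun b hb => by rw [hEB b hb]
    have hb2 : ∑ b ∈ X, x b * ∑ a, α a * (gdist g (ψ a) b : ℝ) = ∑ b ∈ X, x b * P (y b) :=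
      Finset.sum_congr rfl fun b hb => by rw [hEX b hb]
    rw [hb1, hb2]
    ring
  have hκX : ∀ b ∈ X, ((gdist g b (ψ ω') : ℝ) - gdist g b (ψ ω)) = -2 * κ (y b) := by
    intro b hb
    have h1 := hxX b hb
    rw [gdist_comm b, gdist_comm b, hys b h1.1 h1.2, hys b h1.1 h1.2, gdist_comm ω', gdist_comm ω]
    simp only [hκ]
    push_cast; ring
  have hκW : ∀ a, ((gdist g (ψ a) (ψ ω') : ℝ) - gdist g (ψ a) (ψ ω)) = -2 * κ a := by
    intro a
    rw [hd, hd]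
    simp only [hκ]
    ring
  -- Subtracting `2β` replaces the odd response to `B` by its mirror image, which fits the new
  -- position of `B` at `ω'`. Without the vertices in `X`, this would turn `x` on the symmetric part
  -- into its reflection.
  refine rad_lt_of_form (isGateTree_move h hB (hψB ω')) (y := fun v => x v + -2 * β v) ?_
  rw [form_move h hB (hψB ω'), form_add, form_smul]
  have e1 : form g x = r * ∑ v, x v ^ 2 := by
    rw [form_eq_sum, Finset.mul_sum]
    refine Finset.sum_congr rfl fun v _ => ?_
    rw [hx]; ring
  have e2 : ∑ v, -2 * β v * ∑ w, (gdist g v w : ℝ) * x w = -2 * r * ∑ a, α a * x (ψ a) := by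
    rw [← hβsum, Finset.mul_sum]
    refine Finset.sum_congr rfl fun v _ => ?_
    rw [hx]; ring
  have e3 : form g β = ∑ a, α a * P a := by
    rw [form_eq_sum, hβsum]
    refine Finset.sum_congr rfl fun a _ => ?_
    congr 1
    simp_rw [mul_comm (Nat.cast _ : ℝ)]
    rw [hβsum]
    refine Finset.sum_congr rfl fun b _ => ?_
    rw [hd]; ring
  have e4 : ∑ v, (x v + -2 * β v) ^ 2
      = ∑ v, x v ^ 2 - 4 * ∑ a, α a * x (ψ a) + 4 * ∑ a, α a ^ 2 := by
    have h1 : ∀ v, (x v + -2 * β v) ^ 2 = x v ^ 2 - 4 * (β v * x v) + 4 * (β v * β v) := by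
      intro v; ring
    simp_rw [h1]
    rw [Finset.sum_add_distrib, Finset.sum_sub_distrib, ← Finset.mul_sum, ← Finset.mul_sum, hβsum,
      hβsum]
    simp_rw [hβψ, sq]
  have e5 : ∑ b ∈ B, (x b + -2 * β b) = m := by
    refine Finset.sum_congr rfl fun b hb => ?_
    rw [hβB b hb]; ring
  have e6 : ∑ a ∈ Bᶜ, (x a + -2 * β a) * ((gdist g a (ψ ω') : ℝ) - gdist g a (ψ ω))
      = -2 * ∑ a, x (ψ a) * κ a + 4 * P ω - 2 * ∑ b ∈ X, x b * κ (y b) := by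
    have hb1 : ∑ b ∈ X, (x b + -2 * β b) * ((gdist g b (ψ ω') : ℝ) - gdist g b (ψ ω))
        = -2 * ∑ b ∈ X, x b * κ (y b) := by
      rw [Finset.mul_sum]
      refine Finset.sum_congr rfl fun b hb => ?_
      rw [hκX b hb, hβ0 b (hxX b hb).2]
      ring
    have hb2 : ∑ a, (x (ψ a) + -2 * β (ψ a))
          * ((gdist g (ψ a) (ψ ω') : ℝ) - gdist g (ψ a) (ψ ω))
        = -2 * ∑ a, x (ψ a) * κ a + 4 * ∑ a, α a * κ a := by
      rw [Finset.mul_sum, Finset.mul_sum, ← Finset.sum_add_distrib]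
      refine Finset.sum_congr rfl fun a _ => ?_
      rw [hκW, hβψ]
      ring
    rw [hsplit', hb1, hb2, hακ]
    ring
  have e7 : ∑ b ∈ X, x b * P (y b) + m * ∑ b ∈ X, x b * κ (y b) = r * ∑ b ∈ X, x b * α (y b) := by
    rw [Finset.mul_sum, Finset.mul_sum, ← Finset.sum_add_distrib]
    refine Finset.sum_congr rfl fun b _ => ?_
    rw [hPα]; ring
  have e8 : ∑ b ∈ X, x b * α (y b) < 0 := by
    refine Finset.sum_neg (fun b hb => ?_) ⟨b₀, by rw [hXdef, Finset.mem_filter_univ]; exact ⟨hb₀B, hb₀⟩⟩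
    have h1 := hxX b hb
    exact mul_neg_of_pos_of_neg (hx0 b) (hneg _ (hyZ b h1.1 h1.2))
  have e9 : r * ∑ b ∈ X, x b * α (y b) < 0 := mul_neg_of_pos_of_neg hr0 e8
  rw [e1, e2, e3, e4, e5, e6, hPsum]
  -- The net gain over `r` times the squared norm is `-4 * r * ∑ b ∈ X, x b * α (y b)`, positive
  -- since `α` is negative on `Z`.
  linear_combination 4 * e9 + 4 * hpair + 4 * e7

end Reflection

end GateTree

/-! ### The reflection of a symmetric caterpillar -/

namespace GateTree

section CatReflection

open Hypergraph

variable {k L : ℕ} {c : Fin (L + 1) → ℕ}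

/-- The reflection of the edges of a symmetric caterpillar. -/
def reflEdge (hc : ∀ i, c i = c i.rev) : CatEdge L c → CatEdge L c
  | .inl j => .inl j.rev
  | .inr ⟨i, t⟩ => .inr ⟨i.rev, Fin.cast (hc i) t⟩

/-- The reflection of the vertices of a symmetric caterpillar. -/
def refl (k : ℕ) (hc : ∀ i, c i = c i.rev) :
    StarCaterpillarVertex k L c → StarCaterpillarVertex k L c
  | .inl i => .inl i.rev
  | .inr (.inl (j, x)) => .inr (.inl (j.rev, x))
  | .inr (.inr ⟨i, t, x⟩) => .inr (.inr ⟨i.rev, Fin.cast (hc i) t, x⟩)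

lemma sigma_fin_eq {i i' : Fin (L + 1)} {t : Fin (c i)} {t' : Fin (c i')} (hi : i = i')
    (ht : (t : ℕ) = t') : (⟨i, t⟩ : (i : Fin (L + 1)) × Fin (c i)) = ⟨i', t'⟩ := by
  subst hi
  rw [Fin.ext ht]

lemma sigma_fin_eq' {i i' : Fin (L + 1)} {t : Fin (c i)} {t' : Fin (c i')} {x : Fin (k - 1)}
    (hi : i = i') (ht : (t : ℕ) = t') :
    (⟨i, t, x⟩ : (i : Fin (L + 1)) × Fin (c i) × Fin (k - 1)) = ⟨i', t', x⟩ := by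
  subst hi
  rw [Fin.ext ht]

lemma refl_involutive (hc : ∀ i, c i = c i.rev) : Function.Involutive (refl k hc) := by
  rintro (i | ⟨j, x⟩ | ⟨i, t, x⟩)
  · simp [refl]
  · simp [refl]
  · simp only [refl]
    rw [sigma_fin_eq' (Fin.rev_rev i) rfl]

lemma reflEdge_involutive (hc : ∀ i, c i = c i.rev) : Function.Involutive (reflEdge hc) := by
  rintro (j | ⟨i, t⟩)
  · simp [reflEdge]
  · simp only [reflEdge]
    rw [sigma_fin_eq (Fin.rev_rev i) rfl]

lemma isEmb_refl (hc : ∀ i, c i = c i.rev) :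
    IsEmb (catGate k L c) (catGate k L c) (refl k hc) (reflEdge hc) := by
  refine ⟨(reflEdge_involutive hc).injective, ?_, fun i u v _ _ huv =>
    (refl_involutive hc).injective huv⟩
  rintro (j | ⟨i, t⟩) v hv
  · rw [← mem_pathEdge] at hv
    rcases hv with (rfl | rfl) | ⟨x, rfl⟩
    · simp only [refl, reflEdge, catGate_path_inl, Fin.val_rev, Fin.val_castSucc]
      rw [if_neg (by omega)]
      simp [Fin.ext_iff]; omega
    · simp only [refl, reflEdge, catGate_path_inl, Fin.val_rev, Fin.val_succ]
      rw [if_pos (by omega)]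
      simp [Fin.ext_iff]
    · simp [refl, reflEdge]
  · rw [← mem_starEdge] at hv
    rcases hv with rfl | ⟨x, rfl⟩
    · simp [refl, reflEdge]
    · simp [refl, reflEdge]

/-- Twice the distance of a vertex of a caterpillar from the left end, measured along the path. -/
def doublePos : StarCaterpillarVertex k L c → ℕ
  | .inl i => 2 * i
  | .inr (.inl (j, _)) => 2 * j + 1
  | .inr (.inr ⟨i, _, _⟩) => 2 * i

/-- This verifies the hypothesis on `Z` in `rad_lt_move_of_reflection` for the right half. For even
`L` the two halves meet in a fixed vertex of the reflection, for odd `L` in a middle edge that is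
mapped to itself; these are the two alternatives. -/
lemma half_spec (hc : ∀ i, c i = c i.rev) {v : StarCaterpillarVertex k L c} (hv : L < doublePos v)
    (i : CatEdge L c) (hiv : catGate k L c i v = v) :
    L < doublePos (catGate k L c i (.inl (Fin.last L))) ∧
      ((∀ w, catGate k L c i w = w → L < doublePos w ∨ refl k hc w = w) ∨
        (catGate k L c i (.inl (Fin.last L)) = v ∧
          ∀ w, catGate k L c i w = w → catGate k L c i (refl k hc w) = refl k hc w)) := by
  rcases i with j | ⟨i, t⟩
  · have hj := j.2
    have hle : L ≤ 2 * j + 1 := by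
      rw [← mem_pathEdge] at hiv
      rcases hiv with (rfl | rfl) | ⟨x, rfl⟩ <;> simp only [doublePos, Fin.val_castSucc, Fin.val_succ] at hv <;> omega
    rw [catGate_path_inl, if_neg (by rw [Fin.val_last]; omega)]
    refine ⟨by simp only [doublePos, Fin.val_succ]; omega, ?_⟩
    rcases hle.lt_or_eq with hlt | heq
    · left
      intro w hw
      rw [← mem_pathEdge] at hw
      rcases hw with (rfl | rfl) | ⟨x, rfl⟩
      · by_cases h : L = 2 * j
        · right
          simp [refl, Fin.ext_iff]; omega
        · left
          simp only [doublePos, Fin.val_castSucc]; omega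
      · left
        simp only [doublePos, Fin.val_succ]; omega
      · left
        simp only [doublePos]; omega
    · right
      constructor
      · rw [← mem_pathEdge] at hiv
        rcases hiv with (rfl | rfl) | ⟨x, rfl⟩
        · simp only [doublePos, Fin.val_castSucc] at hv; omega
        · rfl
        · simp only [doublePos] at hv; omega
      · intro w hw
        have := (isEmb_refl (k := k) hc).mem _ _ hw
        rwa [reflEdge, show j.rev = j by rw [Fin.ext_iff, Fin.val_rev]; omega] at this
  · rw [catGate_star_inl]
    have hi : L < 2 * (i : ℕ) := by
      rw [← mem_starEdge] at hiv
      rcases hiv with rfl | ⟨x, rfl⟩ <;> simpa only [doublePos] using hv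
    refine ⟨hi, Or.inl fun w hw => Or.inl ?_⟩
    rw [← mem_starEdge] at hw
    rcases hw with rfl | ⟨x, rfl⟩ <;> simpa only [doublePos] using hi

end CatReflection

end GateTree

/-! ### Balance of the two ends -/

namespace GateTree

section Balance

open Hypergraph

variable {ι V : Type*} [Fintype ι] [DecidableEq ι] [Fintype V] [DecidableEq V]
variable {g : ι → V → V} {k n L : ℕ} {u : ℕ → V} {e : ℕ → ι}

lemma IsSpine.off_inj (h : IsGateTree g) (hs : IsSpine g L u e) {f : ι} (hf : ∀ j < L, e j ≠ f)
    {i i' : ℕ} (hi : i ≤ L) (hi' : i' ≤ L) (h1 : g f (u i) = u i) (h2 : g f (u i') = u i') :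
    i = i' := by
  refine hs.injOn h hi hi' ?_
  rw [← h1, ← h2, hs.gate_off h hf hi, hs.gate_off h hf hi']

/-- In an extremal hypertree whose last inner vertex of the path has degree three, a vertex of
degree three without mirror image cannot occur only beyond the middle of the path. -/
lemma IsLongest.not_unbalanced (hg : IsExtremal k n g) (hk : 2 ≤ k) {ℓ : ℕ}
    (hs : IsLongest g (ℓ + 1) u e) (hlast : ℓ ∈ bigPos g (ℓ + 1) u)
    (hI : ∀ i ∈ bigPos g (ℓ + 1) u, i < ℓ → ℓ - i ∉ bigPos g (ℓ + 1) u → ℓ < 2 * i)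
    {i₀ : ℕ} (hi₀ : i₀ ∈ bigPos g (ℓ + 1) u) (hi₀ℓ : i₀ < ℓ)
    (hi₀' : ℓ - i₀ ∉ bigPos g (ℓ + 1) u) : False := by
  have h := hg.tree
  have hs' := hs.toIsSpine
  have h2 := hg.two_le hk
  have : Nonempty ι := ⟨e 0⟩
  have : Nontrivial V := hg.nontrivial hk (e 0)
  set I := bigPos g (ℓ + 1) u with hIdef
  have hℓ : 1 ≤ ℓ := (mem_bigPos.1 hlast).1.1
  choose! p hp1 hp2 using fun i (hi : i ∈ I) =>
    (hs.exists_off_iff hg hk (mem_bigPos.1 hi).1.1 (mem_bigPos.1 hi).1.2).1 (mem_bigPos.1 hi).2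
  -- The symmetric part is the path from `u 0` to `u ℓ` together with the pendant edges whose mirror
  -- image under `i ↦ ℓ - i` is also present.
  let c : Fin (ℓ + 1) → ℕ := fun i => if (i : ℕ) ∈ I ∧ ℓ - i ∈ I then 1 else 0
  have hc : ∀ i, c i = c i.rev := by
    intro i
    have : ℓ + 1 - ((i : ℕ) + 1) = ℓ - i := by omega
    simp only [c, Fin.val_rev, this, show ℓ - (ℓ - (i : ℕ)) = i by omega, and_comm]
  have hcI : ∀ i : Fin (ℓ + 1), Fin (c i) → (i : ℕ) ∈ I ∧ ℓ - i ∈ I := by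
    intro i t
    by_contra hcon
    have : c i = 0 := if_neg hcon
    rw [this] at t
    exact t.elim0
  have hsub : ∀ i : Fin (ℓ + 1), ∀ t t' : Fin (c i), t = t' := by
    intro i t t'
    have : c i ≤ 1 := by simp only [c]; split_ifs <;> omega
    rw [Fin.ext_iff]; omega
  -- The mirror image of `ℓ` is `0`, which is not a position of degree three, so the pendant edge at
  -- `u ℓ` belongs to the moved branch.
  have hlastI : ¬ Nonempty (Fin (c (Fin.last ℓ))) := by
    rintro ⟨t⟩
    have h1 := (mem_bigPos.1 (hcI _ t).2).1.1
    simp at h1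
  obtain ⟨ψ, hψu, hψ⟩ := exists_emb_cat (c := c) (L := ℓ) hg.unif (fun i => u i) (fun j => e j)
    (fun s => p s.1) (by
      refine Function.Injective.sumElim ?_ ?_ ?_
      · intro j j' hjj
        exact Fin.ext (hs.inj j (by omega) j' (by omega) hjj)
      · rintro ⟨i, t⟩ ⟨i', t'⟩ hii
        have h1 := hcI i t
        have h3 := hcI i' t'
        have h4 := hs'.off_inj (i := i) (i' := i') h (hp1 _ h1.1) (by omega) (by omega) (hp2 _ h1.1)
          (by rw [show p i = p i' from hii]; exact hp2 _ h3.1)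
        obtain rfl := Fin.ext h4
        rw [hsub i t t']
      · rintro j ⟨i, t⟩ hji
        exact hp1 _ (hcI i t).1 j (by omega) hji)
    (fun j => hs.left j (by omega)) (fun j => hs.right j (by omega)) (fun j => hs.ne j (by omega))
    (fun s => hp2 _ (hcI s.1 s.2).1)
  have h₀ := isGateTree_catGate k ℓ c
  have hcard : ∀ i, (edge (catGate k ℓ c) i).card = (edge g (Sum.elim (fun j : Fin ℓ => e j)
      (fun s : (i : Fin (ℓ + 1)) × Fin (c i) => p s.1) i)).card := by
    intro i
    rw [card_edge_cat hk, hg.unif]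
  have hrange : ∀ i b, g (Sum.elim (fun j : Fin ℓ => e j)
      (fun s : (i : Fin (ℓ + 1)) × Fin (c i) => p s.1) i) b = b → b ∈ Set.range ψ := by
    intro i b hb
    rw [← mem_edge, ← hψ.map_edge h₀ h (hcard i), Finset.mem_image] at hb
    obtain ⟨a, -, ha⟩ := hb
    exact ⟨a, ha⟩
  have hlastψ : ψ (.inl (Fin.last ℓ)) = u ℓ := by rw [hψu, Fin.val_last]
  have h0ψ : ψ (.inl 0) = u 0 := by rw [hψu, Fin.val_zero]
  have hel : g (e (ℓ - 1)) (u ℓ) = u ℓ := by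
    have := hs.right (ℓ - 1) (by omega)
    rwa [Nat.sub_add_cancel hℓ] at this
  -- The moved branch consists of all that hangs at `u ℓ` off `e (ℓ - 1)`, in particular the last
  -- edge of the path and the pendant edge.
  have hB : IsBranch g (u ℓ) (coBranch g (e (ℓ - 1)) (u ℓ)) := isBranch_coBranch h
  have hψB : ∀ a, ψ a ∉ coBranch g (e (ℓ - 1)) (u ℓ) := by
    intro a ha
    rw [mem_coBranch] at ha
    have h1 := hψ.gate h₀ h (.inl ⟨ℓ - 1, by omega⟩) a
    simp only [Sum.elim_inl] at h1
    rw [ha.1, ← hlastψ] at h1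
    have h3 := (hψ.injective h₀ h h1).symm
    refine ha.2 ?_
    rw [← hlastψ]
    congr 1
    rcases a with i | ⟨j, x⟩ | ⟨i, t, x⟩
    · rw [catGate_path_inl] at h3
      split_ifs at h3 with h4
      · simp [Fin.ext_iff] at h3; omega
      · simp only at h4
        congr 1
        rw [Fin.ext_iff, Fin.val_last]; omega
    · rw [catGate_path_leaf] at h3
      split_ifs at h3 with h4 h5
      · simp [Fin.ext_iff] at h3; omega
      · rw [Fin.ext_iff] at h4
        simp only at h4 h5
        omega
    · rw [catGate_path_star] at h3
      split_ifs at h3 with h4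
      · simp [Fin.ext_iff] at h3; omega
      · have : i = Fin.last ℓ := by
          simp only at h4
          rw [Fin.ext_iff, Fin.val_last]; omega
        subst this
        exact absurd ⟨t⟩ hlastI
  -- the edges outside the symmetric part
  have hoff : ∀ f i, (∀ j < ℓ + 1, e j ≠ f) → g f (u i) = u i → i < ℓ → ℓ - i ∉ I →
      ∀ a, g f (ψ a) = u i := by
    intro f i hf hfi hi hiI a
    have h1 : ∀ j, Sum.elim (fun j : Fin ℓ => e j)
        (fun s : (i : Fin (ℓ + 1)) × Fin (c i) => p s.1) j ≠ f := by
      rintro (j | ⟨i', t⟩) hj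
      · exact hf j (by omega) hj
      · have h3 := hcI i' t
        have h4 := hs'.off_inj (i := i) (i' := i') h hf (by omega) (by omega) hfi
          (by rw [← hj]; exact hp2 _ h3.1)
        exact hiI (h4 ▸ h3.2)
    rw [hψ.gate_of_notMem h₀ h h1 a (.inl ⟨i, by omega⟩), hψu, hfi]
  have hlt : rad g < rad (move g (u ℓ) (u 0) (coBranch g (e (ℓ - 1)) (u ℓ))) := by
    have hmain := rad_lt_move_of_reflection h h₀ (card_edge_cat hk) (by omega)
      (hψ.injective h₀ h) (hψ.gdist h₀ h) (refl_involutive (k := k) hc)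
      ((isEmb_refl hc).gdist h₀ h₀) (ω := .inl (Fin.last ℓ)) (ω' := .inl 0) (by simp [refl])
      (Z := Finset.univ.filter fun v => ℓ < doublePos v)
      (by rw [Finset.mem_filter_univ]; simp only [doublePos, Fin.val_last]; omega)
      (by rw [Finset.mem_filter_univ]; simp [doublePos])
      (fun v hv i hiv => by
        rw [Finset.mem_filter_univ] at hv
        simp only [Finset.mem_filter_univ]
        exact half_spec hc hv i hiv)
      (B := coBranch g (e (ℓ - 1)) (u ℓ)) (by rw [hlastψ]; exact hB)
      ⟨u (ℓ + 1), by
        rw [mem_coBranch, hs'.gate_lt h (by omega) le_rfl, Nat.sub_add_cancel hℓ]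
        exact ⟨rfl, (hs.ne ℓ (by omega)).symm⟩⟩ hψB ?_ ?_
    · rwa [hlastψ, h0ψ] at hmain
    · intro b hbB hbr
      have hnoB : g (e (ℓ - 1)) b ≠ u ℓ := by
        intro h1
        refine hbB (mem_coBranch.2 ⟨h1, ?_⟩)
        rintro rfl
        exact hbr ⟨_, hlastψ⟩
      obtain ⟨b', hb'⟩ := exists_ne b
      obtain ⟨f, hfb, -⟩ := h.step hb'.symm
      have hf : ∀ j < ℓ + 1, e j ≠ f := by
        rintro j hj rfl
        rcases Nat.lt_succ_iff_lt_or_eq.1 hj with hj | rfl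
        · exact hbr (hrange (.inl ⟨j, hj⟩) b hfb)
        · refine hnoB ?_
          rw [const' h (i := e j) (fun h1 => ?_) hfb (hs.left j (by omega)), hel]
          have := hs.inj _ (by omega) _ (by omega) h1
          omega
      obtain ⟨i, hi0, hiL, hfi⟩ := hs.exists_attach hg hk hf
      have hiI : i ∈ I :=
        mem_bigPos.2 ⟨⟨hi0, hiL⟩, (hs.exists_off_iff hg hk hi0 hiL).2 ⟨f, hf, hfi⟩⟩
      have hiℓ : i < ℓ := by
        refine lt_of_le_of_ne (by omega) ?_
        rintro rfl
        refine hnoB ?_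
        rw [const' h (hf _ (by omega)).symm hfb hfi, hel]
      have hiI' : ℓ - i ∉ I := by
        intro h1
        have h3 : f = p i := hs.attach_unique hg hk hf (hp1 i hiI) hi0 hiL hfi (hp2 i hiI)
        have h4 : c ⟨i, by omega⟩ = 1 := if_pos ⟨hiI, h1⟩
        refine hbr (hrange (.inr ⟨⟨i, by omega⟩, ⟨0, by omega⟩⟩) b ?_)
        rw [Sum.elim_inr, ← h3, hfb]
      -- A vertex outside both the symmetric part and the branch lies on an unmatched pendant edge
      -- at some `u i`, hence one step beyond `u i`.
      refine ⟨.inl ⟨i, by omega⟩, ?_, 1, fun a => ?_⟩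
      · rw [Finset.mem_filter_univ]
        exact hI i hiI hiℓ hiI'
      · have h1 := hoff f i hf hfi hiℓ hiI' a
        rw [gdist_comm, gdist_gate h hfb, h1, ← hψ.gdist h₀ h, hψu, gdist_comm]
        rw [h1]
        rintro rfl
        exact hbr ⟨_, hψu ⟨i, by omega⟩⟩
    · have hb := mem_bigPos.1 hi₀
      obtain ⟨b, hfb, hbu⟩ := exists_ne_of_two_le h2 (p i₀) (u i₀)
      refine ⟨b, ?_, ?_⟩
      · rw [mem_coBranch, const' h (hp1 i₀ hi₀ _ (by omega)).symm hfb (hp2 i₀ hi₀),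
          hs'.gate_le h (by omega) (by omega)]
        intro h1
        have := hs'.injOn h (by omega) (by omega) h1.1
        omega
      · rintro ⟨a, rfl⟩
        have := hoff (p i₀) i₀ (hp1 i₀ hi₀) (hp2 i₀ hi₀) hi₀ℓ hi₀' a
        rw [hfb] at this
        exact hbu this
  have hq : u 0 ∉ coBranch g (e (ℓ - 1)) (u ℓ) := by rw [← h0ψ]; exact hψB _
  have hne : u ℓ ≠ u 0 := by
    intro h1
    have := hs'.injOn h (by omega) (by omega) h1
    omega
  -- The move takes at least two edges from `u ℓ` to the leaf `u 0`, which then has degree at least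
  -- three; so the number of vertices of degree at least three does not drop.
  refine absurd (hg.le _ (hg.toInClass.move hB hq ?_)) (not_le.2 hlt)
  have h3 := attach_coBranch h h2 hel
  have h4 := (mem_bigPos.1 hlast).2
  have h5 := deg_move_right h hB hq hne
  have h6 : u 0 ∉ (big g).erase (u ℓ) := by
    rw [Finset.mem_erase, mem_big, hs.deg_zero h h2]
    omega
  have h7 : insert (u 0) ((big g).erase (u ℓ)) ⊆
      big (move g (u ℓ) (u 0) (coBranch g (e (ℓ - 1)) (u ℓ))) := by
    refine Finset.insert_subset ?_ (big_erase_subset h hB hq hne)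
    rw [mem_big, h5, hs.deg_zero h h2]
    omega
  have h8 := Finset.card_le_card h7
  rw [Finset.card_insert_of_notMem h6, Finset.card_erase_of_mem (mem_big.2 h4)] at h8
  have := hg.many
  omega

end Balance

end GateTree

/-! ### The shape of extremal hypertrees -/

namespace GateTree

section Shape

open Hypergraph

/-- A set of positions in which on one side of each member all positions are members consists of an
initial and a final segment. -/
lemma exists_segments {L : ℕ} {I : Finset ℕ} (hI : ∀ i ∈ I, 1 ≤ i ∧ i < L)
    (hside : ∀ i ∈ I, (∀ j, 1 ≤ j → j < i → j ∈ I) ∨ ∀ j, i < j → j < L → j ∈ I) :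
    (∀ i, 1 ≤ i → i < L → i ∈ I) ∨ ∃ a b, a + b + 1 < L ∧
      ∀ i, i ∈ I ↔ (1 ≤ i ∧ i < L) ∧ (i ≤ a ∨ L ≤ i + b) := by
  classical
  set P : ℕ → Prop := fun a => ∀ j, 1 ≤ j → j ≤ a → j ∈ I with hP
  set Q : ℕ → Prop := fun b => ∀ j, j < L → L ≤ j + b → j ∈ I with hQ
  set a := Nat.findGreatest P L with ha
  set b := Nat.findGreatest Q L with hb
  have hPa : P a := Nat.findGreatest_spec (Nat.zero_le L) (by intro j h1 h2; omega)
  have hQb : Q b := Nat.findGreatest_spec (Nat.zero_le L) (by intro j h1 h2; omega)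
  have hPm : ∀ x, a < x → x ≤ L → ¬ P x := fun x h1 h2 => Nat.findGreatest_is_greatest h1 h2
  have hQm : ∀ x, b < x → x ≤ L → ¬ Q x := fun x h1 h2 => Nat.findGreatest_is_greatest h1 h2
  by_cases hall : ∀ i, 1 ≤ i → i < L → i ∈ I
  · exact Or.inl hall
  right
  push Not at hall
  obtain ⟨x, hx1, hxL, hx⟩ := hall
  have hax : a < x := by
    by_contra hcon
    exact hx (hPa x hx1 (by omega))
  -- The gap `a + 1` blocks the left side of every member beyond the initial segment, so all
  -- positions to the right of such a member belong to `I`.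
  have ha1 : a + 1 ∉ I := by
    intro h1
    refine hPm (a + 1) (by omega) (by omega) fun j h2 h3 => ?_
    rcases h3.lt_or_eq with h4 | rfl
    · exact hPa j h2 (by omega)
    · exact h1
  refine ⟨a, b, ?_, fun i => ⟨fun hi => ⟨hI i hi, ?_⟩, ?_⟩⟩
  · by_contra hcon
    exact ha1 (hQb _ (by omega) (by omega))
  · by_contra hcon
    have h1 : i ≠ a + 1 := fun e => ha1 (e ▸ hi)
    have h2 := (hside i hi).resolve_left fun h3 => ha1 (h3 _ (by omega) (by omega))
    have h3 := hI i hi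
    refine hQm (L - i) (by omega) (by omega) fun j h4 h5 => ?_
    rcases (show i ≤ j by omega).lt_or_eq with h6 | rfl
    · exact h2 j h6 h4
    · exact hi
  · rintro ⟨h1, h2 | h2⟩
    · exact hPa i h1.1 h2
    · exact hQb i h1.2 h2

variable {ι V : Type*} [Fintype ι] [DecidableEq ι] [Fintype V] [DecidableEq V]
variable {g : ι → V → V} {k n L : ℕ} {u : ℕ → V} {e : ℕ → ι}

/-- If `b ≥ a + 2`, the last inner position is occupied, and the occupied positions before it
without mirror image are all beyond the middle, which `not_unbalanced` forbids. -/
lemma IsLongest.le_succ_of_segments (hg : IsExtremal k n g) (hk : 2 ≤ k) (hs : IsLongest g L u e)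
    {a b : ℕ} (hab : a + b + 1 < L)
    (hI : ∀ i, i ∈ bigPos g L u ↔ (1 ≤ i ∧ i < L) ∧ (i ≤ a ∨ L ≤ i + b)) : b ≤ a + 1 := by
  by_contra hcon
  obtain ⟨ℓ, rfl⟩ : ∃ ℓ, L = ℓ + 1 := ⟨L - 1, by omega⟩
  -- In `i₀`, the term `ℓ + 1 - b` puts the position into the final segment, and the term `b` keeps
  -- its mirror image out of that segment. The mirror image is also beyond `a` because `a + 1 < b`
  -- and `a + b < ℓ`.
  refine hs.not_unbalanced hg hk ((hI _).2 (by omega)) (fun i hi h1 h2 => ?_)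
    (i₀ := max (ℓ + 1 - b) b) ((hI _).2 (by omega)) (by omega) fun h1 => ?_
  · rw [hI] at hi h2
    omega
  · rw [hI] at h1
    omega

lemma card_segments {a b : ℕ} {I : Finset ℕ} (hab : a + b < L)
    (hI : ∀ i, i ∈ I ↔ (1 ≤ i ∧ i < L) ∧ (i ≤ a ∨ L ≤ i + b)) : I.card = a + b := by
  have : I = Finset.Ico 1 (a + 1) ∪ Finset.Ico (L - b) L := by
    ext i
    rw [hI, Finset.mem_union, Finset.mem_Ico, Finset.mem_Ico]
    omega
  rw [this, Finset.card_union_of_disjoint, Nat.card_Ico, Nat.card_Ico]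
  · omega
  · rw [Finset.disjoint_left]
    intro i h1 h2
    rw [Finset.mem_Ico] at h1 h2
    omega

/-- The bound applied to the path and to its reverse gives that `a` and `b` differ by at most one;
the orientation is chosen so that the initial segment is not the longer one. -/
lemma exists_balanced [Nontrivial V] (hg : IsExtremal k n g) (hk : 2 ≤ k) :
    ∃ L u e, IsLongest g L u e ∧
      ∀ i, i ∈ bigPos g L u ↔ (1 ≤ i ∧ i < L) ∧ (i ≤ n / 2 ∨ L ≤ i + (n + 1) / 2) := by
  obtain ⟨L, u, e, hs⟩ := exists_longest hg.tree
  have hcard := hs.card_bigPos hg hk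
  rcases exists_segments (fun i hi => (mem_bigPos.1 hi).1) (fun i hi => hs.bigPos_side hg hk hi)
    with hall | ⟨a, b, hab, hI⟩
  · refine ⟨L, u, e, hs, fun i => ⟨fun hi => ⟨(mem_bigPos.1 hi).1, ?_⟩, fun hi => hall i hi.1.1 hi.1.2⟩⟩
    have h1 := (mem_bigPos.1 hi).1
    have h2 : n = L - 1 := by
      rw [← hcard, ← Nat.card_Ico]
      congr 1
      ext j
      rw [Finset.mem_Ico]
      exact ⟨fun h => (mem_bigPos.1 h).1, fun h => hall j h.1 h.2⟩
    omega
  · have hn : n = a + b := hcard.symm.trans (card_segments (by omega) hI)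
    have hI' : ∀ i, i ∈ bigPos g L (fun i => u (L - i)) ↔
        (1 ≤ i ∧ i < L) ∧ (i ≤ b ∨ L ≤ i + a) := by
      intro i
      have h1 := hI (L - i)
      rw [mem_bigPos] at h1 ⊢
      by_cases hi : 1 ≤ i ∧ i < L
      · simp only [show 1 ≤ L - i ∧ L - i < L by omega, hi, and_self, true_and] at h1 ⊢
        rw [h1]
        omega
      · simp only [hi, false_and]
    have h1 := hs.le_succ_of_segments hg hk hab hI
    have h2 := hs.reverse.le_succ_of_segments hg hk (a := b) (b := a) (by omega) hI'
    rcases le_total a b with h3 | h3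
    · refine ⟨L, u, e, hs, fun i => ?_⟩
      rw [hI]
      omega
    · refine ⟨L, _, _, hs.reverse, fun i => ?_⟩
      rw [hI']
      omega

/-- The extremal hypertrees are balanced caterpillars. -/
theorem IsExtremal.exists_emb (hg : IsExtremal k n g) (hk : 2 ≤ k) [Nontrivial V] :
    ∃ φ ε, IsEmb (catGate k (Fintype.card ι - n)
      (caterpillarStarSize (Fintype.card ι - n) 3 (n / 2) ((n + 1) / 2))) g φ ε ∧
      Function.Bijective φ ∧ Function.Surjective ε := by
  obtain ⟨L, u, e, hs, hI⟩ := exists_balanced hg hk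
  have h := hg.tree
  have hs' := hs.toIsSpine
  have hL := hs.card_edges hg hk
  obtain rfl : L = Fintype.card ι - n := by omega
  set L := Fintype.card ι - n
  have : Nonempty ι := ⟨e 0⟩
  set c := caterpillarStarSize L 3 (n / 2) ((n + 1) / 2) with hc
  choose! p hp1 hp2 using fun i (hi : i ∈ bigPos g L u) =>
    (hs.exists_off_iff hg hk (mem_bigPos.1 hi).1.1 (mem_bigPos.1 hi).1.2).1 (mem_bigPos.1 hi).2
  have hcI : ∀ i : Fin (L + 1), Fin (c i) → (i : ℕ) ∈ bigPos g L u := by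
    intro i t
    rw [hI]
    by_contra hcon
    have : c i = 0 := if_pos (by omega)
    rw [this] at t
    exact t.elim0
  have hsub : ∀ i : Fin (L + 1), ∀ t t' : Fin (c i), t = t' := by
    intro i t t'
    have : c i ≤ 1 := by simp only [hc, caterpillarStarSize]; split_ifs <;> omega
    rw [Fin.ext_iff]; omega
  obtain ⟨φ, -, hφ⟩ := exists_emb_cat (c := c) (L := L) hg.unif (fun i => u i) (fun j => e j)
    (fun s => p s.1) (by
      refine Function.Injective.sumElim ?_ ?_ ?_
      · intro j j' hjj
        exact Fin.ext (hs.inj j (by omega) j' (by omega) hjj)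
      · rintro ⟨i, t⟩ ⟨i', t'⟩ hii
        have h1 := hcI i t
        have h3 := hcI i' t'
        have h4 := hs'.off_inj (i := i) (i' := i') h (hp1 _ h1) (by omega) (by omega) (hp2 _ h1)
          (by rw [show p i = p i' from hii]; exact hp2 _ h3)
        obtain rfl := Fin.ext h4
        rw [hsub i t t']
      · rintro j ⟨i, t⟩ hji
        exact hp1 _ (hcI i t) j (by omega) hji)
    (fun j => hs.left j (by omega)) (fun j => hs.right j (by omega)) (fun j => hs.ne j (by omega))
    (fun s => hp2 _ (hcI s.1 s.2))
  have h₀ := isGateTree_catGate k L c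
  have hsurj : Function.Surjective (Sum.elim (fun j : Fin L => e j)
      (fun s : (i : Fin (L + 1)) × Fin (c i) => p s.1)) := by
    intro f
    by_cases hf : ∀ j < L, e j ≠ f
    · obtain ⟨i, h0, hi, hfi⟩ := hs.exists_attach hg hk hf
      have hib : i ∈ bigPos g L u :=
        mem_bigPos.2 ⟨⟨h0, hi⟩, (hs.exists_off_iff hg hk h0 hi).2 ⟨f, hf, hfi⟩⟩
      have hci : c ⟨i, by omega⟩ = 1 := by
        rw [hI] at hib
        exact if_neg (by simp only; omega)
      exact ⟨.inr ⟨⟨i, by omega⟩, ⟨0, by omega⟩⟩,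
        hs.attach_unique hg hk (hp1 i hib) hf h0 hi (hp2 i hib) hfi⟩
    · push Not at hf
      obtain ⟨j, hj, rfl⟩ := hf
      exact ⟨.inl ⟨j, hj⟩, rfl⟩
  refine ⟨φ, _, hφ, ⟨hφ.injective h₀ h, ?_⟩, hsurj⟩
  exact hφ.surjective h₀ h (fun i => by rw [card_edge_cat hk, hg.unif]) hsurj

end Shape

end GateTree

/-! ### From hypertrees to gate maps -/

namespace Hypergraph

variable {α : Type*} {H : Hypergraph α}

/-- Two vertices are adjacent if they lie in a common edge other than `e`. -/
def avoidGraph (H : Hypergraph α) (e : Set α) : SimpleGraph α where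
  Adj a b := a ≠ b ∧ ∃ f ∈ H.edgeSet, f ≠ e ∧ a ∈ f ∧ b ∈ f
  symm := ⟨fun _ _ ⟨h1, f, h2, h3, h4, h5⟩ => ⟨h1.symm, f, h2, h3, h5, h4⟩⟩
  loopless := ⟨fun _ h => h.1 rfl⟩

lemma reachable_of_mem {e f : Set α} (hf : f ∈ H.edgeSet) (hfe : f ≠ e) {a b : α} (ha : a ∈ f)
    (hb : b ∈ f) : (H.avoidGraph e).Reachable a b := by
  by_cases hab : a = b
  · rw [hab]
  · exact SimpleGraph.Adj.reachable ⟨hab, f, hf, hfe, ha, hb⟩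

/-- Along a geodesic the distance to the end decreases by one in each step. -/
lemma exists_geodesic {G : SimpleGraph α} {a b : α} (hab : G.Reachable a b) :
    ∃ v : ℕ → α, v 0 = a ∧ v (G.dist a b) = b ∧ (∀ i < G.dist a b, G.Adj (v i) (v (i + 1))) ∧
      ∀ i ≤ G.dist a b, G.Reachable (v i) b ∧ G.dist (v i) b = G.dist a b - i := by
  obtain ⟨w, hw⟩ := hab.exists_walk_length_eq_dist
  refine ⟨w.getVert, w.getVert_zero, by rw [← hw, w.getVert_length],
    fun i hi => w.adj_getVert_succ (by omega), fun i hi => ⟨(w.drop i).reachable, ?_⟩⟩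
  have h1 := SimpleGraph.dist_le (w.drop i)
  have h2 := SimpleGraph.dist_le (w.take i)
  have h3 := (w.take i).reachable
  have h4 := h3.dist_triangle_left b
  rw [SimpleGraph.Walk.drop_length] at h1
  rw [SimpleGraph.Walk.take_length] at h2
  omega

/-- Two vertices of an edge of a hypergraph without cycles are not joined outside the edge. -/
lemma eq_of_reachable (hcyc : ∀ (p : ℕ) (v : Fin (p + 1) → α) (e : Fin p → Set α), ¬ H.IsCycle v e)
    {e : Set α} (he : e ∈ H.edgeSet) {a b : α} (ha : a ∈ e) (hb : b ∈ e)
    (hab : (H.avoidGraph e).Reachable a b) : a = b := by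
  by_contra hne
  obtain ⟨v, hv0, hvp, hadj, hdist⟩ := exists_geodesic hab
  set p := (H.avoidGraph e).dist a b with hp
  have hp0 : 0 < p := hab.pos_dist_of_ne hne
  have hinj : ∀ i ≤ p, ∀ j ≤ p, v i = v j → i = j := by
    intro i hi j hj hij
    have h1 := (hdist i hi).2
    rw [hij, (hdist j hj).2] at h1
    omega
  choose! f hfE hfe hf1 hf2 using fun i (hi : i < p) => (hadj i hi).2
  -- An edge used twice would be a shortcut on the geodesic.
  have hfinj' : ∀ i < p, ∀ j < p, i < j → f i ≠ f j := by
    intro i hi j hj hij hff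
    have hr := reachable_of_mem (hfE i hi) (hfe i hi) (hf1 i hi) (hff ▸ hf2 j hj)
    have h1 : (H.avoidGraph e).dist (v i) (v (j + 1)) ≤ 1 := by
      by_cases h2 : v i = v (j + 1)
      · rw [h2, SimpleGraph.dist_self]; omega
      · have h3 : (H.avoidGraph e).Adj (v i) (v (j + 1)) :=
          ⟨h2, f i, hfE i hi, hfe i hi, hf1 i hi, hff ▸ hf2 j hj⟩
        exact (SimpleGraph.dist_eq_one_iff_adj.2 h3).le
    have h2 := hr.dist_triangle_left b
    rw [(hdist i hi.le).2, (hdist (j + 1) hj).2] at h2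
    omega
  have hfinj : ∀ i < p, ∀ j < p, f i = f j → i = j := by
    intro i hi j hj hij
    by_contra hcon
    rcases lt_or_gt_of_ne hcon with h1 | h1
    · exact hfinj' i hi j hj h1 hij
    · exact hfinj' j hj i hi h1 hij.symm
  -- The geodesic outside `e` from `a` to `b`, closed up by `e` itself, is a cycle of length `p +
  -- 1`.
  refine hcyc (p + 1) (fun i => if (i : ℕ) ≤ p then v i else a)
    (fun i => if (i : ℕ) < p then f i else e) ⟨⟨?_, ?_⟩, by omega, ?_, ?_, ?_⟩
  · intro i
    dsimp only
    split_ifs with hi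
    · rcases hi.lt_or_eq with hi | hi
      · exact H.subset_vertexSet_of_mem_edgeSet' (hfE i hi) (hf1 i hi)
      · rw [hi, hvp]; exact H.subset_vertexSet_of_mem_edgeSet' he hb
    · exact H.subset_vertexSet_of_mem_edgeSet' he ha
  · intro i
    simp only [Fin.val_castSucc, Fin.val_succ]
    have hip := Nat.lt_succ_iff.1 i.2
    rw [if_pos hip]
    by_cases hi : (i : ℕ) < p
    · simp only [hi, if_true, show (i : ℕ) + 1 ≤ p from hi]
      exact ⟨hfE i hi, hf1 i hi, hf2 i hi, (hadj i hi).1⟩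
    · have hip : (i : ℕ) = p := by omega
      simp only [hip, lt_self_iff_false, if_false, hvp, show ¬ p + 1 ≤ p by omega]
      exact ⟨he, hb, ha, Ne.symm hne⟩
  · intro i j hij
    dsimp only at hij
    rw [Fin.ext_iff]
    split_ifs at hij with h1 h2 h2
    · exact hfinj i h1 j h2 hij
    · exact absurd hij (hfe i h1)
    · exact absurd hij.symm (hfe j h2)
    · omega
  · intro i j hij
    simp only [Fin.val_castSucc] at hij
    rw [if_pos (by omega), if_pos (by omega)] at hij
    exact Fin.ext (hinj i (by omega) j (by omega) hij)
  · simp [hv0]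

lemma IsWalk.reachable {p : ℕ} {v : Fin (p + 1) → α} {f : Fin p → Set α} (hw : H.IsWalk v f)
    {e : Set α} {i j : Fin (p + 1)} (hij : i ≤ j)
    (he : ∀ l : Fin p, i ≤ l.castSucc → l.succ ≤ j → f l ≠ e) :
    (H.avoidGraph e).Reachable (v i) (v j) := by
  induction j using Fin.induction with
  | zero =>
    obtain rfl : i = 0 := Fin.le_zero_iff.1 hij
    exact SimpleGraph.Reachable.refl _
  | succ j ih =>
    rcases hij.lt_or_eq with h1 | rfl
    · have h2 : i ≤ j.castSucc := Fin.le_castSucc_iff.2 h1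
      refine (ih h2 fun l hl1 hl2 => he l hl1 (hl2.trans j.castSucc_lt_succ.le)).trans ?_
      obtain ⟨h3, h4, h5, -⟩ := hw.2 j
      exact reachable_of_mem h3 (he j h2 le_rfl) h4 h5
    · exact SimpleGraph.Reachable.refl _

/-- From every vertex of a connected hypergraph one reaches an edge without using it. -/
lemma exists_reachable (hc : H.IsConnected) {e : Set α} (he : e ∈ H.edgeSet) (hne : e.Nonempty)
    {a : α} (ha : a ∈ H.vertexSet) : ∃ w ∈ e, (H.avoidGraph e).Reachable w a := by
  obtain ⟨b, hb⟩ := hne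
  obtain ⟨p, v, f, ⟨hw, -⟩, hv0, hvp⟩ :=
    hc.2 b (H.subset_vertexSet_of_mem_edgeSet' he hb) a ha
  have key : ∀ j, ∃ w ∈ e, (H.avoidGraph e).Reachable w (v j) := by
    intro j
    induction j using Fin.induction with
    | zero => exact ⟨b, hb, by rw [hv0]⟩
    | succ j ih =>
      obtain ⟨h3, h4, h5, -⟩ := hw.2 j
      by_cases hfe : f j = e
      · exact ⟨_, hfe ▸ h5, SimpleGraph.Reachable.refl _⟩
      · obtain ⟨w, hwe, hwr⟩ := ih
        exact ⟨w, hwe, hwr.trans (reachable_of_mem h3 hfe h4 h5)⟩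
  exact hvp ▸ key (Fin.last p)

open GateTree

/-- A hypertree is described by its gate maps. -/
theorem IsHypertree.exists_gate [Fintype H.vertexSet] [DecidableEq H.vertexSet] [Fintype H.edgeSet]
    [DecidableEq H.edgeSet] (hH : H.IsHypertree) (hne : ∀ e ∈ H.edgeSet, e.Nonempty) :
    ∃ g : H.edgeSet → H.vertexSet → H.vertexSet, IsGateTree g ∧
      (∀ e v, g e v = v ↔ (v : α) ∈ (e : Set α)) ∧ ∀ u w : H.vertexSet, H.dist u w = gdist g u w := by
  have hex : ∀ (e : H.edgeSet) (a : H.vertexSet), ∃ w : H.vertexSet, (w : α) ∈ (e : Set α) ∧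
      (H.avoidGraph e).Reachable w a := by
    intro e a
    obtain ⟨w, hw, hwa⟩ := exists_reachable hH.1 e.2 (hne e e.2) a.2
    exact ⟨⟨w, H.subset_vertexSet_of_mem_edgeSet' e.2 hw⟩, hw, hwa⟩
  choose g hg1 hg2 using hex
  -- The gate of `a` in `e` is the only vertex of `e` that can be reached from `a` without using
  -- `e`.
  have huniq : ∀ (e : H.edgeSet) (a w : H.vertexSet), (w : α) ∈ (e : Set α) →
      (H.avoidGraph e).Reachable w a → g e a = w := by
    intro e a w hw hwa
    exact Subtype.ext (eq_of_reachable hH.2 e.2 (hg1 e a) hw ((hg2 e a).trans hwa.symm))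
  have hfix : ∀ e v, g e v = v ↔ (v : α) ∈ (e : Set α) := by
    intro e v
    constructor
    · intro h
      have := hg1 e v
      rwa [h] at this
    · exact fun h => huniq e v v h (SimpleGraph.Reachable.refl _)
  have hreach : ∀ (e : H.edgeSet) (a b : H.vertexSet), (H.avoidGraph e).Reachable a b →
      g e a = g e b := fun e a b hab => huniq e a _ (hg1 e b) ((hg2 e b).trans hab.symm)
  have hpath : ∀ (p : ℕ) (v : Fin (p + 1) → α) (f : Fin p → Set α) (hp : H.IsPath v f) (i : Fin p),
      g ⟨f i, (hp.1.2 i).1⟩ ⟨v 0, hp.1.1 0⟩ = ⟨v i.castSucc, hp.1.1 _⟩ ∧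
        g ⟨f i, (hp.1.2 i).1⟩ ⟨v (Fin.last p), hp.1.1 _⟩ = ⟨v i.succ, hp.1.1 _⟩ := by
    intro p v f hp i
    constructor
    · refine huniq _ _ _ (hp.1.2 i).2.1 (hp.1.reachable (Fin.zero_le _) fun l _ hl hli => ?_).symm
      rw [hp.2.2 hli] at hl
      exact absurd hl (not_le.2 i.castSucc_lt_succ)
    · refine huniq _ _ _ (hp.1.2 i).2.2.1 (hp.1.reachable (Fin.le_last _) fun l hl _ hli => ?_)
      rw [hp.2.2 hli] at hl
      exact absurd hl (not_le.2 i.castSucc_lt_succ)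
  refine ⟨g, ⟨fun e a => (hfix e _).2 (hg1 e a), ?_, ?_⟩, hfix, ?_⟩
  · intro e e' hee a b
    exact hreach e' _ _ (reachable_of_mem e.2 (fun h => hee (Subtype.ext h)) (hg1 e a) (hg1 e b))
  · intro a b hab
    obtain ⟨p, v, f, hp, hv0, hvp⟩ := hH.1.2 a a.2 b b.2
    obtain ⟨q, rfl⟩ : ∃ q, p = q + 1 := by
      refine Nat.exists_eq_succ_of_ne_zero ?_
      rintro rfl
      exact hab (Subtype.ext (hv0.symm.trans hvp))
    obtain ⟨h1, h2⟩ := hpath _ v f hp 0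
    have ha : (⟨v 0, hp.1.1 0⟩ : H.vertexSet) = a := Subtype.ext hv0
    have hb : (⟨v (Fin.last (q + 1)), hp.1.1 _⟩ : H.vertexSet) = b := Subtype.ext hvp
    rw [ha] at h1
    rw [hb] at h2
    refine ⟨_, h1.trans (Subtype.ext hv0), ?_⟩
    rw [h2]
    intro h3
    have h4 := congrArg Subtype.val h3
    simp only at h4
    rw [← hv0] at h4
    exact absurd (hp.2.1 h4) (Fin.succ_ne_zero _)
  · intro a b
    -- The edges of any path from `a` to `b` are exactly the edges separating `a` from `b`, so all
    -- such paths have the same length.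
    have hlen : ∀ p, H.HasPath a b p → p = gdist g a b := by
      rintro p ⟨v, f, hp, hv0, hvp⟩
      have ha : (⟨v 0, hp.1.1 0⟩ : H.vertexSet) = a := Subtype.ext hv0
      have hb : (⟨v (Fin.last p), hp.1.1 _⟩ : H.vertexSet) = b := Subtype.ext hvp
      have hsep : sep g a b
          = Finset.univ.image fun i : Fin p => (⟨f i, (hp.1.2 i).1⟩ : H.edgeSet) := by
        ext e
        simp only [mem_sep, Finset.mem_image, Finset.mem_univ, true_and]
        constructor
        · intro h1
          by_contra hcon
          push Not at hcon
          refine h1 (hreach e a b ?_)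
          rw [← hv0, ← hvp]
          exact hp.1.reachable (Fin.zero_le _) fun l _ _ hl => hcon l (Subtype.ext hl)
        · rintro ⟨i, rfl⟩
          obtain ⟨h1, h2⟩ := hpath _ v f hp i
          rw [ha] at h1
          rw [hb] at h2
          rw [h1, h2]
          intro h3
          exact (hp.1.2 i).2.2.2 (congrArg Subtype.val h3)
      rw [gdist, hsep, Finset.card_image_of_injective, Finset.card_univ, Fintype.card_fin]
      intro i j hij
      exact hp.2.2 (congrArg Subtype.val hij)
    obtain ⟨p, hp⟩ := hH.1.2 a a.2 b b.2
    have : {p | H.HasPath (a : α) b p} = {gdist g a b} := by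
      ext q
      rw [Set.mem_ofPred_eq, Set.mem_singleton_iff]
      exact ⟨hlen q, fun h => h ▸ hlen p hp ▸ hp⟩
    rw [dist, this, csInf_singleton]

end Hypergraph

/-! ### From gate maps to hypertrees -/

namespace Hypergraph

open GateTree

section Gate

variable {α : Type*} {H : Hypergraph α}

lemma distSpectralRadius_eq_rad [Finite H.vertexSet] [Fintype H.vertexSet]
    [DecidableEq H.vertexSet] {ι : Type*} [Fintype ι] {g : ι → H.vertexSet → H.vertexSet}
    (hd : ∀ u w : H.vertexSet, H.dist u w = gdist g u w) : H.distSpectralRadius = rad g := by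
  have h1 : H.distMatrix = distMat g := by
    ext u w
    simp [distMatrix, distMat, hd]
  have h2 : Fintype.ofFinite H.vertexSet = ‹Fintype H.vertexSet› := Subsingleton.elim _ _
  rw [distSpectralRadius, rad, h1, h2]

lemma degree_eq_deg {ι V : Type*} [Fintype ι] [DecidableEq V] {g : ι → V → V} {E : ι → Set α}
    (hEi : Function.Injective E) (hE : Set.range E = H.edgeSet) {v : V} {x : α}
    (hx : ∀ i, g i v = v ↔ x ∈ E i) : H.degree x = deg g v := by
  have h1 : {e | e ∈ H.edgeSet ∧ x ∈ e} = E '' ↑(Finset.univ.filter fun i => g i v = v) := by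
    ext e
    simp only [Set.mem_ofPred_eq, ← hE, Set.mem_range, Finset.coe_filter, Finset.mem_univ, true_and,
      Set.mem_image, hx]
    constructor
    · rintro ⟨⟨i, rfl⟩, h⟩
      exact ⟨i, h, rfl⟩
    · rintro ⟨i, h, rfl⟩
      exact ⟨⟨i, rfl⟩, h⟩
  rw [degree, h1, Set.ncard_image_of_injective _ hEi, Set.ncard_coe_finset, deg]

lemma ncard_edgeSet {ι : Type*} [Fintype ι] {E : ι → Set α} (hEi : Function.Injective E)
    (hE : Set.range E = H.edgeSet) : H.edgeSet.ncard = Fintype.card ι := by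
  rw [← hE, ← Set.image_univ, Set.ncard_image_of_injective _ hEi, Set.ncard_univ,
    Nat.card_eq_fintype_card]

/-- Gate maps describe a hypertree. -/
theorem isHypertree_of_gate [Fintype α] [DecidableEq α] {ι : Type*} [Fintype ι] [DecidableEq ι]
    [Nonempty ι] [Nonempty α] {g : ι → α → α} (h : IsGateTree g) {E : ι → Set α}
    (hEi : Function.Injective E) (hE : Set.range E = H.edgeSet) (hV : H.vertexSet = Set.univ)
    (hfix : ∀ i v, g i v = v ↔ v ∈ E i) : H.IsHypertree := by
  refine ⟨⟨by rw [hV]; exact Set.univ_nonempty, fun a _ b _ => ?_⟩, ?_⟩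
  · obtain ⟨u, e, hs, h0, hp, -⟩ := exists_spine h a b
    refine ⟨gdist g a b, fun i => u i, fun j => E (e j), ⟨⟨fun i => by rw [hV]; trivial, fun i =>
      ⟨hE ▸ ⟨_, rfl⟩, (hfix _ _).1 (hs.left i i.2), (hfix _ _).1 (hs.right i i.2), hs.ne i i.2⟩⟩,
      ?_, ?_⟩, h0, hp⟩
    · intro i j hij
      exact Fin.ext (hs.injOn h (by omega) (by omega) hij)
    · intro i j hij
      exact Fin.ext (hs.inj i i.2 j j.2 (hEi hij))
  · rintro p v e ⟨hw, hp2, hinj, -, hv⟩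
    obtain ⟨q, rfl⟩ : ∃ q, p = q + 1 := ⟨p - 1, by omega⟩
    have h1 : ∀ i, ∃ f, E f = e i := fun i => by
      have := (hw.2 i).1
      rwa [← hE] at this
    choose f hf using h1
    have hl : ∀ i, g (f i) (v i.castSucc) = v i.castSucc := fun i =>
      (hfix _ _).2 (hf i ▸ (hw.2 i).2.1)
    have hr : ∀ i, g (f i) (v i.succ) = v i.succ := fun i => (hfix _ _).2 (hf i ▸ (hw.2 i).2.2.1)
    -- Along the rest of the cycle, whose edges all differ from `f 0`, the gate in `f 0` stays the
    -- second vertex. Back at the first vertex, this contradicts that the first two vertices are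
    -- distinct.
    have key : ∀ i : Fin (q + 1), g (f 0) (v i.succ) = v (Fin.succ 0) := by
      intro i
      induction i using Fin.induction with
      | zero => exact hr 0
      | succ i ih =>
        rw [← ih]
        refine (const' h (fun h2 => ?_) (hl i.succ) (hr i.succ)).symm
        have h3 : e i.succ = e 0 := by rw [← hf, ← hf, h2]
        exact absurd (hinj h3) (Fin.succ_ne_zero i)
    have h2 := key (Fin.last q)
    rw [Fin.succ_last, ← hv] at h2
    exact (hw.2 0).2.2.2 ((hl 0).symm.trans h2)

/-- Every other edge sees an edge through a single vertex, so distinct edges cannot share two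
vertices. -/
lemma fix_injective {ι V : Type*} [Fintype ι] [DecidableEq ι] [Fintype V] [DecidableEq V]
    {g : ι → V → V} (h : IsGateTree g)
    (h2 : ∀ i, 2 ≤ (edge g i).card) : Function.Injective fun i => {v | g i v = v} := by
  intro i j hij
  by_contra hne
  obtain ⟨a, ha, b, hb, hab⟩ := Finset.one_lt_card.1 (h2 i)
  rw [mem_edge] at ha hb
  have h3 : ∀ v, g i v = v ↔ g j v = v := fun v => Set.ext_iff.1 hij v
  have h4 := const' h hne ha hb
  rw [(h3 a).1 ha, (h3 b).1 hb] at h4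
  exact hab h4

end Gate

/-! ### Membership in the relaxed class -/

section Class

variable {α : Type*} {T : Hypergraph α} {k m n : ℕ}

/-- With `m` edges, the degrees sum to `k * m`, there are `(k - 1) * m + 1` vertices, and each has
degree one or two; so `m - 1` of them have degree two. -/
lemma card_big_of_deg_le_two {ι V : Type*} [Fintype ι] [DecidableEq ι] [Fintype V] [DecidableEq V]
    {g : ι → V → V} (h : IsGateTree g) [Nontrivial V] (hk : 1 ≤ k) (hu : ∀ i, (edge g i).card = k)
    (hd : ∀ v, deg g v ≤ 2) :
    (Finset.univ.filter fun v => deg g v = 2).card + 1 = Fintype.card ι := by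
  have h1 : ∀ v, deg g v = 1 + if deg g v = 2 then 1 else 0 := by
    intro v
    have h2 := hd v
    obtain ⟨w, hw⟩ := exists_ne v
    have h3 := deg_pos h hw.symm
    split_ifs <;> omega
  have h2 := sum_deg g
  obtain ⟨v⟩ : Nonempty V := inferInstance
  have h3 := card_vertices h v
  simp only [hu, Finset.sum_const, Finset.card_univ, smul_eq_mul] at h2 h3
  rw [Finset.sum_congr rfl fun v _ => h1 v, Finset.sum_add_distrib, ← Finset.card_filter,
    Finset.sum_const, Finset.card_univ, smul_eq_mul, mul_one, h3] at h2
  obtain ⟨l, rfl⟩ : ∃ l, k = l + 1 := ⟨k - 1, by omega⟩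
  rw [Nat.add_sub_cancel, mul_add] at h2
  omega

/-- If the maximum degree is at least three, the `n` vertices attaining it all count. Otherwise `m -
1` vertices would attain the maximum degree two, but `n < m - 1`. -/
theorem IsUniformHypertreeWith.exists_inClass [Fintype T.vertexSet] [DecidableEq T.vertexSet]
    [Fintype T.edgeSet] [DecidableEq T.edgeSet] (hk : 2 ≤ k) (hn : 2 ≤ n) (hnm : n ≤ (m - 1) / 2)
    (hT : T.IsUniformHypertreeWith k m n) :
    Fintype.card T.edgeSet = m ∧ ∃ g : T.edgeSet → T.vertexSet → T.vertexSet, InClass k n g ∧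
      (∀ e v, g e v = v ↔ (v : α) ∈ (e : Set α)) ∧
      ∀ u w : T.vertexSet, T.dist u w = gdist g u w := by
  obtain ⟨htree, hunif, hm, hmax⟩ := hT
  obtain ⟨g, h, hfix, hd⟩ := htree.exists_gate fun e he => by
    rw [Set.nonempty_iff_ne_empty]
    rintro rfl
    have := hunif _ he
    rw [Set.ncard_empty] at this
    omega
  have hcard : Fintype.card T.edgeSet = m := by
    rw [← hm, ← Nat.card_eq_fintype_card, Nat.card_coe_set_eq]
  have hu : ∀ e, (edge g e).card = k := by
    intro e
    rw [← hunif e e.2, ← Set.ncard_coe_finset]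
    have : (e : Set α) = Subtype.val '' (↑(edge g e) : Set T.vertexSet) := by
      ext x
      simp only [Set.mem_image, Finset.mem_coe, mem_edge, hfix]
      constructor
      · intro hx
        exact ⟨⟨x, T.subset_vertexSet_of_mem_edgeSet' e.2 hx⟩, hx, rfl⟩
      · rintro ⟨v, hv, rfl⟩
        exact hv
    rw [this, Set.ncard_image_of_injective _ Subtype.val_injective]
  have hdeg : ∀ v : T.vertexSet, T.degree v = deg g v := fun v =>
    degree_eq_deg Subtype.val_injective Subtype.range_coe fun e => hfix e v
  have hmaxv : T.maxDegreeVertices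
      = Subtype.val '' {v : T.vertexSet | ∀ w, deg g w ≤ deg g v} := by
    ext x
    simp only [maxDegreeVertices, Set.mem_ofPred_eq, Set.mem_image]
    constructor
    · rintro ⟨hx, h1⟩
      refine ⟨⟨x, hx⟩, fun w => ?_, rfl⟩
      rw [← hdeg, ← hdeg]
      exact h1 w w.2
    · rintro ⟨v, hv, rfl⟩
      refine ⟨v.2, fun w hw => ?_⟩
      rw [hdeg v, hdeg ⟨w, hw⟩]
      exact hv _
  rw [hmaxv, Set.ncard_image_of_injective _ Subtype.val_injective] at hmax
  refine ⟨hcard, g, ⟨h, hu, ?_⟩, hfix, hd⟩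
  have : Nontrivial T.vertexSet := by
    obtain ⟨e⟩ : Nonempty T.edgeSet := by
      rw [← Fintype.card_pos_iff, hcard]; omega
    obtain ⟨a, -, b, -, hab⟩ := Finset.one_lt_card.1 ((hu e).symm ▸ hk : 1 < (edge g e).card)
    exact ⟨a, b, hab⟩
  by_cases hd3 : ∃ v, 3 ≤ deg g v
  · obtain ⟨v, hv⟩ := hd3
    rw [← hmax, ← Set.ncard_coe_finset]
    refine Set.ncard_le_ncard (fun w hw => ?_) (Set.toFinite _)
    rw [Finset.mem_coe, mem_big]
    exact hv.trans (hw v)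
  · push Not at hd3
    have h1 := card_big_of_deg_le_two h (by omega) hu fun v => Nat.lt_succ_iff.1 (hd3 v)
    rw [hcard] at h1
    have h2 : {v : T.vertexSet | ∀ w, deg g w ≤ deg g v}
        = ↑(Finset.univ.filter fun v => deg g v = 2) := by
      obtain ⟨w₀, hw₀⟩ := Finset.card_pos.1
        (show 0 < (Finset.univ.filter fun v => deg g v = 2).card by omega)
      rw [Finset.mem_filter_univ] at hw₀
      ext v
      rw [Set.mem_ofPred_eq, Finset.mem_coe, Finset.mem_filter_univ]
      constructor
      · intro hv
        have h3 := hv w₀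
        have h4 := hd3 v
        omega
      · intro hv w
        have h4 := hd3 w
        omega
    rw [h2, Set.ncard_coe_finset] at hmax
    omega

end Class

end Hypergraph

/-! ### The caterpillar belongs to the class -/

namespace Hypergraph

open GateTree

section Caterpillar

variable {k L : ℕ} {c : Fin (L + 1) → ℕ}

lemma deg_cat_inl (i : Fin (L + 1)) : deg (catGate k L c) (.inl i)
    = (if (i : ℕ) < L then 1 else 0) + (if 0 < (i : ℕ) then 1 else 0) + c i := by
  have h1 : ∀ j : Fin L, (catGate k L c (.inl j) (.inl i) = .inl i) ↔
      ((i : ℕ) = j ∨ (i : ℕ) = j + 1) := by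
    intro j
    rw [catGate_path_inl]
    split_ifs with h
    · simp [Fin.ext_iff]; omega
    · simp [Fin.ext_iff]; omega
  -- At `i = 0` the truncated difference `i - 1` is `0`; the inner condition `0 < i` discards this
  -- spurious match.
  have h2 : ∀ j : ℕ, (if (i : ℕ) = j ∨ (i : ℕ) = j + 1 then 1 else 0)
      = (if (i : ℕ) = j then 1 else 0) + if (i : ℕ) - 1 = j then (if 0 < (i : ℕ) then 1 else 0) else 0 := by
    intro j
    split_ifs <;> omega
  rw [deg, Finset.card_filter, Fintype.sum_sum_type, Fintype.sum_sigma]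
  simp only [h1, h2, catGate_star_inl, Sum.inl.injEq]
  rw [Finset.sum_add_distrib, Fin.sum_univ_eq_sum_range (fun j => if (i : ℕ) = j then 1 else 0) L,
    Fin.sum_univ_eq_sum_range
      (fun j => if (i : ℕ) - 1 = j then (if 0 < (i : ℕ) then 1 else 0) else 0) L,
    Finset.sum_ite_eq, Finset.sum_ite_eq]
  simp only [Finset.sum_const, Finset.card_univ, Fintype.card_fin, smul_eq_mul, mul_ite, mul_one,
    mul_zero, Finset.sum_ite_eq', Finset.mem_univ, if_true, Finset.mem_range]
  have := i.2
  split_ifs <;> omega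

lemma deg_cat_inr (y : (Fin L × Fin (k - 2)) ⊕ ((i : Fin (L + 1)) × Fin (c i) × Fin (k - 1))) :
    deg (catGate k L c) (.inr y) = 1 := by
  rw [deg, Finset.card_eq_one]
  rcases y with ⟨j, x⟩ | ⟨i, t, x⟩
  · refine ⟨.inl j, ?_⟩
    ext f
    rw [Finset.mem_filter_univ, Finset.mem_singleton]
    rcases f with j' | s
    · rw [catGate_path_leaf]
      split_ifs with h1 h2
      · simp [h1]
      · simp [Ne.symm h1]
      · simp [Ne.symm h1]
    · simp
  · refine ⟨.inr ⟨i, t⟩, ?_⟩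
    ext f
    rw [Finset.mem_filter_univ, Finset.mem_singleton]
    rcases f with j' | s
    · rw [catGate_path_star]
      split_ifs <;> simp
    · rw [catGate_star_star]
      split_ifs with h1
      · simp [h1]
      · simp [Ne.symm h1]

/-- The vertex set of an edge of a caterpillar. -/
def catEdgeSet (k L : ℕ) (c : Fin (L + 1) → ℕ) (i : CatEdge L c) :
    Set (StarCaterpillarVertex k L c) := {v | catGate k L c i v = v}

lemma catEdgeSet_injective (hk : 2 ≤ k) : Function.Injective (catEdgeSet k L c) :=
  fix_injective (isGateTree_catGate k L c) fun i => by rw [card_edge_cat hk]; exact hk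

lemma range_catEdgeSet : Set.range (catEdgeSet k L c) = (starCaterpillar k L c).edgeSet := by
  have h1 : ∀ j, catEdgeSet k L c (.inl j) = starCaterpillarPathEdge k L c j :=
    fun j => Set.ext fun v => mem_pathEdge.symm
  have h2 : ∀ i t, catEdgeSet k L c (.inr ⟨i, t⟩) = starCaterpillarStarEdge k L c i t :=
    fun i t => Set.ext fun v => mem_starEdge.symm
  ext s
  constructor
  · rintro ⟨j | ⟨i, t⟩, rfl⟩
    · exact Or.inl ⟨j, h1 j⟩
    · exact Or.inr ⟨i, t, h2 i t⟩
  · rintro (⟨j, rfl⟩ | ⟨i, t, rfl⟩)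
    · exact ⟨_, h1 j⟩
    · exact ⟨_, h2 i t⟩

lemma isHypertree_starCaterpillar (hk : 2 ≤ k) (hL : 1 ≤ L) :
    (starCaterpillar k L c).IsHypertree :=
  have : Nonempty (CatEdge L c) := ⟨.inl ⟨0, hL⟩⟩
  isHypertree_of_gate (isGateTree_catGate k L c) (catEdgeSet_injective hk) range_catEdgeSet rfl
    fun _ _ => Iff.rfl

lemma isUniform_starCaterpillar (hk : 2 ≤ k) : (starCaterpillar k L c).IsUniform k := by
  intro e he
  rw [← range_catEdgeSet] at he
  obtain ⟨i, rfl⟩ := he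
  have h1 : catEdgeSet k L c i = ↑(edge (catGate k L c) i) := by
    ext v
    simp [catEdgeSet]
  rw [h1, Set.ncard_coe_finset, card_edge_cat hk]

theorem distSpectralRadius_starCaterpillar (hk : 2 ≤ k) (hL : 1 ≤ L)
    [Finite (starCaterpillar k L c).vertexSet] :
    (starCaterpillar k L c).distSpectralRadius = rad (catGate k L c) := by
  classical
  set C := starCaterpillar k L c
  let _ : Fintype C.vertexSet := Fintype.ofFinite _
  let _ : Fintype C.edgeSet := Fintype.ofFinite _
  obtain ⟨g, h, hfix, hd⟩ := (isHypertree_starCaterpillar (c := c) hk hL).exists_gate fun e he => by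
    rw [← range_catEdgeSet] at he
    obtain ⟨i, rfl⟩ := he
    exact ⟨catGate k L c i (.inl 0), (isGateTree_catGate k L c).idem i _⟩
  rw [distSpectralRadius_eq_rad hd]
  have hE : IsEmb (catGate k L c) g (fun v => ⟨v, trivial⟩)
      (fun i => ⟨catEdgeSet k L c i, range_catEdgeSet ▸ ⟨i, rfl⟩⟩) := by
    refine ⟨fun i j hij => catEdgeSet_injective hk (congrArg Subtype.val hij), fun i v hv => ?_,
      fun i u v _ _ huv => congrArg Subtype.val huv⟩
    exact (hfix _ _).2 hv
  refine (rad_eq_of_gdist_eq (Equiv.ofBijective _ ⟨hE.injective (isGateTree_catGate k L c) h, ?_⟩)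
    (hE.gdist (isGateTree_catGate k L c) h)).symm
  exact fun v => ⟨v, rfl⟩

lemma sum_caterpillarStarSize {a b : ℕ} (hab : a + b < L) :
    ∑ i, caterpillarStarSize L 3 a b i = a + b := by
  have h1 : ∀ i : Fin (L + 1), caterpillarStarSize L 3 a b i
      = if (1 ≤ (i : ℕ) ∧ (i : ℕ) < L) ∧ ((i : ℕ) ≤ a ∨ L ≤ i + b) then 1 else 0 := by
    intro i
    rw [caterpillarStarSize]
    split_ifs <;> omega
  simp_rw [h1]
  rw [Fin.sum_univ_eq_sum_range
    (fun i => if (1 ≤ i ∧ i < L) ∧ (i ≤ a ∨ L ≤ i + b) then 1 else 0) (L + 1), ← Finset.card_filter]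
  refine card_segments hab fun i => ?_
  rw [Finset.mem_filter, Finset.mem_range]
  omega

theorem isUniformHypertreeWith_caterpillar (hk : 2 ≤ k) {a b : ℕ} (hab : a + b < L)
    (h0 : 0 < a + b) :
    (caterpillar k L 3 a b).IsUniformHypertreeWith k (L + (a + b)) (a + b) := by
  set c := caterpillarStarSize L 3 a b with hc
  have hsum : ∑ i, c i = a + b := sum_caterpillarStarSize hab
  refine ⟨isHypertree_starCaterpillar hk (by omega), isUniform_starCaterpillar hk, ?_, ?_⟩
  · rw [ncard_edgeSet (catEdgeSet_injective hk) range_catEdgeSet, Fintype.card_sum,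
      Fintype.card_sigma, Fintype.card_fin]
    simp only [Fintype.card_fin]
    rw [hsum]
  have hdeg : ∀ v, (starCaterpillar k L c).degree v = deg (catGate k L c) v := fun v =>
    degree_eq_deg (catEdgeSet_injective hk) range_catEdgeSet fun _ => Iff.rfl
  have hc1 : ∀ i, c i = 1 ∧ 1 ≤ (i : ℕ) ∧ (i : ℕ) < L ∨ c i = 0 := by
    intro i
    rw [hc, caterpillarStarSize]
    split_ifs <;> omega
  have hle : ∀ v, deg (catGate k L c) v ≤ 3 := by
    rintro (i | y)
    · rw [deg_cat_inl]
      have := hc1 i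
      split_ifs <;> omega
    · rw [deg_cat_inr]; omega
  have h3 : ∀ i, deg (catGate k L c) (.inl i) = 3 ↔ c i = 1 := by
    intro i
    rw [deg_cat_inl]
    have := hc1 i
    split_ifs <;> omega
  obtain ⟨i₀, hi₀⟩ : ∃ i, c i = 1 := by
    by_contra hcon
    push Not at hcon
    have : ∑ i, c i = 0 := Finset.sum_eq_zero fun i _ => (hc1 i).resolve_left fun h => hcon i h.1
    omega
  have hmax : (starCaterpillar k L c).maxDegreeVertices
      = Sum.inl '' ↑(Finset.univ.filter fun i => c i = 1) := by
    ext v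
    simp only [maxDegreeVertices, Set.mem_ofPred_eq, hdeg, Finset.coe_filter, Finset.mem_univ,
      true_and, Set.mem_image]
    constructor
    · rintro ⟨-, hv⟩
      have h4 := hv (.inl i₀) trivial
      rw [(h3 i₀).2 hi₀] at h4
      rcases v with i | y
      · exact ⟨i, (h3 i).1 (le_antisymm (hle _) h4), rfl⟩
      · rw [deg_cat_inr] at h4; omega
    · rintro ⟨i, hi, rfl⟩
      refine ⟨trivial, fun w _ => ?_⟩
      rw [(h3 i).2 hi]
      exact hle w
  rw [hmax, Set.ncard_image_of_injective _ Sum.inl_injective, Set.ncard_coe_finset,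
    Finset.card_filter, ← hsum]
  refine Finset.sum_congr rfl fun i _ => ?_
  rcases hc1 i with h | h <;> simp [h]

end Caterpillar

/-! ### Isomorphism with the caterpillar -/

section Isomorphism

variable {α : Type*} {T : Hypergraph α} {k L : ℕ} {c : Fin (L + 1) → ℕ}

lemma isIsomorphic_of_isEmb [Fintype T.vertexSet] [DecidableEq T.vertexSet]
    [Fintype T.edgeSet] [DecidableEq T.edgeSet] {g : T.edgeSet → T.vertexSet → T.vertexSet}
    (h : IsGateTree g) (hfix : ∀ e v, g e v = v ↔ (v : α) ∈ (e : Set α))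
    (hu : ∀ e, (edge g e).card = k) (hk : 2 ≤ k) {φ : StarCaterpillarVertex k L c → T.vertexSet}
    {ε : CatEdge L c → T.edgeSet} (hφ : IsEmb (catGate k L c) g φ ε) (hb : Function.Bijective φ)
    (hε : Function.Surjective ε) : T.IsIsomorphic (starCaterpillar k L c) := by
  have h₀ := isGateTree_catGate k L c
  set ψ : StarCaterpillarVertex k L c → α := fun x => φ x with hψ
  have hψi : Function.Injective ψ := Subtype.val_injective.comp hb.1
  have hψr : ∀ x, x ∈ T.vertexSet → ∃ y, ψ y = x := fun x hx => by
    obtain ⟨y, hy⟩ := hb.2 ⟨x, hx⟩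
    exact ⟨y, congrArg Subtype.val hy⟩
  have hleft : ∀ y, Function.invFun ψ (ψ y) = y := Function.leftInverse_invFun hψi
  have hedge : ∀ i, ψ '' catEdgeSet k L c i = ε i := by
    intro i
    have h1 := hφ.map_edge h₀ h (i := i) (by rw [card_edge_cat hk, hu])
    ext x
    constructor
    · rintro ⟨y, hy, rfl⟩
      exact (hfix _ _).1 (hφ.mem i y hy)
    · intro hx
      have hxV := T.subset_vertexSet_of_mem_edgeSet' (ε i).2 hx
      have h2 : (⟨x, hxV⟩ : T.vertexSet) ∈ edge g (ε i) := mem_edge.2 ((hfix _ _).2 hx)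
      rw [← h1, Finset.mem_image] at h2
      obtain ⟨y, hy, hyx⟩ := h2
      exact ⟨y, mem_edge.1 hy, congrArg Subtype.val hyx⟩
  -- An isomorphism is a map on all of `α`; `Function.invFun` takes irrelevant values outside the
  -- vertices of `T`.
  refine ⟨Function.invFun ψ, ⟨fun _ _ => trivial, ?_, ?_⟩, ?_⟩
  · intro x hx x' hx' hxx
    obtain ⟨y, rfl⟩ := hψr x hx
    obtain ⟨y', rfl⟩ := hψr x' hx'
    rw [hleft, hleft] at hxx
    rw [hxx]
  · exact fun y _ => ⟨ψ y, (φ y).2, hleft y⟩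
  · intro s hs
    obtain ⟨t, rfl⟩ : ∃ t, ψ '' t = s := by
      refine ⟨ψ ⁻¹' s, Set.image_preimage_eq_of_subset fun x hx => ?_⟩
      exact hψr x (hs hx)
    have h1 : Function.invFun ψ '' (ψ '' t) = t := by
      rw [Set.image_image]
      simp [hleft]
    rw [h1, ← range_catEdgeSet]
    constructor
    · intro ht
      obtain ⟨i, hi⟩ := hε ⟨_, ht⟩
      exact ⟨i, hψi.image_injective (by rw [hedge, hi])⟩
    · rintro ⟨i, rfl⟩
      rw [hedge]
      exact (ε i).2

lemma rad_eq_of_isIsomorphic [Fintype T.vertexSet] [DecidableEq T.vertexSet]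
    [Fintype T.edgeSet] [DecidableEq T.edgeSet] {g : T.edgeSet → T.vertexSet → T.vertexSet}
    (h : IsGateTree g) (hfix : ∀ e v, g e v = v ↔ (v : α) ∈ (e : Set α))
    (hiso : T.IsIsomorphic (starCaterpillar k L c)) : rad g = rad (catGate k L c) := by
  have h₀ := isGateTree_catGate k L c
  obtain ⟨f, ⟨-, hfi, hfs⟩, hfE⟩ := hiso
  have h1 : ∀ e : T.edgeSet, ∃ i, catEdgeSet k L c i = f '' e := by
    intro e
    have := (hfE e (T.subset_vertexSet_of_mem_edgeSet' e.2)).1 e.2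
    rwa [← range_catEdgeSet] at this
  choose ε hε using h1
  have hφ : IsEmb g (catGate k L c) (fun v => f v) ε := by
    refine ⟨fun e e' hee => Subtype.ext ?_, fun e v hv => ?_, fun e u v _ _ huv =>
      Subtype.ext (hfi u.2 v.2 huv)⟩
    · have h2 : f '' (e : Set α) = f '' e' := by rw [← hε, ← hε, hee]
      exact (hfi.image_eq_image_iff (T.subset_vertexSet_of_mem_edgeSet' e.2)
        (T.subset_vertexSet_of_mem_edgeSet' e'.2)).1 h2
    · have h2 : f v ∈ catEdgeSet k L c (ε e) := by
        rw [hε]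
        exact ⟨v, (hfix e v).1 hv, rfl⟩
      exact h2
  refine rad_eq_of_gdist_eq (Equiv.ofBijective _ ⟨hφ.injective h h₀, fun y => ?_⟩)
    (hφ.gdist h h₀)
  obtain ⟨x, hx, hxy⟩ := hfs (Set.mem_univ y)
  exact ⟨⟨x, hx⟩, hxy⟩

end Isomorphism

end Hypergraph

/-! ### The main theorem -/

theorem mainTheorem6 (k m n : ℕ) (hk : 2 ≤ k) (hn : 2 ≤ n) (hnm : n ≤ (m - 1) / 2) :
    (Hypergraph.caterpillar k (m - n) 3 (n / 2) ((n + 1) / 2)).IsUniformHypertreeWith k m n ∧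
      ∀ {α : Type*} (T : Hypergraph α) [Finite T.vertexSet], T.IsUniformHypertreeWith k m n →
        T.distSpectralRadius ≤
            (Hypergraph.caterpillar k (m - n) 3 (n / 2) ((n + 1) / 2)).distSpectralRadius ∧
          (T.distSpectralRadius =
              (Hypergraph.caterpillar k (m - n) 3 (n / 2) ((n + 1) / 2)).distSpectralRadius ↔
            T.IsIsomorphic (Hypergraph.caterpillar k (m - n) 3 (n / 2) ((n + 1) / 2))) := by
  classical
  refine ⟨?_, ?_⟩
  · have h1 := Hypergraph.isUniformHypertreeWith_caterpillar hk (L := m - n) (a := n / 2)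
      (b := (n + 1) / 2) (by omega) (by omega)
    rwa [show n / 2 + (n + 1) / 2 = n by omega, show m - n + n = m by omega] at h1
  intro α T _ hT
  let _ : Fintype T.vertexSet := Fintype.ofFinite _
  have : Finite T.edgeSet :=
    ((Set.toFinite T.vertexSet).powerset.subset fun e he =>
      T.subset_vertexSet_of_mem_edgeSet' he).to_subtype
  let _ : Fintype T.edgeSet := Fintype.ofFinite _
  obtain ⟨hm, g, hg, hfix, hd⟩ := hT.exists_inClass hk hn hnm
  have : Nontrivial T.vertexSet := by
    obtain ⟨e⟩ : Nonempty T.edgeSet := by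
      rw [← Fintype.card_pos_iff, hm]; omega
    exact hg.nontrivial hk e
  have hshape : ∀ g' : T.edgeSet → T.vertexSet → T.vertexSet, GateTree.IsExtremal k n g' →
      ∃ φ ε, GateTree.IsEmb (GateTree.catGate k (m - n)
        (Hypergraph.caterpillarStarSize (m - n) 3 (n / 2) ((n + 1) / 2))) g' φ ε ∧
        Function.Bijective φ ∧ Function.Surjective ε := by
    intro g' hg'
    have := hg'.exists_emb hk
    rwa [hm] at this
  rw [Hypergraph.distSpectralRadius_eq_rad hd,
    Hypergraph.distSpectralRadius_starCaterpillar hk (by omega)]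
  have hle : GateTree.rad g ≤ GateTree.rad (GateTree.catGate k (m - n)
      (Hypergraph.caterpillarStarSize (m - n) 3 (n / 2) ((n + 1) / 2))) ∧
      (GateTree.rad g = GateTree.rad (GateTree.catGate k (m - n)
        (Hypergraph.caterpillarStarSize (m - n) 3 (n / 2) ((n + 1) / 2))) →
        GateTree.IsExtremal k n g) := by
    -- Gate maps on the vertices and edges of `T` form a finite set, so a maximizer `g'` exists. It
    -- is a copy of the caterpillar, so its radius is that of the caterpillar, and equality makes
    -- `g` itself extremal.
    have : Nonempty {g' : T.edgeSet → T.vertexSet → T.vertexSet // GateTree.InClass k n g'} :=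
      ⟨⟨g, hg⟩⟩
    obtain ⟨⟨g', hg'⟩, hmax⟩ := Finite.exists_max fun g' :
      {g' : T.edgeSet → T.vertexSet → T.vertexSet // GateTree.InClass k n g'} => GateTree.rad g'.1
    obtain ⟨φ, ε, hφ, hb, -⟩ := hshape g' ⟨hg', fun g'' h => hmax ⟨g'', h⟩⟩
    rw [GateTree.rad_eq_of_gdist_eq (Equiv.ofBijective φ hb)
      (hφ.gdist (GateTree.isGateTree_catGate _ _ _) hg'.tree)]
    exact ⟨hmax ⟨g, hg⟩, fun h => ⟨hg, fun g'' h'' => h ▸ hmax ⟨g'', h''⟩⟩⟩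
  refine ⟨hle.1, fun h => ?_, Hypergraph.rad_eq_of_isIsomorphic hg.tree hfix⟩
  obtain ⟨φ, ε, hφ, hb, hε⟩ := hshape g (hle.2 h)
  exact Hypergraph.isIsomorphic_of_isEmb hg.tree hfix hg.unif hk hφ hb hε
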